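/- Graphs are finite and simple. For a graph $G$, a set $X\subseteq V(G)$ and an integer $r\ge 0$, let $B_G(X,r)$ be the set of vertices of $G$ at distance at most $r$ in $G$ from some vertex of $X$, and let $G-A$ be the graph obtained from $G$ by deleting the vertices of $A\subseteq V(G)$. For a positive integer $d$, a distance-$d$ packing of two cycles in $G$ is a pair of distinct cycles of $G$ such that $G$ has no path of length at most $d$ (a single vertex being a path of length $0$) between them. Theorem. There is an algorithm which, given a positive integer $d$ and a graph $G$, finds one of the following: 1. a distance-$d$ packing of two cycles in $G$; 2. sets $X_1,X_2\subseteq V(G)$ with $|X_1|\le 12(d+1)$ and $|X_2|\le 12$ such that both $G-B_G(X_1,2d)$ and $G-B_G(X_2,3d)$ are forests. The algorithm is a single program, the same for all $d$ and $G$, for a random access machine whose arithmetic operations are addition and truncated subtraction of natural numbers, each at unit cost. Its input is the number $|V(G)|$, the integer $d$ and the adjacency matrix of $G$, and its number of elementary steps is bounded by a polynomial in $|V(G)|$ that does not depend on $d$. -/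

import Mathlib

/-! ### Cycles, packings, balls, forests -/

namespace CyclePacking

section Graphs

variable {V : Type*} (G : SimpleGraph V)

/-- A subgraph of `G` that is a cycle. -/
def IsCycleSubgraph (H : G.Subgraph) : Prop :=
  ∃ (v : V) (c : G.Walk v v), c.IsCycle ∧ c.toSubgraph = H

/-- A set `F` of cycles of `G` is a distance-`d` packing if `G` has no path of length at most `d`
between any two distinct cycles of `F` (a path of length `0` is a single vertex). -/
def IsDistancePacking (d : ℕ) (F : Set G.Subgraph) : Prop :=
  (∀ C ∈ F, IsCycleSubgraph G C) ∧
    ∀ C ∈ F, ∀ D ∈ F, C ≠ D →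
      ¬ ∃ u ∈ C.verts, ∃ v ∈ D.verts, ∃ q : G.Walk u v, q.IsPath ∧ q.length ≤ d

/-- `B_G(X, r)`: the vertices at distance at most `r` from some vertex of `X`. -/
def ball (X : Set V) (r : ℕ) : Set V :=
  {u | ∃ v ∈ X, G.edist u v ≤ (r : ℕ∞)}

/-- `G - A` is a forest. -/
def IsForestOutside (A : Set V) : Prop :=
  (G.induce Aᶜ).IsAcyclic

end Graphs

/-! ### A random access machine with a step count

A program has finitely many scalar variables and two-dimensional arrays, all holding natural
numbers. Variables and arrays are named by literals, array positions are computed. The arithmetic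
is addition and truncated subtraction only (no multiplication), so that `t` steps produce numbers
of `O(t)` more bits than those of the input, and time on this machine is polynomially related to
time on a Turing machine. -/

/-- Memory contents: `var x` is the value of variable `x`, and `arr a i j` is the entry of the
array `a` at position `(i, j)`. -/
@[ext]
structure Store where
  var : ℕ → ℕ
  arr : ℕ → ℕ → ℕ → ℕ

namespace Store

def setVar (σ : Store) (x k : ℕ) : Store :=
  { σ with var := fun y => if y = x then k else σ.var y }

def setArr (σ : Store) (a i j k : ℕ) : Store :=
  { σ with arr := fun b i' j' => if b = a ∧ i' = i ∧ j' = j then k else σ.arr b i' j' }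

end Store

inductive Expr where
  | lit (k : ℕ)
  | var (x : ℕ)
  | arr (a : ℕ) (i j : Expr)
  | add (e f : Expr)
  | sub (e f : Expr)

namespace Expr

def eval (σ : Store) : Expr → ℕ
  | lit k => k
  | var x => σ.var x
  | arr a i j => σ.arr a (i.eval σ) (j.eval σ)
  | add e f => e.eval σ + f.eval σ
  | sub e f => e.eval σ - f.eval σ

/-- The number of elementary operations that an evaluation of the expression takes. -/
def cost : Expr → ℕ
  | lit _ => 1
  | var _ => 1
  | arr _ i j => i.cost + j.cost + 1
  | add e f => e.cost + f.cost + 1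
  | sub e f => e.cost + f.cost + 1

end Expr

inductive Prog where
  | skip
  | setVar (x : ℕ) (e : Expr)
  | setArr (a : ℕ) (i j e : Expr)
  | seq (P Q : Prog)
  /-- run `P` if `e ≠ 0`, and `Q` otherwise -/
  | cond (e : Expr) (P Q : Prog)
  /-- run `P` as long as `e ≠ 0` -/
  | loop (e : Expr) (P : Prog)

/-- `Runs P σ τ t`: started with memory `σ`, the program `P` halts with memory `τ` after exactly
`t` elementary steps. -/
inductive Runs : Prog → Store → Store → ℕ → Prop
  | skip (σ : Store) : Runs .skip σ σ 1
  | setVar (x : ℕ) (e : Expr) (σ : Store) :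
      Runs (.setVar x e) σ (σ.setVar x (e.eval σ)) (e.cost + 1)
  | setArr (a : ℕ) (i j e : Expr) (σ : Store) :
      Runs (.setArr a i j e) σ (σ.setArr a (i.eval σ) (j.eval σ) (e.eval σ))
        (i.cost + j.cost + e.cost + 1)
  | seq {P Q : Prog} {σ σ' σ'' : Store} {s t : ℕ} :
      Runs P σ σ' s → Runs Q σ' σ'' t → Runs (.seq P Q) σ σ'' (s + t)
  | cond_true {e : Expr} {P Q : Prog} {σ σ' : Store} {t : ℕ} :
      e.eval σ ≠ 0 → Runs P σ σ' t → Runs (.cond e P Q) σ σ' (e.cost + 1 + t)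
  | cond_false {e : Expr} {P Q : Prog} {σ σ' : Store} {t : ℕ} :
      e.eval σ = 0 → Runs Q σ σ' t → Runs (.cond e P Q) σ σ' (e.cost + 1 + t)
  | loop_done {e : Expr} {P : Prog} {σ : Store} :
      e.eval σ = 0 → Runs (.loop e P) σ σ (e.cost + 1)
  | loop_step {e : Expr} {P : Prog} {σ σ' σ'' : Store} {s t : ℕ} :
      e.eval σ ≠ 0 → Runs P σ σ' s → Runs (.loop e P) σ' σ'' t →
        Runs (.loop e P) σ σ'' (e.cost + 1 + s + t)

/-! ### Input and output -/

open Classical in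
/-- The input: variable `0` holds the number `n` of vertices, variable `1` holds `d`, array `0`
holds the adjacency matrix of the graph, and everything else is `0`. -/
noncomputable def inputStore {n : ℕ} (G : SimpleGraph (Fin n)) (d : ℕ) : Store where
  var x := if x = 0 then n else if x = 1 then d else 0
  arr a i j := if a = 0 ∧ ∃ (hi : i < n) (hj : j < n), G.Adj ⟨i, hi⟩ ⟨j, hj⟩ then 1 else 0

/-- The first `ℓ` entries of column `0` of the array `a` are the vertices of the list `l`, and
`l` has length `ℓ`. -/
def Store.HoldsList {n : ℕ} (τ : Store) (a ℓ : ℕ) (l : List (Fin n)) : Prop :=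
  l.map (fun v => (v : ℕ)) = (List.range ℓ).map fun i => τ.arr a i 0

/-- Column `0` of the array `a` is an indicator of the vertex set `X`. -/
def Store.HoldsSet {n : ℕ} (τ : Store) (a : ℕ) (X : Finset (Fin n)) : Prop :=
  ∀ v : Fin n, v ∈ X ↔ τ.arr a v 0 ≠ 0

/-- An output: two sequences of vertices, or two sets of vertices. -/
inductive Answer (n : ℕ) where
  | cycles (l₁ l₂ : List (Fin n))
  | sets (X₁ X₂ : Finset (Fin n))

/-- Variable `0` tells which kind of answer is given. Two sequences are read from the arrays `1`
and `2`, with their lengths in the variables `1` and `2`; two sets are read from the arrays `1`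
and `2`. -/
def Store.Outputs {n : ℕ} (τ : Store) : Answer n → Prop
  | .cycles l₁ l₂ => τ.var 0 = 0 ∧ τ.HoldsList 1 (τ.var 1) l₁ ∧ τ.HoldsList 2 (τ.var 2) l₂
  | .sets X₁ X₂ => τ.var 0 ≠ 0 ∧ τ.HoldsSet 1 X₁ ∧ τ.HoldsSet 2 X₂

/-- The answer is correct: the two sequences traverse two cycles (first and last vertex equal)
that form a distance-`d` packing of two cycles, or the two sets have the required sizes and leave
a forest when the balls of radius `2 * d` and `3 * d` around them are deleted. -/
def IsCorrect {n : ℕ} (G : SimpleGraph (Fin n)) (d : ℕ) : Answer n → Prop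
  | .cycles l₁ l₂ =>
      ∃ (u v : Fin n) (c₁ : G.Walk u u) (c₂ : G.Walk v v),
        c₁.IsCycle ∧ c₂.IsCycle ∧ c₁.support = l₁ ∧ c₂.support = l₂ ∧
          c₁.toSubgraph ≠ c₂.toSubgraph ∧
          IsDistancePacking G d {c₁.toSubgraph, c₂.toSubgraph}
  | .sets X₁ X₂ =>
      X₁.card ≤ 12 * (d + 1) ∧ X₂.card ≤ 12 ∧
        IsForestOutside G (ball G (X₁ : Set (Fin n)) (2 * d)) ∧
        IsForestOutside G (ball G (X₂ : Set (Fin n)) (3 * d))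

end CyclePacking

/-! Let `C` be a shortest cycle of `G`, of length `g`; without one, `G` is a forest already. If `G -
B(C,d)` contains a cycle, this cycle and `C` form the packing. Otherwise `G - B(C,d)` is a forest
`F`. If `g ≤ 12(2d+1)`, then `B(C,d)` is covered by the balls of radius `2d` around twelve evenly
spaced vertices of `C`. If `C` is longer, every cycle that misses the vertex `γ 0` of `C` leaves
`B(C,2d)` (`IsShortestCycle.exists_notMem_ball`), and it enters `B(C,d)` because `F` is acyclic. So
it contains an ear: a path outside `B(C,2d)` except for its ends, which descend to `C` by geodesics
of length `2d` (`IsShortestCycle.exists_ear`).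

Root the components of `F` and choose ears greedily, each time a surviving ear whose vertex `t`
closest to the root is as deep as possible; then delete the balls of radius `2d` around `t` and
around the arcs of `C` within `d` of the two feet. Every ear that survives is far from the chosen
one (`IsShortestCycle.far_of_survives`): a short connection away from `C` would pass through `t`
(`mem_support_of_depth_le`), and one close to `C` contradicts the girth
(`IsShortestCycle.cyc_le_of_anchored`). If a forest is left after at most three rounds, `γ 0`, three
vertices `t` and six arcs hit all cycles; these are at most `4 + 6(2d+1) ≤ 12(d+1)` vertices, and
replacing each arc by its centre leaves ten vertices at the price of radius `3d`. Otherwise there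
are four ears far from each other. If two of them do not cross on `C`, each closes up along its own
arc of `C`; if all cross, they pair up into two cycles
(`IsShortestCycle.exists_isPackingTuple_of_far`).

The program need not find `C` or any ear. Arcs of `C` shorter than `g / 2` are unique geodesics, and
the path of an ear is the unique path of `F` between its ends. Hence the first cycle of a packing is
contained in a set determined by 14 vertices, and the hitting sets are determined by 24 and by 12
vertices (`hasHittingTuples_or_isPackingTuple`). The program tries all tuples and tests each
candidate, deciding acyclicity by pruning vertices with fewer than two neighbours
(`not_isAcyclic_iff_prune`). Its loops run over the vertices only, and `d` enters only as a number
that is added and compared, so the time is polynomial in `n` alone (`Cmd.exists_prog`). -/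

namespace CyclePacking

open SimpleGraph

/-! ### Cycles, cores, and paths that are determined by their ends -/

section Toolkit

variable {V : Type*} {G : SimpleGraph V}

/-- The graph on the same vertices that keeps the edges of `G` inside `S`. -/
def restrict (G : SimpleGraph V) (S : Set V) : SimpleGraph V where
  Adj u v := G.Adj u v ∧ u ∈ S ∧ v ∈ S
  symm := ⟨fun _ _ h => ⟨h.1.symm, h.2.2, h.2.1⟩⟩
  loopless := ⟨fun _ h => G.loopless.irrefl _ h.1⟩

theorem restrict_le (S : Set V) : restrict G S ≤ G := fun _ _ h => h.1

theorem restrict_mono {S T : Set V} (h : S ⊆ T) : restrict G S ≤ restrict G T :=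
  fun _ _ ha => ⟨ha.1, h ha.2.1, h ha.2.2⟩

/-- Every vertex of the nonempty set `K` has two neighbours in `K`. -/
def IsCore (G : SimpleGraph V) (K : Set V) : Prop :=
  K.Nonempty ∧ ∀ v ∈ K, ∃ a ∈ K, ∃ b ∈ K, a ≠ b ∧ G.Adj v a ∧ G.Adj v b

theorem exists_walk_of_seq (w : ℕ → V) (L : ℕ) :
    ∀ i, (∀ k, i ≤ k → k < i + L → G.Adj (w k) (w (k + 1))) →
      ∃ p : G.Walk (w i) (w (i + L)),
        p.length = L ∧ p.support = (List.range (L + 1)).map fun k => w (i + k) := by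
  induction L with
  | zero => intro i _; exact ⟨.nil, by simp, by simp⟩
  | succ L ih =>
    intro i h
    obtain ⟨p, hp, hs⟩ := ih (i + 1) fun k hk hk' => h k (by omega) (by omega)
    refine ⟨(Walk.cons (h i le_rfl (by omega)) p).copy rfl (by congr 1; omega), ?_, ?_⟩
    · simp [hp]
    · rw [Walk.support_copy, Walk.support_cons, hs, List.range_succ_eq_map (n := L + 1),
        List.map_cons, List.map_map]
      congr 1
      refine List.map_congr_left fun k _ => ?_
      simp only [Function.comp]
      congr 1; omega

/-- This is the form in which the program meets cycles: a walk that never turns back, cut at its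
first repetition. Length one is excluded by looplessness and length two by `hback`. -/
theorem exists_cycle_of_seq (w : ℕ → V) {i j : ℕ} (hij : i < j) (hw : w j = w i)
    (hinj : ∀ k l, i ≤ k → k < l → l < j → w k ≠ w l)
    (hadj : ∀ k, i ≤ k → k < j → G.Adj (w k) (w (k + 1)))
    (hback : ∀ k, i ≤ k → k + 1 < j → w (k + 2) ≠ w k) :
    ∃ c : G.Walk (w i) (w i), c.IsCycle ∧
      c.support = (List.range (j - i + 1)).map fun k => w (i + k) := by
  obtain ⟨p, hp, hs⟩ := exists_walk_of_seq w (j - i) i fun k h1 h2 => hadj k h1 (by omega)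
  have hji : i + (j - i) = j := by omega
  refine ⟨p.copy rfl (by rw [hji, hw]), ?_, by rw [Walk.support_copy, hs]⟩
  have h3 : 3 ≤ j - i := by
    by_contra hlt
    obtain h | h : j - i = 1 ∨ j - i = 2 := by omega
    · have := hadj i le_rfl hij
      rw [show i + 1 = j by omega, hw] at this
      exact G.loopless.irrefl _ this
    · apply hback i le_rfl (by omega)
      rw [show i + 2 = j by omega, hw]
  rw [Walk.isCycle_iff_isPath_tail_and_le_length]
  refine ⟨?_, by simpa [hp] using h3⟩
  rw [Walk.isPath_def, Walk.support_tail_of_not_nil, Walk.support_copy, hs]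
  · rw [List.range_succ_eq_map, List.map_cons, List.tail_cons, List.map_map]
    refine List.Nodup.map_on ?_ List.nodup_range
    intro x hx y hy hxy
    simp only [List.mem_range, Function.comp] at hx hy hxy
    by_contra hne
    wlog hlt : x < y generalizing x y
    · exact this y x (hx := hy) (hy := hx) (hxy := hxy.symm) (hne := Ne.symm hne) (by omega)
    by_cases hy' : y + 1 < j - i
    · exact hinj _ _ (by omega) (by omega) (by omega) hxy
    · rw [show i + y.succ = j by omega, hw] at hxy
      exact hinj i (i + x.succ) (by omega) (by omega) (by omega) hxy.symm
  · intro h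
    have := Walk.length_eq_zero_iff.mpr h
    simp [hp] at this
    omega

/-- A core is a local witness for a cycle; unlike a cycle, a largest one can be found by pruning. -/
theorem exists_core_of_isCycle {v : V} {c : G.Walk v v} (hc : c.IsCycle) :
    IsCore G {u | u ∈ c.support} := by
  refine ⟨⟨v, c.start_mem_support⟩, fun u hu => ?_⟩
  have h2 := hc.ncard_neighborSet_toSubgraph_eq_two hu
  obtain ⟨a, b, hab, hs⟩ := Set.ncard_eq_two.mp h2
  have ha : c.toSubgraph.Adj u a := by
    have : a ∈ c.toSubgraph.neighborSet u := by rw [hs]; simp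
    exact this
  have hb : c.toSubgraph.Adj u b := by
    have : b ∈ c.toSubgraph.neighborSet u := by rw [hs]; simp
    exact this
  refine ⟨a, ?_, b, ?_, hab, ha.adj_sub, hb.adj_sub⟩
  · exact (c.mem_verts_toSubgraph).mp (c.toSubgraph.edge_vert ha.symm)
  · exact (c.mem_verts_toSubgraph).mp (c.toSubgraph.edge_vert hb.symm)

theorem support_subset_of_restrict {S : Set V} {u v : V} (p : (restrict G S).Walk u v)
    (hu : u ∈ S) : ∀ x ∈ p.support, x ∈ S := by
  induction p with
  | nil => intro x hx; rw [Walk.support_nil, List.mem_singleton] at hx; exact hx ▸ hu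
  | cons h p ih =>
    intro x hx
    rw [Walk.support_cons, List.mem_cons] at hx
    rcases hx with rfl | hx
    · exact hu
    · exact ih h.2.2 x hx

theorem exists_core_of_not_isAcyclic {S : Set V} (h : ¬ (restrict G S).IsAcyclic) :
    ∃ K ⊆ S, IsCore G K := by
  simp only [IsAcyclic, not_forall, not_not] at h
  obtain ⟨v, c, hc⟩ := h
  have hcore := exists_core_of_isCycle hc
  refine ⟨{u | u ∈ c.support}, ?_, hcore.1, fun u hu => ?_⟩
  · intro u hu
    obtain ⟨a, _, b, _, _, ha, _⟩ := hcore.2 u hu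
    exact ha.2.1
  · obtain ⟨a, ha, b, hb, hab, h1, h2⟩ := hcore.2 u hu
    exact ⟨a, ha, b, hb, hab, h1.1, h2.1⟩

/-- A walk that never turns back and repeats a vertex yields a cycle. -/
theorem exists_first_repeat {n : ℕ} (w : ℕ → V) [Fintype V] (hn : Fintype.card V ≤ n) :
    ∃ i j, i < j ∧ j ≤ n ∧ w j = w i ∧ ∀ k l, k < l → l < j → w k ≠ w l := by
  classical
  have hex : ∃ j, ∃ i, i < j ∧ w j = w i := by
    obtain ⟨x, y, hxy, h⟩ := Finite.exists_ne_map_eq_of_infinite w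
    rcases lt_or_gt_of_ne hxy with h' | h'
    · exact ⟨y, x, h', h.symm⟩
    · exact ⟨x, y, h', h⟩
  obtain ⟨i, hi, hw⟩ := Nat.find_spec hex
  have hmin : ∀ k l, k < l → l < Nat.find hex → w k ≠ w l := fun k l hkl hl h =>
    Nat.find_min hex hl ⟨k, hkl, h.symm⟩
  refine ⟨i, Nat.find hex, hi, ?_, hw, hmin⟩
  have : (Finset.range (Nat.find hex)).card ≤ Fintype.card V := by
    apply Finset.card_le_card_of_injOn w (by simp)
    intro x hx y hy hxy
    simp only [Finset.coe_range, Set.mem_Iio] at hx hy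
    by_contra hne
    rcases lt_or_gt_of_ne hne with h' | h'
    · exact hmin _ _ h' hy hxy
    · exact hmin _ _ h' hx hxy.symm
  rw [Finset.card_range] at this
  exact this.trans hn

/-- Walk inside `K`, leaving each vertex by a neighbour other than the one just visited; the first
repeated vertex closes a cycle. -/
theorem not_isAcyclic_of_core [Fintype V] {S K : Set V} (hKS : K ⊆ S) (hK : IsCore G K) :
    ¬ (restrict G S).IsAcyclic := by
  classical
  have hK2 : ∀ v ∈ K, ∀ u, ∃ a ∈ K, a ≠ u ∧ G.Adj v a := by
    intro v hv u
    obtain ⟨a, ha, b, hb, hab, h1, h2⟩ := hK.2 v hv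
    by_cases h : a = u
    · exact ⟨b, hb, fun h' => hab (h.trans h'.symm), h2⟩
    · exact ⟨a, ha, h, h1⟩
  choose! f hfK hfne hfadj using hK2
  obtain ⟨v0, hv0⟩ := hK.1
  -- The state consists of the current vertex and the next one, so that the following step can avoid
  -- turning back. At the start there is no predecessor, and `v0` itself takes its place.
  let s : ℕ → V × V := fun k => Nat.rec (v0, f v0 v0) (fun _ x => (x.2, f x.2 x.1)) k
  let w : ℕ → V := fun k => (s k).1
  have hs1 : ∀ k, s (k + 1) = ((s k).2, f (s k).2 (s k).1) := fun k => rfl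
  have hsK : ∀ k, (s k).1 ∈ K ∧ (s k).2 ∈ K ∧ G.Adj (s k).1 (s k).2 := by
    intro k
    induction k with
    | zero => exact ⟨hv0, hfK _ hv0 _, hfadj _ hv0 _⟩
    | succ k ih => rw [hs1]; exact ⟨ih.2.1, hfK _ ih.2.1 _, hfadj _ ih.2.1 _⟩
  obtain ⟨i, j, hij, _, hw, hinj⟩ := exists_first_repeat w le_rfl
  obtain ⟨c, hc, _⟩ := exists_cycle_of_seq (G := restrict G S) w hij hw
    (fun k l _ => hinj k l)
    (fun k _ _ => ⟨(hsK k).2.2, hKS (hsK k).1, hKS (hsK k).2.1⟩)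
    (fun k _ _ => hfne _ (hsK k).2.1 _)
  exact fun h => h c hc

/-- `restrict` keeps the vertex type, so that walks inside different vertex sets can be compared
without coercions; this translates back to induced subgraphs. -/
theorem isAcyclic_induce_iff {S : Set V} :
    (G.induce S).IsAcyclic ↔ (restrict G S).IsAcyclic := by
  constructor
  · intro h v c hc
    have hS : ∀ x ∈ c.support, x ∈ S := by
      refine support_subset_of_restrict c ?_
      obtain ⟨a, _, b, _, _, ha, _⟩ := (exists_core_of_isCycle hc).2 v c.start_mem_support
      exact ha.2.1
    have hc' := hc.mapLe (restrict_le S)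
    have hS' : ∀ x ∈ (c.mapLe (restrict_le S)).support, x ∈ S := by simpa using hS
    refine h ((c.mapLe (restrict_le S)).induce S hS') ?_
    apply Walk.IsCycle.of_map (f := (Embedding.induce S).toHom)
    rw [Walk.map_induce]
    exact hc'
  · intro h
    exact h.comap (⟨Subtype.val, fun {a b} hab => ⟨hab, a.2, b.2⟩⟩ : G.induce S →g restrict G S)
      Subtype.val_injective

/-- Two paths with the same ends and total length less than the girth are equal. -/
theorem path_unique_of_girth {g : ℕ} (hg : ∀ (v : V) (c : G.Walk v v), c.IsCycle → g ≤ c.length)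
    {u v : V} {p q : G.Walk u v} (hp : p.IsPath) (hq : q.IsPath) (h : p.length + q.length < g) :
    p = q := by
  classical
  -- The two paths together have fewer than `g` edges, so they span a forest, where paths are
  -- unique.
  let E : Finset (Sym2 V) := p.edges.toFinset ∪ q.edges.toFinset
  let H : SimpleGraph V := fromEdgeSet (E : Set (Sym2 V))
  have hHG : H ≤ G := by
    intro a b hab
    have h1 : s(a, b) ∈ E := ((fromEdgeSet_adj _).mp hab).1
    simp only [E, Finset.mem_union, List.mem_toFinset] at h1
    exact h1.elim (fun h => p.adj_of_mem_edges h) fun h => q.adj_of_mem_edges h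
  have hmem : ∀ e ∈ E, e ∈ G.edgeSet → e ∈ H.edgeSet := by
    intro e he heG
    induction e with
    | h a b => exact (fromEdgeSet_adj _).mpr ⟨he, (G.ne_of_adj heG)⟩
  have hpE : ∀ e ∈ p.edges, e ∈ H.edgeSet := fun e he =>
    hmem e (by simp [E, he]) (p.edges_subset_edgeSet he)
  have hqE : ∀ e ∈ q.edges, e ∈ H.edgeSet := fun e he =>
    hmem e (by simp [E, he]) (q.edges_subset_edgeSet he)
  have hac : H.IsAcyclic := by
    intro x c hc
    have h1 := hg x _ (hc.mapLe hHG)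
    have h2 : c.edges.toFinset ⊆ E := by
      intro e he
      have := c.edges_subset_edgeSet (List.mem_toFinset.mp he)
      simp only [H, edgeSet_fromEdgeSet] at this
      exact this.1
    have h3 := Finset.card_le_card h2
    rw [List.toFinset_card_of_nodup hc.edges_nodup, Walk.length_edges] at h3
    have h4 : E.card ≤ p.length + q.length := by
      refine (Finset.card_union_le _ _).trans (Nat.add_le_add ?_ ?_)
      · exact (List.toFinset_card_le _).trans (by simp)
      · exact (List.toFinset_card_le _).trans (by simp)
    simp at h1
    omega
  have := (hac.subsingleton_path _ _).elim ⟨p.transfer H hpE, hp.transfer hpE⟩ ⟨q.transfer H hqE, hq.transfer hqE⟩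
  have h5 : p.transfer H hpE = q.transfer H hqE := congrArg Subtype.val this
  apply Walk.edges_injective
  rw [← Walk.edges_transfer p hpE, h5, Walk.edges_transfer]

/-- The vertices on some geodesic between `u` and `v`, for a distance function `D`. -/
def between (D : V → V → ℕ) (u v : V) : Set V := {w | D u w + D w v ≤ D u v}

open Classical in
/-- The distance in `G`, and `M` for vertices in different components. -/
noncomputable def cappedDist (G : SimpleGraph V) (M : ℕ) (u v : V) : ℕ :=
  if G.Reachable u v then G.dist u v else M

theorem dist_lt_card [Fintype V] {u v : V} (h : G.Reachable u v) : G.dist u v < Fintype.card V := by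
  obtain ⟨p, hp, hl⟩ := h.exists_path_of_dist
  rw [← hl]; exact hp.length_lt

/-- A unique shortest path can be recovered from its ends and a distance matrix. The bound on `M`
keeps out the vertices of other components: a single entry `M` already exceeds the distance of `u`
and `v`. -/
theorem between_eq_support [Fintype V] {M : ℕ} (hM : Fintype.card V ≤ M) {u v : V}
    {A : G.Walk u v} (hA : A.IsPath) (huniq : ∀ p : G.Walk u v, p.IsPath → p.length ≤ A.length → p = A) :
    between (cappedDist G M) u v = {w | w ∈ A.support} := by
  classical
  obtain ⟨p, hp, hl⟩ := A.reachable.exists_path_of_dist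
  have hpA : p = A := huniq p hp (hl ▸ G.dist_le A)
  subst hpA
  ext w
  simp only [between, Set.mem_ofPred_eq]
  have huv : cappedDist G M u v = G.dist u v := if_pos p.reachable
  have hlt : cappedDist G M u v < M := huv ▸ (dist_lt_card p.reachable).trans_le hM
  constructor
  · intro h
    have h1 : G.Reachable u w := by
      by_contra h'
      simp only [cappedDist, if_neg h'] at h hlt
      omega
    have h2 : G.Reachable w v := by
      by_contra h'
      simp only [cappedDist, if_neg h'] at h hlt
      omega
    rw [huv, cappedDist, if_pos h1, cappedDist, if_pos h2] at h
    obtain ⟨q1, hq1⟩ := h1.exists_walk_length_eq_dist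
    obtain ⟨q2, hq2⟩ := h2.exists_walk_length_eq_dist
    have hle : (q1.append q2).length ≤ G.dist u v := by rw [Walk.length_append]; omega
    have heq : (q1.append q2).length = G.dist u v := le_antisymm hle (G.dist_le _)
    have := huniq _ (Walk.isPath_of_length_eq_dist _ heq) (by omega)
    rw [← this]
    simp
  · intro h
    have h1 := G.dist_le (p.takeUntil w h)
    have h2 := G.dist_le (p.dropUntil w h)
    have h3 : (p.takeUntil w h).length + (p.dropUntil w h).length = p.length := by
      rw [← Walk.length_append, Walk.take_spec]
    rw [huv, cappedDist, if_pos (p.takeUntil w h).reachable, cappedDist,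
      if_pos (p.dropUntil w h).reachable]
    omega

theorem between_self [Fintype V] {M : ℕ} (hM : Fintype.card V ≤ M) (u : V) :
    between (cappedDist G M) u u = {u} := by
  rw [between_eq_support hM (A := Walk.nil) (by simp)]
  · ext; simp
  · intro p _ hp
    exact Walk.eq_nil_iff_nil.mpr (Walk.length_eq_zero_iff.mp (Nat.le_zero.mp hp))

/-- A path and a walk with the same ends that misses a vertex of the path force a cycle. -/
theorem not_isAcyclic_of_walk_avoiding {S : Set V} {u v z : V} {p q : G.Walk u v} (hp : p.IsPath)
    (hz : z ∈ p.support) (hzq : z ∉ q.support) (hpS : ∀ x ∈ p.support, x ∈ S)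
    (hqS : ∀ x ∈ q.support, x ∈ S) : ¬ (restrict G S).IsAcyclic := by
  classical
  intro hac
  have key : ∀ r : G.Walk u v, (∀ x ∈ r.support, x ∈ S) →
      ∀ e ∈ r.edges, e ∈ (restrict G S).edgeSet := by
    intro r hr e he
    induction e with
    | h a b => exact ⟨r.adj_of_mem_edges he, hr _ (r.fst_mem_support_of_mem_edges he),
        hr _ (r.snd_mem_support_of_mem_edges he)⟩
  have hbS : ∀ x ∈ q.bypass.support, x ∈ S := fun x hx => hqS x (q.support_bypass_subset_support hx)
  -- In a forest, the path obtained by shortcutting `q` would have to be `p`, but it misses `z`.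
  have := (hac.subsingleton_path _ _).elim ⟨p.transfer _ (key p hpS), hp.transfer _⟩
    ⟨q.bypass.transfer _ (key _ hbS), q.bypass_isPath.transfer _⟩
  have h5 : p.transfer _ (key p hpS) = q.bypass.transfer _ (key _ hbS) := congrArg Subtype.val this
  have h6 := congrArg Walk.support h5
  rw [Walk.support_transfer, Walk.support_transfer] at h6
  rw [h6] at hz
  exact hzq (q.support_bypass_subset_support hz)

end Toolkit

end CyclePacking

namespace CyclePacking

open SimpleGraph

/-! ### Walks near a shortest cycle, and ears -/

section ShortestCycle

variable {V : Type*} {G : SimpleGraph V}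

theorem mem_ball_iff {X : Set V} {r : ℕ} {u : V} :
    u ∈ ball G X r ↔ ∃ v ∈ X, ∃ p : G.Walk u v, p.length ≤ r := by
  constructor
  · rintro ⟨v, hv, h⟩
    obtain ⟨p, hp⟩ := exists_walk_of_edist_ne_top
      (ne_top_of_le_ne_top (ENat.natCast_ne_top r) h : G.edist u v ≠ ⊤)
    exact ⟨v, hv, p, by rw [← hp] at h; exact_mod_cast h⟩
  · rintro ⟨v, hv, p, hp⟩
    exact ⟨v, hv, (edist_le p).trans (by exact_mod_cast hp)⟩

theorem ball_mono {X Y : Set V} {r s : ℕ} (h : X ⊆ Y) (hrs : r ≤ s) : ball G X r ⊆ ball G Y s := by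
  intro u hu
  obtain ⟨v, hv, p, hp⟩ := mem_ball_iff.mp hu
  exact mem_ball_iff.mpr ⟨v, h hv, p, hp.trans hrs⟩

/-- If `p` ends in `B(X, r)`, then it starts in `B(X, p.length + r)`. -/
theorem mem_ball_of_walk {X : Set V} {r s : ℕ} {u v : V} (p : G.Walk u v) (hv : v ∈ ball G X r)
    (h : p.length + r ≤ s) : u ∈ ball G X s := by
  obtain ⟨x, hx, q, hq⟩ := mem_ball_iff.mp hv
  exact mem_ball_iff.mpr ⟨x, hx, p.append q, by rw [Walk.length_append]; omega⟩

theorem self_mem_ball {X : Set V} {r : ℕ} {u : V} (h : u ∈ X) : u ∈ ball G X r :=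
  mem_ball_iff.mpr ⟨u, h, .nil, by simp⟩

/-- `γ` runs around a cycle of length `g` of `G`. -/
structure IsCyclicSeq (G : SimpleGraph V) (g : ℕ) (γ : ℕ → V) : Prop where
  three : 3 ≤ g
  periodic : ∀ i, γ (i + g) = γ i
  adj : ∀ i, G.Adj (γ i) (γ (i + 1))
  inj : ∀ i j, i < g → j < g → γ i = γ j → i = j

theorem exists_cyclicSeq_of_isCycle {v : V} {c : G.Walk v v} (hc : c.IsCycle) :
    ∃ γ : ℕ → V, IsCyclicSeq G c.length γ ∧ Set.range γ = {x | x ∈ c.support} ∧ γ 0 = v := by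
  have h3 := hc.three_le_length
  have hpos : 0 < c.length := by omega
  refine ⟨fun i => c.getVert (i % c.length), ⟨h3, by simp, fun i => ?_, fun i j hi hj h => ?_⟩,
    ?_, by simp⟩
  · have hlt := Nat.mod_lt i hpos
    have h1 := c.adj_getVert_succ hlt
    by_cases hi : i % c.length + 1 = c.length
    · have h2 : (i + 1) % c.length = 0 := by
        rw [Nat.add_mod, Nat.mod_eq_of_lt (show 1 < c.length by omega), hi, Nat.mod_self]
      simp only [h2, Walk.getVert_zero]
      rwa [hi, Walk.getVert_length] at h1
    · have h2 : (i + 1) % c.length = i % c.length + 1 := by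
        rw [Nat.add_mod, Nat.mod_eq_of_lt (show 1 < c.length by omega),
          Nat.mod_eq_of_lt (by omega)]
      simpa only [h2] using h1
  · simp only [Nat.mod_eq_of_lt hi, Nat.mod_eq_of_lt hj] at h
    exact hc.getVert_injOn' (by simp only [Set.mem_ofPred_eq]; omega)
      (by simp only [Set.mem_ofPred_eq]; omega) h
  · ext x
    simp only [Set.mem_range, Set.mem_ofPred_eq, Walk.mem_support_iff_exists_getVert]
    constructor
    · rintro ⟨i, rfl⟩
      exact ⟨_, rfl, (Nat.mod_lt i hpos).le⟩
    · rintro ⟨i, rfl, hi⟩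
      rcases hi.lt_or_eq with hi | hi
      · exact ⟨i, by rw [Nat.mod_eq_of_lt hi]⟩
      · exact ⟨0, by rw [hi]; simp⟩

namespace IsCyclicSeq

variable {g : ℕ} {γ : ℕ → V}

theorem apply_mod (hC : IsCyclicSeq G g γ) (i : ℕ) : γ (i % g) = γ i := by
  have h : ∀ k m, γ (m + g * k) = γ m := by
    intro k
    induction k with
    | zero => simp
    | succ k ih => intro m; rw [Nat.mul_succ, ← add_assoc, hC.periodic, ih]
  conv_rhs => rw [← Nat.mod_add_div i g]
  rw [h]

theorem mod_lt (hC : IsCyclicSeq G g γ) (i : ℕ) : i % g < g := Nat.mod_lt _ (by have := hC.three; omega)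

theorem exists_lt_of_mem_range (hC : IsCyclicSeq G g γ) {x : V} (h : x ∈ Set.range γ) : ∃ i < g, γ i = x := by
  obtain ⟨i, rfl⟩ := h
  exact ⟨i % g, hC.mod_lt i, hC.apply_mod i⟩

theorem ne_of_lt (hC : IsCyclicSeq G g γ) {i j : ℕ} (hij : i < j) (hj : j < i + g) : γ i ≠ γ j := by
  intro h
  rw [← hC.apply_mod i, ← hC.apply_mod j] at h
  have h1 := hC.inj _ _ (hC.mod_lt i) (hC.mod_lt j) h
  have h2 : j - i ≡ 0 [MOD g] := by
    have h4 : j - i + i ≡ 0 + i [MOD g] := by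
      rw [Nat.sub_add_cancel hij.le, zero_add]; exact h1.symm
    exact Nat.ModEq.add_right_cancel' i h4
  have h3 := Nat.le_of_dvd (by omega) ((Nat.modEq_zero_iff_dvd).mp h2)
  omega

theorem exists_arc (hC : IsCyclicSeq G g γ) (i : ℕ) {L : ℕ} (hL : L < g) :
    ∃ A : G.Walk (γ i) (γ (i + L)), A.IsPath ∧ A.length = L ∧
      ∀ x, x ∈ A.support ↔ ∃ k ≤ L, γ (i + k) = x := by
  obtain ⟨A, hl, hs⟩ := exists_walk_of_seq (G := G) γ L i fun k _ _ => hC.adj k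
  refine ⟨A, ?_, hl, fun x => ?_⟩
  · rw [Walk.isPath_def, hs]
    refine List.Nodup.map_on ?_ List.nodup_range
    intro x hx y hy hxy
    simp only [List.mem_range] at hx hy
    by_contra hne
    rcases lt_or_gt_of_ne hne with h | h
    · exact hC.ne_of_lt (by omega) (by omega) hxy
    · exact hC.ne_of_lt (by omega) (by omega) hxy.symm
  · rw [hs]
    simp

end IsCyclicSeq

/-- The distance of the positions `i, j < g` on a cycle of length `g`. -/
def cyc (g i j : ℕ) : ℕ := min (i - j + (j - i)) (g - (i - j + (j - i)))

theorem cyc_comm (g i j : ℕ) : cyc g i j = cyc g j i := by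
  unfold cyc; rw [add_comm]

theorem IsCyclicSeq.exists_cyc_path {g : ℕ} {γ : ℕ → V} (hC : IsCyclicSeq G g γ) {i j : ℕ}
    (hi : i < g) (hj : j < g) : ∃ A : G.Walk (γ i) (γ j), A.IsPath ∧ A.length = cyc g i j ∧
      ∀ x ∈ A.support, x ∈ Set.range γ := by
  wlog hij : i ≤ j generalizing i j
  · obtain ⟨A, h1, h2, h3⟩ := this hj hi (by omega)
    exact ⟨A.reverse, h1.reverse, by rw [Walk.length_reverse, h2, cyc_comm], by simpa using h3⟩
  by_cases hs : j - i ≤ g - (j - i)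
  · obtain ⟨A, h1, h2, h3⟩ := hC.exists_arc i (L := j - i) (by omega)
    refine ⟨A.copy rfl (by congr 1; omega), by simpa using h1, ?_, fun x hx => ?_⟩
    · rw [Walk.length_copy, h2, cyc]; omega
    · rw [Walk.support_copy] at hx
      obtain ⟨k, -, rfl⟩ := (h3 x).mp hx
      exact ⟨_, rfl⟩
  · obtain ⟨A, h1, h2, h3⟩ := hC.exists_arc j (L := g - (j - i)) (by omega)
    refine ⟨(A.copy rfl (by rw [← hC.periodic i]; congr 1; omega)).reverse, by simpa using h1,
      ?_, fun x hx => ?_⟩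
    · rw [Walk.length_reverse, Walk.length_copy, h2, cyc]; omega
    · rw [Walk.support_reverse, Walk.support_copy, List.mem_reverse] at hx
      obtain ⟨k, -, rfl⟩ := (h3 x).mp hx
      exact ⟨_, rfl⟩

/-- `γ` runs around a shortest cycle, of length `g`, of `G`. -/
structure IsShortestCycle (G : SimpleGraph V) (g : ℕ) (γ : ℕ → V) : Prop
    extends IsCyclicSeq G g γ where
  girth : ∀ (v : V) (c : G.Walk v v), c.IsCycle → g ≤ c.length

theorem exists_isShortestCycle (h : ¬ G.IsAcyclic) : ∃ g γ, IsShortestCycle G g γ := by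
  obtain ⟨v, c, hc, hl⟩ := exists_girth_eq_length.mpr h
  obtain ⟨γ, hγ, -⟩ := exists_cyclicSeq_of_isCycle hc
  exact ⟨_, γ, hγ, fun v c' hc' => hl ▸ girth_le_length hc'⟩

namespace IsShortestCycle

variable {g : ℕ} {γ : ℕ → V}

/-- A walk of length less than `g / 2` between two vertices of the cycle contains all edges of
the shorter arc between them. -/
theorem exists_arc_edges (hC : IsShortestCycle G g γ) {i j : ℕ} (hi : i < g) (hj : j < g) (W : G.Walk (γ i) (γ j))
    (hW : 2 * W.length < g) :
    ∃ E : Finset (Sym2 V), E.card = cyc g i j ∧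
      ∀ e ∈ E, e ∈ W.edges ∧ ∀ x ∈ e, x ∈ Set.range γ := by
  classical
  obtain ⟨A, hA, hl, hs⟩ := hC.exists_cyc_path hi hj
  have hbl := W.length_bypass_le_length
  -- The shorter arc has at most `g / 2` edges and the shortcut walk has fewer than that, so the
  -- girth makes them equal.
  have hAW : A = W.bypass := by
    apply path_unique_of_girth hC.girth hA W.bypass_isPath
    have : 2 * cyc g i j ≤ g := by unfold cyc; omega
    omega
  refine ⟨A.edges.toFinset, ?_, fun e he => ?_⟩
  · rw [List.toFinset_card_of_nodup hA.isTrail.edges_nodup, Walk.length_edges, hl]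
  · have he' := List.mem_toFinset.mp he
    refine ⟨W.edges_bypass_subset_edges (hAW ▸ he'), fun x hx => hs x ?_⟩
    exact A.mem_support_of_mem_edges he' hx

end IsShortestCycle

/-- A walk of length at most `r` from `w` to the vertex `x` of `C` that uses no edge inside `C`. -/
def Anchored (G : SimpleGraph V) (C : Set V) (r : ℕ) (w x : V) : Prop :=
  ∃ p : G.Walk w x, p.length ≤ r ∧ ∀ e ∈ p.edges, ∃ y ∈ e, y ∉ C

theorem Anchored.refl (C : Set V) (r : ℕ) (x : V) : Anchored G C r x x :=
  ⟨.nil, by simp, by simp⟩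

/-- The walk from `γ i` through `w` and `w'` to `γ j` is shorter than `g / 2`, so it contains every
edge of the shorter arc. The anchoring walks use no edge inside `C`, so all these edges lie on `q`;
if `q` has none either, the arc is trivial. -/
theorem IsShortestCycle.cyc_le_of_anchored {g : ℕ} {γ : ℕ → V} (hC : IsShortestCycle G g γ)
    {i j r s : ℕ} (hi : i < g) (hj : j < g) {w w' : V} (hw : Anchored G (Set.range γ) r w (γ i))
    (hw' : Anchored G (Set.range γ) r w' (γ j)) (q : G.Walk w w') (hq : q.length ≤ s)
    (hg : 4 * r + 2 * s < g) :
    cyc g i j ≤ s ∧ ((∀ e ∈ q.edges, ∃ y ∈ e, y ∉ Set.range γ) → i = j) := by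
  classical
  obtain ⟨p, hp, hpe⟩ := hw
  obtain ⟨p', hp', hpe'⟩ := hw'
  obtain ⟨E, hE, hEe⟩ := hC.exists_arc_edges hi hj (p.reverse.append (q.append p')) (by
    simp only [Walk.length_append, Walk.length_reverse]; omega)
  have hsub : ∀ e ∈ E, e ∈ q.edges ∧ ∀ x ∈ e, x ∈ Set.range γ := by
    intro e he
    obtain ⟨h1, h2⟩ := hEe e he
    refine ⟨?_, h2⟩
    simp only [Walk.edges_append, Walk.edges_reverse, List.mem_append, List.mem_reverse] at h1
    rcases h1 with h1 | h1 | h1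
    · obtain ⟨y, hy, hyC⟩ := hpe e h1
      exact absurd (h2 y hy) hyC
    · exact h1
    · obtain ⟨y, hy, hyC⟩ := hpe' e h1
      exact absurd (h2 y hy) hyC
  constructor
  · rw [← hE]
    calc E.card ≤ q.edges.toFinset.card :=
          Finset.card_le_card fun e he => List.mem_toFinset.mpr (hsub e he).1
      _ ≤ q.edges.length := List.toFinset_card_le _
      _ ≤ s := by rw [Walk.length_edges]; exact hq
  · intro h
    have : E = ∅ := by
      rw [Finset.eq_empty_iff_forall_notMem]
      intro e he
      obtain ⟨h1, h2⟩ := hsub e he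
      obtain ⟨y, hy, hyC⟩ := h e h1
      exact hyC (h2 y hy)
    rw [this, Finset.card_empty, cyc] at hE
    omega

/-- A vertex at distance exactly `k` from `C` is joined to `C` by a path of length `k` along which
the distance from `C` drops at unit speed. -/
theorem exists_descent {C : Set V} {k : ℕ} {u : V} (hu : u ∈ ball G C k)
    (hk : ∀ l, u ∈ ball G C l → k ≤ l) :
    ∃ x ∈ C, ∃ p : G.Walk u x, p.IsPath ∧ p.length = k ∧
      ∀ w ∈ p.support, Anchored G C k w x ∧
        ∀ m, w ∉ ball G C m → ∃ q : G.Walk u w, q.length + m < k ∧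
          ∀ y ∈ q.support, y ∉ ball G C m := by
  classical
  obtain ⟨x, hx, p₀, hp₀⟩ := mem_ball_iff.mp hu
  have hle : p₀.bypass.length ≤ k := p₀.length_bypass_le_length.trans hp₀
  have hpk : p₀.bypass.length = k :=
    le_antisymm hle (hk _ (mem_ball_iff.mpr ⟨x, hx, p₀.bypass, le_rfl⟩))
  have hpath := p₀.bypass_isPath
  generalize p₀.bypass = p at hle hpk hpath
  have hsplit : ∀ w (hw : w ∈ p.support),
      (p.takeUntil w hw).length + (p.dropUntil w hw).length = k := fun w hw => by
    rw [← Walk.length_append, Walk.take_spec, hpk]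
  have htake : ∀ w (hw : w ∈ p.support) m, w ∈ ball G C m →
      k ≤ (p.takeUntil w hw).length + m := fun w hw m hm =>
    hk _ (mem_ball_of_walk (p.takeUntil w hw) hm le_rfl)
  -- A shortest path to `C` meets `C` only at its last vertex, so it has no edge inside `C` and
  -- anchors each of its vertices.
  have hend : ∀ y ∈ p.support, y ∈ C → y = x := by
    intro y hy hyC
    have h1 := hsplit y hy
    have h2 := htake y hy 0 (self_mem_ball hyC)
    exact Walk.eq_of_length_eq_zero (p := p.dropUntil y hy) (by omega)
  have hedge : ∀ e ∈ p.edges, ∃ y ∈ e, y ∉ C := by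
    intro e he
    induction e with
    | h a b =>
      by_contra hcon
      push Not at hcon
      have h1 := hend a (p.fst_mem_support_of_mem_edges he) (hcon a (by simp))
      have h2 := hend b (p.snd_mem_support_of_mem_edges he) (hcon b (by simp))
      exact (p.adj_of_mem_edges he).ne (h1.trans h2.symm)
  refine ⟨x, hx, p, hpath, hpk, fun w hw => ⟨⟨p.dropUntil w hw, ?_, fun e he => ?_⟩,
    fun m hm => ⟨p.takeUntil w hw, ?_, fun y hy hyb => ?_⟩⟩⟩
  · have := hsplit w hw; omega
  · exact hedge e (p.edges_dropUntil_subset_edges hw he)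
  · have h1 := hsplit w hw
    by_contra hcon
    exact hm (mem_ball_iff.mpr ⟨x, hx, p.dropUntil w hw, by omega⟩)
  · have h1 := hsplit w hw
    have h2 : k ≤ ((p.takeUntil w hw).takeUntil y hy).length + m :=
      hk _ (mem_ball_of_walk _ hyb le_rfl)
    have h3 := (p.takeUntil w hw).length_takeUntil_le_length hy
    exact hm (mem_ball_iff.mpr ⟨x, hx, p.dropUntil w hw, by omega⟩)

theorem exists_min_ball {C : Set V} {k : ℕ} {u : V} (hu : u ∈ ball G C k) :
    ∃ l ≤ k, u ∈ ball G C l ∧ ∀ m, u ∈ ball G C m → l ≤ m := by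
  classical
  have hex : ∃ l, u ∈ ball G C l := ⟨k, hu⟩
  exact ⟨Nat.find hex, Nat.find_min' hex hu, Nat.find_spec hex, fun m hm => Nat.find_min' hex hm⟩

/-- Around a shortest cycle `C` that is long enough, every cycle except `C` leaves `B(C, r)`. -/
theorem IsShortestCycle.exists_notMem_ball [Finite V] {g : ℕ} {γ : ℕ → V}
    (hC : IsShortestCycle G g γ) {r : ℕ} (hg : 4 * r + 2 < g) {K : Set V} (hK : IsCore G K)
    (h0 : γ 0 ∉ K) : ∃ u ∈ K, u ∉ ball G (Set.range γ) r := by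
  classical
  by_contra hcon
  push Not at hcon
  have hlev : ∀ u, ∃ l, u ∈ K → l ≤ r ∧ u ∈ ball G (Set.range γ) l ∧
      ∀ m, u ∈ ball G (Set.range γ) m → l ≤ m := by
    intro u
    by_cases hu : u ∈ K
    · obtain ⟨l, h1, h2, h3⟩ := exists_min_ball (hcon u hu)
      exact ⟨l, fun _ => ⟨h1, h2, h3⟩⟩
    · exact ⟨0, fun h => absurd h hu⟩
  choose lev hlev using hlev
  -- If `K` were inside the ball, consider a vertex `u` of `K` that is farthest from `C`.
  obtain ⟨u, huK, humax⟩ := Set.exists_max_image K lev K.toFinite hK.1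
  rcases Nat.eq_zero_or_pos (lev u) with hzero | hpos
  · have hKC : ∀ v ∈ K, ∃ i < g, γ i = v := by
      intro v hv
      have h1 := (hlev v hv).2.1
      have h2 : lev v = 0 := by have := humax v hv; omega
      rw [h2] at h1
      obtain ⟨x, hx, p, hp⟩ := mem_ball_iff.mp h1
      have := Walk.eq_of_length_eq_zero (Nat.le_zero.mp hp)
      subst this
      exact hC.exists_lt_of_mem_range hx
    have hpos : ∀ v, ∃ i, v ∈ K → i < g ∧ γ i = v := by
      intro v
      by_cases hv : v ∈ K
      · obtain ⟨i, h⟩ := hKC v hv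
        exact ⟨i, fun _ => h⟩
      · exact ⟨0, fun h => absurd h hv⟩
    choose pos hpos using hpos
    -- Now `K` is part of `C`. Since `γ 0` is missing, the neighbours in `K` of the vertex with the
    -- largest position can only be at the position before it, so there are not two of them.
    obtain ⟨v, hvK, hvmax⟩ := Set.exists_max_image K pos K.toFinite hK.1
    have hnbr : ∀ a ∈ K, G.Adj v a → pos a + 1 = pos v := by
      intro a ha hva
      obtain ⟨hv1, hv2⟩ := hpos v hvK
      obtain ⟨ha1, ha2⟩ := hpos a ha
      have ha0 : pos a ≠ 0 := fun h => h0 (by rw [← h, ha2]; exact ha)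
      have hle := hvmax a ha
      have hadj : G.Adj (γ (pos v)) (γ (pos a)) := by rw [hv2, ha2]; exact hva
      have hne : pos v ≠ pos a := fun h => by rw [h] at hadj; exact hadj.ne rfl
      have := (hC.cyc_le_of_anchored (r := 0) (s := 1) hv1 ha1 (Anchored.refl _ _ _)
        (Anchored.refl _ _ _) hadj.toWalk (by simp) (by have := hC.three; omega)).1
      unfold cyc at this
      omega
    obtain ⟨a, ha, b, hb, hab, h1, h2⟩ := hK.2 v hvK
    apply hab
    rw [← (hpos a ha).2, ← (hpos b hb).2]
    have := hnbr a ha h1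
    have := hnbr b hb h2
    congr 1; omega
  · have huC : u ∉ Set.range γ := fun h => by
      have := (hlev u huK).2.2 0 (self_mem_ball h)
      omega
    obtain ⟨x, hx, p, -, hpl, hpw⟩ := exists_descent (hlev u huK).2.1 (hlev u huK).2.2
    obtain ⟨i, hi, rfl⟩ := hC.exists_lt_of_mem_range hx
    have anch : ∀ {w x k}, Anchored G (Set.range γ) k w x → k ≤ r →
        Anchored G (Set.range γ) r w x := by
      rintro w x k ⟨p, hp, h⟩ hk
      exact ⟨p, hp.trans hk, h⟩
    -- The edge from `u` to `a` is not inside `C`, so the descents of `u` and `a` arrive at the same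
    -- vertex. The descent of `a` misses `u`, because `a` is at most as far from `C` as `u`. Two
    -- neighbours thus give two paths of length at most `r + 1` with the same ends, contradicting
    -- the girth.
    have hnbr : ∀ a ∈ K, ∀ h : G.Adj u a, ∃ q : G.Walk a (γ i),
        (Walk.cons h q).IsPath ∧ q.length ≤ r := by
      intro a ha hua
      obtain ⟨y, hy, q, hqp, hql, hqw⟩ := exists_descent (hlev a ha).2.1 (hlev a ha).2.2
      obtain ⟨j, hj, rfl⟩ := hC.exists_lt_of_mem_range hy
      have hij : i = j := by
        refine (hC.cyc_le_of_anchored (r := r) (s := 1) hi hj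
          (anch (hpw u p.start_mem_support).1 (hlev u huK).1)
          (anch (hqw a q.start_mem_support).1 (hlev a ha).1) hua.toWalk (by simp) (by omega)).2 ?_
        intro e he
        rw [Adj.edges_toWalk, List.mem_singleton] at he
        exact ⟨u, by simp [he], huC⟩
      subst hij
      refine ⟨q, (Walk.cons_isPath_iff _ _).mpr ⟨hqp, fun huq => ?_⟩, hql ▸ (hlev a ha).1⟩
      have h1 : (q.takeUntil u huq).length + (q.dropUntil u huq).length = q.length := by
        rw [← Walk.length_append, Walk.take_spec]
      have h2 := (hlev u huK).2.2 _ (mem_ball_iff.mpr ⟨_, hy, q.dropUntil u huq, le_rfl⟩)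
      have h3 := humax a ha
      have h4 : (q.takeUntil u huq).length = 0 := by omega
      exact hua.ne (Walk.eq_of_length_eq_zero h4).symm
    obtain ⟨a, ha, b, hb, hab, h1, h2⟩ := hK.2 u huK
    obtain ⟨qa, hqa, hla⟩ := hnbr a ha h1
    obtain ⟨qb, hqb, hlb⟩ := hnbr b hb h2
    have := path_unique_of_girth hC.girth hqa hqb (by simp only [Walk.length_cons]; omega)
    rw [Walk.cons.injEq] at this
    exact hab this.1

/-- A path `Q` from `a` to `b` outside `B(C, 2 * d)` except for its ends, and shortest paths from
the ends to `C`, which arrive at the positions `i` and `j`. -/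
structure Ear (G : SimpleGraph V) (g : ℕ) (γ : ℕ → V) (d : ℕ) where
  a : V
  b : V
  Q : G.Walk a b
  isPath : Q.IsPath
  z : V
  z_mem : z ∈ Q.support
  z_high : z ∉ ball G (Set.range γ) (2 * d)
  high : ∀ x ∈ Q.support, x ≠ a → x ≠ b → x ∉ ball G (Set.range γ) (2 * d)
  i : ℕ
  j : ℕ
  hi : i < g
  hj : j < g
  pa : G.Walk a (γ i)
  pb : G.Walk b (γ j)
  pa_isPath : pa.IsPath
  pb_isPath : pb.IsPath
  pa_length : pa.length = 2 * d
  pb_length : pb.length = 2 * d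
  pa_low : ∀ w ∈ pa.support, Anchored G (Set.range γ) (2 * d) w (γ i) ∧
        ∀ m, w ∉ ball G (Set.range γ) m → ∃ q : G.Walk a w, q.length + m < 2 * d ∧
          ∀ y ∈ q.support, y ∉ ball G (Set.range γ) m
  pb_low : ∀ w ∈ pb.support, Anchored G (Set.range γ) (2 * d) w (γ j) ∧
        ∀ m, w ∉ ball G (Set.range γ) m → ∃ q : G.Walk b w, q.length + m < 2 * d ∧
          ∀ y ∈ q.support, y ∉ ball G (Set.range γ) m
  a_high : ∀ l, a ∈ ball G (Set.range γ) l → 2 * d ≤ l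
  b_high : ∀ l, b ∈ ball G (Set.range γ) l → 2 * d ≤ l

/-- A cycle of `G[U]` that misses a vertex of the long shortest cycle `C` contains an ear. -/
theorem IsShortestCycle.exists_ear [Finite V] {g d : ℕ} {γ : ℕ → V} (hC : IsShortestCycle G g γ)
    (hd : 1 ≤ d) (hg : 8 * d + 2 < g)
    (hF : (restrict G (ball G (Set.range γ) d)ᶜ).IsAcyclic) {U : Set V}
    (hU : ¬ (restrict G U).IsAcyclic) (h0 : γ 0 ∉ U) :
    ∃ e : Ear G g γ d, ∀ x ∈ e.Q.support, x ∈ U := by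
  classical
  simp only [IsAcyclic, not_forall, not_not] at hU
  obtain ⟨v, c₀, hc₀⟩ := hU
  have hsupp : ∀ x ∈ c₀.support, x ∈ U := by
    obtain ⟨a, _, b, _, _, ha, _⟩ := (exists_core_of_isCycle hc₀).2 v c₀.start_mem_support
    exact support_subset_of_restrict c₀ ha.2.1
  have hc := hc₀.mapLe (restrict_le U)
  have hcU : ∀ x ∈ (c₀.mapLe (restrict_le U)).support, x ∈ U := by simpa using hsupp
  generalize c₀.mapLe (restrict_le U) = c at hc hcU
  -- Start the cycle at a vertex `z` outside `B(C,2d)`; it also meets `B(C,d)`, at `δ m`. The ear is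
  -- the arc through `z` between the nearest vertices of `B(C,2d)` on both sides.
  obtain ⟨z, hzc, hz⟩ := hC.exists_notMem_ball (r := 2 * d) (by omega) (exists_core_of_isCycle hc)
    (fun h => h0 (hcU _ h))
  have hc' := hc.rotate hzc
  have hcU' : ∀ x ∈ (c.rotate z hzc).support, x ∈ U := fun x hx =>
    hcU x (by simpa using hx)
  generalize c.rotate z hzc = D at hc' hcU'
  obtain ⟨δ, hδ, hδr, hδ0⟩ := exists_cyclicSeq_of_isCycle hc'
  obtain ⟨m, hm, hmlow⟩ : ∃ m < D.length, δ m ∈ ball G (Set.range γ) d := by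
    by_contra hcon
    push Not at hcon
    have hD : ∀ x ∈ D.support, x ∈ (ball G (Set.range γ) d)ᶜ := by
      intro x hx
      have : x ∈ Set.range δ := by rw [hδr]; exact hx
      obtain ⟨k, hk, rfl⟩ := hδ.exists_lt_of_mem_range this
      exact hcon k hk
    have hedge : ∀ e ∈ D.edges, e ∈ (restrict G (ball G (Set.range γ) d)ᶜ).edgeSet := by
      intro e he
      induction e with
      | h a b => exact ⟨D.adj_of_mem_edges he, hD _ (D.fst_mem_support_of_mem_edges he),
          hD _ (D.snd_mem_support_of_mem_edges he)⟩
    exact hF _ (hc'.transfer hedge)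
  generalize D.length = n at hδ hm
  -- A neighbour of a vertex outside `B(C,2d)` is at distance at least `2d` from `C`, so the ends of
  -- the ear are at distance exactly `2d`.
  have hexact : ∀ k l, δ k ∉ ball G (Set.range γ) (2 * d) →
      (δ l = δ (k + 1) ∨ δ k = δ (l + 1)) →
      ∀ r, δ l ∈ ball G (Set.range γ) r → 2 * d ≤ r := by
    intro k l hk hkl r hr
    by_contra hlt
    have hadj : G.Adj (δ k) (δ l) := by
      rcases hkl with h | h
      · rw [h]; exact hδ.adj k
      · rw [h]; exact (hδ.adj l).symm
    exact hk (mem_ball_of_walk hadj.toWalk hr (by simp; omega))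
  have hδn : δ n = z := by rw [← hδ0, ← hδ.periodic 0, zero_add]
  have hex1 : ∃ k, δ k ∈ ball G (Set.range γ) (2 * d) :=
    ⟨m, ball_mono subset_rfl (by omega) hmlow⟩
  have hex2 : ∃ t, t ≤ n ∧ δ (n - t) ∈ ball G (Set.range γ) (2 * d) :=
    ⟨n - m, by omega, ball_mono subset_rfl (show d ≤ 2 * d by omega)
      (by rwa [show n - (n - m) = m by omega])⟩
  obtain ⟨k, hk, hkmin⟩ : ∃ k, δ k ∈ ball G (Set.range γ) (2 * d) ∧
      ∀ l < k, δ l ∉ ball G (Set.range γ) (2 * d) :=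
    ⟨Nat.find hex1, Nat.find_spec hex1, fun l hl => Nat.find_min hex1 hl⟩
  obtain ⟨t, htn, ht, htmin⟩ : ∃ t, t ≤ n ∧ δ (n - t) ∈ ball G (Set.range γ) (2 * d) ∧
      ∀ l < t, l ≤ n → δ (n - l) ∉ ball G (Set.range γ) (2 * d) :=
    ⟨Nat.find hex2, (Nat.find_spec hex2).1, (Nat.find_spec hex2).2,
      fun l hl hln h => Nat.find_min hex2 hl ⟨hln, h⟩⟩
  have hk0 : 0 < k := by
    rcases Nat.eq_zero_or_pos k with rfl | h
    · rw [hδ0] at hk; exact absurd hk hz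
    · exact h
  have ht0 : 0 < t := by
    rcases Nat.eq_zero_or_pos t with rfl | h
    · rw [Nat.sub_zero, hδn] at ht; exact absurd ht hz
    · exact h
  have hb_high := hexact (k - 1) k (hkmin _ (by omega)) (Or.inl (by congr 1; omega))
  have ha_high := hexact (n - (t - 1)) (n - t) (htmin _ (by omega) (by omega))
    (Or.inr (by congr 1; omega))
  -- As `d < 2d`, the vertex `δ m` is not an end of the ear. It therefore separates the two ends,
  -- and the arc through `z` does not run around the whole cycle.
  have hkm : k < m := by
    by_contra hcon
    rcases (not_lt.mp hcon).lt_or_eq with h | h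
    · exact hkmin m h (ball_mono subset_rfl (by omega) hmlow)
    · rw [← h] at hb_high
      have := hb_high d hmlow
      omega
  have hmt : m < n - t := by
    by_contra hcon
    rcases (not_lt.mp hcon).lt_or_eq with h | h
    · refine htmin (n - m) (by omega) (by omega) (ball_mono subset_rfl
        (show d ≤ 2 * d by omega) ?_)
      rwa [show n - (n - m) = m by omega]
    · rw [h] at ha_high
      have := ha_high d hmlow
      omega
  obtain ⟨A, hA, -, hAs⟩ := hδ.exists_arc (n - t) (L := t + k) (by omega)
  have hend : δ (n - t + (t + k)) = δ k := by
    rw [← hδ.periodic k]; congr 1; omega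
  obtain ⟨x, hx, p, hp, hpl, hpw⟩ := exists_descent ht ha_high
  obtain ⟨y, hy, q, hq, hql, hqw⟩ := exists_descent hk hb_high
  obtain ⟨i, hi, rfl⟩ := hC.exists_lt_of_mem_range hx
  obtain ⟨j, hj, rfl⟩ := hC.exists_lt_of_mem_range hy
  refine ⟨{ a := δ (n - t), b := δ k, Q := A.copy rfl hend, isPath := by simpa using hA, z := z,
            z_mem := ?_, z_high := hz, high := ?_, i := i, j := j, hi := hi, hj := hj, pa := p,
            pb := q, pa_isPath := hp, pb_isPath := hq, pa_length := hpl, pb_length := hql,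
            pa_low := hpw, pb_low := hqw, a_high := ha_high, b_high := hb_high }, ?_⟩
  · rw [Walk.support_copy, hAs]
    exact ⟨t, by omega, by rw [← hδn]; congr 1; omega⟩
  · intro x hx hxa hxb
    rw [Walk.support_copy, hAs] at hx
    obtain ⟨s, hs, rfl⟩ := hx
    rcases lt_or_ge s t with hst | hst
    · have hs0 : 0 < s := Nat.pos_of_ne_zero fun h => hxa (by rw [h, add_zero])
      rw [show n - t + s = n - (t - s) by omega]
      exact htmin _ (by omega) (by omega)
    · have hsk : s ≠ t + k := fun h => hxb (by rw [h, hend])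
      rw [show n - t + s = s - t + n by omega, hδ.periodic]
      exact hkmin _ (by omega)
  · intro x hx
    simp only [Walk.support_copy] at hx
    obtain ⟨s, hs, rfl⟩ := (hAs x).mp hx
    have : δ (n - t + s) ∈ Set.range δ := ⟨_, rfl⟩
    rw [hδr] at this
    exact hcU' _ this

end ShortestCycle

end CyclePacking

namespace CyclePacking

open SimpleGraph

/-! ### Greedy choice of ears in the rooted forest -/

section Ears

variable {V : Type*} {G : SimpleGraph V}

theorem exists_subwalk {u v x y : V} (p : G.Walk u v) (hx : x ∈ p.support) (hy : y ∈ p.support) :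
    ∃ q : G.Walk x y, ∀ z ∈ q.support, z ∈ p.support := by
  classical
  refine ⟨(p.takeUntil x hx).reverse.append (p.takeUntil y hy), fun z hz => ?_⟩
  rw [Walk.mem_support_append_iff, Walk.support_reverse, List.mem_reverse] at hz
  exact hz.elim (fun h => p.support_takeUntil_subset_support hx h)
    fun h => p.support_takeUntil_subset_support hy h

theorem exists_walk_restrict {S : Set V} {u v : V} (p : G.Walk u v)
    (h : ∀ x ∈ p.support, x ∈ S) :
    ∃ q : (restrict G S).Walk u v, q.length = p.length ∧ q.support = p.support := by
  have hedge : ∀ e ∈ p.edges, e ∈ (restrict G S).edgeSet := by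
    intro e he
    induction e with
    | h a b => exact ⟨p.adj_of_mem_edges he, h _ (p.fst_mem_support_of_mem_edges he),
        h _ (p.snd_mem_support_of_mem_edges he)⟩
  exact ⟨p.transfer _ hedge, by simp, by simp⟩

/-- In a rooted forest, let `t` be the vertex of a walk `Q` that is closest to the root. A walk from
a vertex that is at most as deep as `t` can reach `Q` only through `t`. -/
theorem mem_support_of_depth_le {F : SimpleGraph V} (hF : F.IsAcyclic) {root : V → V}
    (hroot : ∀ v, F.Reachable (root v) v) (hconst : ∀ u v, F.Reachable u v → root u = root v)
    {a b t : V} {Q : F.Walk a b} (ht : t ∈ Q.support)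
    (hmin : ∀ x ∈ Q.support, F.dist (root t) t ≤ F.dist (root x) x) {z v : V}
    (hz : F.dist (root z) z ≤ F.dist (root t) t) (W : F.Walk z v) (hv : v ∈ Q.support) :
    t ∈ W.support := by
  classical
  by_contra htW
  obtain ⟨R, hR⟩ := exists_subwalk Q ht hv
  have hzt : root z = root t := hconst _ _ (W.reachable.trans R.reachable.symm)
  rw [hzt] at hz
  have hrz : F.Reachable (root t) z := hzt ▸ hroot z
  obtain ⟨q, -, hql⟩ := hrz.exists_path_of_dist
  obtain ⟨p, hp, hpl⟩ := (hroot t).exists_path_of_dist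
  -- A shortest path from the root to `z` can contain `t` only if `z = t`, because `z` is no deeper
  -- than `t`.
  have htq : t ∉ q.support := by
    intro h
    have h1 : (q.takeUntil t h).length + (q.dropUntil t h).length = q.length := by
      rw [← Walk.length_append, Walk.take_spec]
    have h2 := F.dist_le (q.takeUntil t h)
    have h3 : (q.dropUntil t h).length = 0 := by omega
    have := Walk.eq_of_length_eq_zero h3
    subst this
    exact htW W.start_mem_support
  have hRs : ∀ x ∈ R.bypass.support, x ∈ Q.support := fun x hx =>
    hR x (R.support_bypass_subset_support hx)
  have hRp := R.bypass_isPath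
  -- Let `y` follow `t` on the way along `Q` to `v`. As `y` is at least as deep as `t`, the path
  -- from the root to `y` runs through `t`. But the walk from the root over `z` and `v` to `y`
  -- avoids `t`, which is impossible in a forest.
  cases hRc : R.bypass with
  | nil => exact htW W.end_mem_support
  | @cons _ y _ h rest =>
    rw [hRc] at hRs hRp
    obtain ⟨-, htr⟩ := (Walk.cons_isPath_iff _ _).mp hRp
    have hyQ : y ∈ Q.support := hRs y (by simp)
    have hy : root y = root t := hconst _ _ h.symm.reachable
    have hyd := hmin y hyQ
    rw [hy] at hyd
    have hyp : y ∉ p.support := by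
      intro hyp
      have h1 : (p.takeUntil y hyp).length + (p.dropUntil y hyp).length = p.length := by
        rw [← Walk.length_append, Walk.take_spec]
      have h2 := F.dist_le (p.takeUntil y hyp)
      have h3 : (p.dropUntil y hyp).length = 0 := by omega
      exact h.ne (Walk.eq_of_length_eq_zero h3).symm
    have h1 : (p.concat h).IsPath := hp.concat hyp h
    let W' := (q.append W).append rest.reverse
    have htW' : t ∉ W'.support := by
      simp only [W', Walk.mem_support_append_iff, Walk.support_reverse, List.mem_reverse, not_or]
      exact ⟨⟨htq, htW⟩, htr⟩
    have h2 := (hF.subsingleton_path _ _).elim ⟨p.concat h, h1⟩ ⟨W'.bypass, W'.bypass_isPath⟩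
    have h3 : p.concat h = W'.bypass := congrArg Subtype.val h2
    apply htW'
    apply W'.support_bypass_subset_support
    rw [← h3, Walk.support_concat]
    simp

variable {g d : ℕ} {γ : ℕ → V}

namespace Ear

/-- The vertices of the ear together with its descents to the cycle. -/
def verts (e : Ear G g γ d) : Set V :=
  {x | x ∈ e.Q.support ∨ x ∈ e.pa.support ∨ x ∈ e.pb.support}

/-- The ears are at distance more than `d`, and so are the places where they meet the cycle. -/
def Far (e f : Ear G g γ d) : Prop :=
  (∀ u ∈ e.verts, ∀ w ∈ f.verts, ∀ q : G.Walk u w, d < q.length) ∧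
    d < cyc g e.i f.i ∧ d < cyc g e.i f.j ∧ d < cyc g e.j f.i ∧ d < cyc g e.j f.j

theorem Far.symm {e f : Ear G g γ d} (h : e.Far f) : f.Far e := by
  obtain ⟨h1, h2, h3, h4, h5⟩ := h
  refine ⟨fun u hu w hw q => ?_, ?_, ?_, ?_, ?_⟩
  · simpa using h1 w hw u hu q.reverse
  all_goals rw [cyc_comm]; assumption

/-- The ear splits into a high part, where the forest controls distances, and a part anchored to
`C`, where the girth does. The ends of `Q` belong to the second part. -/
theorem mem_verts_cases (e : Ear G g γ d) {u : V} (hu : u ∈ e.verts) :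
    (u ∈ e.Q.support ∧ u ∉ ball G (Set.range γ) (2 * d)) ∨
      ∃ k < g, (k = e.i ∨ k = e.j) ∧ Anchored G (Set.range γ) (2 * d) u (γ k) ∧
        ∀ m, u ∉ ball G (Set.range γ) m → ∃ x ∈ e.Q.support, ∃ q : G.Walk x u,
          q.length + m < 2 * d ∧ ∀ y ∈ q.support, y ∉ ball G (Set.range γ) m := by
  have ha : u ∈ e.pa.support → ∃ k < g, (k = e.i ∨ k = e.j) ∧
      Anchored G (Set.range γ) (2 * d) u (γ k) ∧
        ∀ m, u ∉ ball G (Set.range γ) m → ∃ x ∈ e.Q.support, ∃ q : G.Walk x u,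
          q.length + m < 2 * d ∧ ∀ y ∈ q.support, y ∉ ball G (Set.range γ) m := fun h =>
    ⟨e.i, e.hi, Or.inl rfl, (e.pa_low u h).1, fun m hm =>
      ⟨e.a, e.Q.start_mem_support, (e.pa_low u h).2 m hm⟩⟩
  have hb : u ∈ e.pb.support → ∃ k < g, (k = e.i ∨ k = e.j) ∧
      Anchored G (Set.range γ) (2 * d) u (γ k) ∧
        ∀ m, u ∉ ball G (Set.range γ) m → ∃ x ∈ e.Q.support, ∃ q : G.Walk x u,
          q.length + m < 2 * d ∧ ∀ y ∈ q.support, y ∉ ball G (Set.range γ) m := fun h =>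
    ⟨e.j, e.hj, Or.inr rfl, (e.pb_low u h).1, fun m hm =>
      ⟨e.b, e.Q.end_mem_support, (e.pb_low u h).2 m hm⟩⟩
  rcases hu with hu | hu | hu
  · by_cases h1 : u = e.a
    · exact Or.inr (ha (h1 ▸ e.pa.start_mem_support))
    by_cases h2 : u = e.b
    · exact Or.inr (hb (h2 ▸ e.pb.start_mem_support))
    exact Or.inl ⟨hu, e.high u hu h1 h2⟩
  · exact Or.inr (ha hu)
  · exact Or.inr (hb hu)

theorem notMem_ball_of_mem_Q (e : Ear G g γ d) (hd : 1 ≤ d) {x : V} (hx : x ∈ e.Q.support) :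
    x ∉ ball G (Set.range γ) d := by
  intro h
  by_cases h1 : x = e.a
  · have := e.a_high d (h1 ▸ h); omega
  by_cases h2 : x = e.b
  · have := e.b_high d (h2 ▸ h); omega
  exact e.high x hx h1 h2 (ball_mono subset_rfl (by omega) h)

end Ear

/-- Two ears are far from each other if their attachments to the cycle are, and if no short walk
outside `B(C, d)` joins them. -/
theorem IsShortestCycle.far_of_walks (hC : IsShortestCycle G g γ) (hg : 10 * d < g)
    {e f : Ear G g γ d}
    (h1 : ∀ u ∈ e.Q.support, ∀ w ∈ f.Q.support, ∀ q : G.Walk u w,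
      (∀ y ∈ q.support, y ∉ ball G (Set.range γ) d) → 2 * d < q.length)
    (h2 : d < cyc g e.i f.i) (h3 : d < cyc g e.i f.j) (h4 : d < cyc g e.j f.i)
    (h5 : d < cyc g e.j f.j) : e.Far f := by
  classical
  refine ⟨fun u hu w hw q => ?_, h2, h3, h4, h5⟩
  by_contra hq
  -- If one end of `q` is outside `B(C,2d)`, all of `q` avoids `B(C,d)`. If the other end is on a
  -- descent, a piece of length less than `d` leads back up to the path of that ear, still outside
  -- `B(C,d)`; in total this is at most `2d`.
  have havoid : ∀ {x y : V} (r : G.Walk x y), r.length ≤ d →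
      x ∉ ball G (Set.range γ) (2 * d) → ∀ z ∈ r.support, z ∉ ball G (Set.range γ) d := by
    intro x y r hr hx z hz hzb
    have := r.length_takeUntil_le_length hz
    exact hx (mem_ball_of_walk (r.takeUntil z hz) hzb (by omega))
  rcases e.mem_verts_cases hu with ⟨huQ, huh⟩ | ⟨k, hk, hki, hku, hkm⟩
  · have hqa := havoid q (by omega) huh
    rcases f.mem_verts_cases hw with ⟨hwQ, -⟩ | ⟨l, hl, hli, hlw, hlm⟩
    · have := h1 u huQ w hwQ q hqa
      omega
    · obtain ⟨x, hx, r, hr, hra⟩ := hlm d (hqa w q.end_mem_support)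
      have := h1 u huQ x hx (q.append r.reverse) (fun y hy => by
        rw [Walk.mem_support_append_iff, Walk.support_reverse, List.mem_reverse] at hy
        exact hy.elim (hqa y) (hra y))
      rw [Walk.length_append, Walk.length_reverse] at this
      omega
  · rcases f.mem_verts_cases hw with ⟨hwQ, hwh⟩ | ⟨l, hl, hli, hlw, hlm⟩
    · have hqa : ∀ z ∈ q.support, z ∉ ball G (Set.range γ) d := fun z hz =>
        havoid q.reverse (by simpa using hq) hwh z (by simpa using hz)
      obtain ⟨x, hx, r, hr, hra⟩ := hkm d (hqa u q.start_mem_support)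
      have := h1 x hx w hwQ (r.append q) (fun y hy => by
        rw [Walk.mem_support_append_iff] at hy
        exact hy.elim (hra y) (hqa y))
      rw [Walk.length_append] at this
      omega
    -- Both vertices are anchored within `2d`, and `4 * (2d) + 2 * d = 10d < g`.
    · have := (hC.cyc_le_of_anchored hk hl hku hlw q (not_lt.mp hq) (by omega)).1
      rcases hki with rfl | rfl <;> rcases hli with rfl | rfl <;> omega

/-- The vertices of the cycle within distance `d` of the position `i`. -/
def arcAround (g : ℕ) (γ : ℕ → V) (d i : ℕ) : Set V := {x | ∃ k < g, cyc g k i ≤ d ∧ γ k = x}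

/-- The vertex `t` and the two arcs around the positions `i` and `j`. -/
def earTrace (g : ℕ) (γ : ℕ → V) (d : ℕ) (t : V) (i j : ℕ) : Set V :=
  {t} ∪ arcAround g γ d i ∪ arcAround g γ d j

/-- The ear avoids the ball around `Z`. -/
def Ear.Survives (e : Ear G g γ d) (Z : Set V) : Prop :=
  ∀ x ∈ e.Q.support, x ∉ ball G Z (2 * d)

theorem Ear.Survives.mono {e : Ear G g γ d} {Z Z' : Set V} (h : e.Survives Z') (hZ : Z ⊆ Z') :
    e.Survives Z := fun x hx hb => h x hx (ball_mono hZ le_rfl hb)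

/-- Among the surviving ears there is one whose top `t` is deepest in the rooted forest. -/
theorem IsShortestCycle.exists_deepest_ear [Finite V] (hC : IsShortestCycle G g γ) (hd : 1 ≤ d)
    (hg : 8 * d + 2 < g) (hF : (restrict G (ball G (Set.range γ) d)ᶜ).IsAcyclic)
    {depth : V → ℕ} {M : ℕ} (hM : ∀ v, depth v ≤ M) {Z : Set V} (hZ : γ 0 ∈ Z)
    (hcyc : ¬ (restrict G (ball G Z (2 * d))ᶜ).IsAcyclic) :
    ∃ e : Ear G g γ d, ∃ t ∈ e.Q.support, e.Survives Z ∧ (∀ x ∈ e.Q.support, depth t ≤ depth x) ∧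
      ∀ f : Ear G g γ d, f.Survives Z → ∃ s ∈ f.Q.support, depth s ≤ depth t := by
  classical
  obtain ⟨e₀, he₀⟩ := hC.exists_ear hd hg hF hcyc (fun h => h (self_mem_ball hZ))
  -- For the greatest `k` such that a surviving ear has depth at least `k` throughout, no surviving
  -- ear can stay strictly below the top of that ear.
  let P : ℕ → Prop := fun k => ∃ e : Ear G g γ d, e.Survives Z ∧ ∀ x ∈ e.Q.support, k ≤ depth x
  have hP0 : P 0 := ⟨e₀, he₀, fun _ _ => Nat.zero_le _⟩
  have hPM : ∀ k, P k → k ≤ M := fun k ⟨e, _, h⟩ => (h _ e.Q.start_mem_support).trans (hM _)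
  have hmax := Nat.findGreatest_spec (P := P) (Nat.zero_le M) hP0
  obtain ⟨e, he, hdep⟩ := hmax
  obtain ⟨t, ht, htmin⟩ := Set.exists_min_image {x | x ∈ e.Q.support} depth (Set.toFinite _)
    ⟨_, e.Q.start_mem_support⟩
  refine ⟨e, t, ht, he, htmin, fun f hf => ?_⟩
  by_contra hcon
  push Not at hcon
  have hP : P (depth t + 1) := ⟨f, hf, hcon⟩
  have h1 := Nat.le_findGreatest (hPM _ hP) hP
  have h2 := hdep t ht
  omega

/-- A connection of length at most `2d` outside `B(C,d)`, prolonged along `f.Q`, is a walk of the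
forest from `s` to `e.Q`. As `s` is no deeper than `t`, it passes through `t`, so `f.Q` comes within
`2d` of `t`, which survival forbids. -/
theorem IsShortestCycle.far_of_survives (hC : IsShortestCycle G g γ) (hd : 1 ≤ d)
    (hg : 10 * d < g) (hF : (restrict G (ball G (Set.range γ) d)ᶜ).IsAcyclic) {root : V → V}
    (hroot : ∀ v, (restrict G (ball G (Set.range γ) d)ᶜ).Reachable (root v) v)
    (hconst : ∀ u v, (restrict G (ball G (Set.range γ) d)ᶜ).Reachable u v → root u = root v)
    {depth : V → ℕ}
    (hdepth : ∀ v, depth v = (restrict G (ball G (Set.range γ) d)ᶜ).dist (root v) v)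
    {e f : Ear G g γ d} {t s : V} (ht : t ∈ e.Q.support)
    (hmin : ∀ x ∈ e.Q.support, depth t ≤ depth x) (hs : s ∈ f.Q.support)
    (hst : depth s ≤ depth t) (hf : f.Survives (earTrace g γ d t e.i e.j)) : e.Far f := by
  classical
  -- The end `f.a` is within `2d` of its foot, so a foot on an arc of the trace would put `f.a` into
  -- the deleted ball.
  have hi : d < cyc g f.i e.i := by
    by_contra hcon
    refine hf f.a f.Q.start_mem_support (mem_ball_iff.mpr ⟨γ f.i, ?_, f.pa, f.pa_length.le⟩)
    exact Or.inl (Or.inr ⟨f.i, f.hi, not_lt.mp hcon, rfl⟩)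
  have hj : d < cyc g f.i e.j := by
    by_contra hcon
    refine hf f.a f.Q.start_mem_support (mem_ball_iff.mpr ⟨γ f.i, ?_, f.pa, f.pa_length.le⟩)
    exact Or.inr ⟨f.i, f.hi, not_lt.mp hcon, rfl⟩
  have hi' : d < cyc g f.j e.i := by
    by_contra hcon
    refine hf f.b f.Q.end_mem_support (mem_ball_iff.mpr ⟨γ f.j, ?_, f.pb, f.pb_length.le⟩)
    exact Or.inl (Or.inr ⟨f.j, f.hj, not_lt.mp hcon, rfl⟩)
  have hj' : d < cyc g f.j e.j := by
    by_contra hcon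
    refine hf f.b f.Q.end_mem_support (mem_ball_iff.mpr ⟨γ f.j, ?_, f.pb, f.pb_length.le⟩)
    exact Or.inr ⟨f.j, f.hj, not_lt.mp hcon, rfl⟩
  rw [cyc_comm] at hi hj hi' hj'
  refine hC.far_of_walks hg ?_ hi hi' hj hj'
  intro u hu w hw q hq
  by_contra hlen
  obtain ⟨QF, -, hQF⟩ := exists_walk_restrict (S := (ball G (Set.range γ) d)ᶜ) e.Q
    fun x hx => e.notMem_ball_of_mem_Q hd hx
  obtain ⟨W₁, hW₁⟩ := exists_subwalk f.Q hs hw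
  obtain ⟨W, -, hW⟩ := exists_walk_restrict (S := (ball G (Set.range γ) d)ᶜ)
    (W₁.append q.reverse) (fun x hx => by
      rw [Walk.mem_support_append_iff, Walk.support_reverse, List.mem_reverse] at hx
      exact hx.elim (fun h => f.notMem_ball_of_mem_Q hd (hW₁ x h)) (hq x))
  have key := mem_support_of_depth_le hF hroot hconst (Q := QF) (t := t) (by rwa [hQF])
    (fun x hx => by rw [hQF] at hx; rw [← hdepth, ← hdepth]; exact hmin x hx)
    (by rw [← hdepth, ← hdepth]; exact hst) W (by rwa [hQF])
  rw [hW, Walk.mem_support_append_iff, Walk.support_reverse, List.mem_reverse] at key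
  have htt : t ∈ earTrace g γ d t e.i e.j := Or.inl (Or.inl rfl)
  rcases key with key | key
  · exact hf t (hW₁ t key) (self_mem_ball htt)
  · refine hf w hw (mem_ball_iff.mpr ⟨t, htt, (q.dropUntil t key).reverse, ?_⟩)
    have := q.length_dropUntil_le_length key
    rw [Walk.length_reverse]
    omega

/-- Three traces of ears are enough, or there are four ears far from each other. -/
theorem IsShortestCycle.traces_or_far_ears [Fintype V] (hC : IsShortestCycle G g γ) (hd : 1 ≤ d)
    (hg : 10 * d + 2 < g) (hF : (restrict G (ball G (Set.range γ) d)ᶜ).IsAcyclic) :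
    (∃ (t : Fin 3 → V) (i j : Fin 3 → ℕ), (∀ l, i l < g) ∧ (∀ l, j l < g) ∧
      (restrict G (ball G ({γ 0} ∪ ⋃ l, earTrace g γ d (t l) (i l) (j l)) (2 * d))ᶜ).IsAcyclic) ∨
    ∃ e : Fin 4 → Ear G g γ d, ∀ k l, k < l → (e k).Far (e l) := by
  classical
  set F := restrict G (ball G (Set.range γ) d)ᶜ with hFdef
  let root : V → V := fun v => (F.connectedComponentMk v).out
  have hroot : ∀ v, F.Reachable (root v) v := fun v =>
    ConnectedComponent.exact (Quot.out_eq (F.connectedComponentMk v))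
  have hconst : ∀ u v, F.Reachable u v → root u = root v := fun u v h => by
    simp only [root, ConnectedComponent.sound h]
  let depth : V → ℕ := fun v => F.dist (root v) v
  have hM : ∀ v, depth v ≤ Fintype.card V := fun v => (dist_lt_card (hroot v)).le
  have hpos : 0 < g := by omega
  have mono : ∀ {Z Z' : Set V}, Z ⊆ Z' → (restrict G (ball G Z (2 * d))ᶜ).IsAcyclic →
      (restrict G (ball G Z' (2 * d))ᶜ).IsAcyclic := fun h h' =>
    h'.anti (restrict_mono (Set.compl_subset_compl.mpr (ball_mono h le_rfl)))
  have step : ∀ Z : Set V, γ 0 ∈ Z → ¬ (restrict G (ball G Z (2 * d))ᶜ).IsAcyclic → _ :=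
    fun Z hZ hcyc => hC.exists_deepest_ear hd (by omega) hF hM hZ hcyc
  have far : ∀ {e f : Ear G g γ d} {t : V} {Z : Set V}, t ∈ e.Q.support →
      (∀ x ∈ e.Q.support, depth t ≤ depth x) →
      (∀ f : Ear G g γ d, f.Survives Z → ∃ s ∈ f.Q.support, depth s ≤ depth t) →
      f.Survives Z → f.Survives (earTrace g γ d t e.i e.j) → e.Far f := by
    intro e f t Z ht hmin hall hfZ hft
    obtain ⟨s, hs, hst⟩ := hall f hfZ
    exact hC.far_of_survives hd (by omega) hF hroot hconst (fun _ => rfl) ht hmin hs hst hft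
  by_cases h0 : (restrict G (ball G {γ 0} (2 * d))ᶜ).IsAcyclic
  · exact Or.inl ⟨fun _ => γ 0, fun _ => 0, fun _ => 0, fun _ => hpos, fun _ => hpos,
      mono Set.subset_union_left h0⟩
  -- The deleted sets increase, so a later ear was available in every earlier round; the maximality
  -- of that round makes it far from the ear chosen there.
  obtain ⟨e₁, t₁, ht₁, hs₁, hm₁, ha₁⟩ := step {γ 0} rfl h0
  set Z₁ : Set V := {γ 0} ∪ earTrace g γ d t₁ e₁.i e₁.j with hZ₁
  by_cases h1 : (restrict G (ball G Z₁ (2 * d))ᶜ).IsAcyclic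
  · refine Or.inl ⟨fun _ => t₁, fun _ => e₁.i, fun _ => e₁.j, fun _ => e₁.hi, fun _ => e₁.hj,
      mono ?_ h1⟩
    exact Set.union_subset_union_right _ (Set.subset_iUnion_of_subset 0 subset_rfl)
  obtain ⟨e₂, t₂, ht₂, hs₂, hm₂, ha₂⟩ := step Z₁ (Or.inl rfl) h1
  set Z₂ : Set V := Z₁ ∪ earTrace g γ d t₂ e₂.i e₂.j with hZ₂
  by_cases h2 : (restrict G (ball G Z₂ (2 * d))ᶜ).IsAcyclic
  · refine Or.inl ⟨![t₁, t₂, t₂], ![e₁.i, e₂.i, e₂.i], ![e₁.j, e₂.j, e₂.j], ?_, ?_, mono ?_ h2⟩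
    · intro l; fin_cases l <;> simp [Ear.hi]
    · intro l; fin_cases l <;> simp [Ear.hj]
    · rintro x ((hx | hx) | hx)
      · exact Or.inl hx
      · exact Or.inr (Set.mem_iUnion.mpr ⟨0, hx⟩)
      · exact Or.inr (Set.mem_iUnion.mpr ⟨1, hx⟩)
  obtain ⟨e₃, t₃, ht₃, hs₃, hm₃, ha₃⟩ := step Z₂ (Or.inl (Or.inl rfl)) h2
  set Z₃ : Set V := Z₂ ∪ earTrace g γ d t₃ e₃.i e₃.j with hZ₃
  by_cases h3 : (restrict G (ball G Z₃ (2 * d))ᶜ).IsAcyclic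
  · refine Or.inl ⟨![t₁, t₂, t₃], ![e₁.i, e₂.i, e₃.i], ![e₁.j, e₂.j, e₃.j], ?_, ?_, mono ?_ h3⟩
    · intro l; fin_cases l <;> simp [Ear.hi]
    · intro l; fin_cases l <;> simp [Ear.hj]
    · rintro x (((hx | hx) | hx) | hx)
      · exact Or.inl hx
      · exact Or.inr (Set.mem_iUnion.mpr ⟨0, hx⟩)
      · exact Or.inr (Set.mem_iUnion.mpr ⟨1, hx⟩)
      · exact Or.inr (Set.mem_iUnion.mpr ⟨2, hx⟩)
  obtain ⟨e₄, t₄, ht₄, hs₄, hm₄, ha₄⟩ := step Z₃ (Or.inl (Or.inl (Or.inl rfl))) h3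
  have i01 : ({γ 0} : Set V) ⊆ Z₁ := Set.subset_union_left
  have i12 : Z₁ ⊆ Z₂ := Set.subset_union_left
  have i23 : Z₂ ⊆ Z₃ := Set.subset_union_left
  have y1 : earTrace g γ d t₁ e₁.i e₁.j ⊆ Z₁ := Set.subset_union_right
  have y2 : earTrace g γ d t₂ e₂.i e₂.j ⊆ Z₂ := Set.subset_union_right
  have y3 : earTrace g γ d t₃ e₃.i e₃.j ⊆ Z₃ := Set.subset_union_right
  have f12 : e₁.Far e₂ := far ht₁ hm₁ ha₁ (hs₂.mono i01) (hs₂.mono y1)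
  have f13 : e₁.Far e₃ := far ht₁ hm₁ ha₁ (hs₃.mono (i01.trans i12)) (hs₃.mono (y1.trans i12))
  have f14 : e₁.Far e₄ := far ht₁ hm₁ ha₁ (hs₄.mono ((i01.trans i12).trans i23))
    (hs₄.mono ((y1.trans i12).trans i23))
  have f23 : e₂.Far e₃ := far ht₂ hm₂ ha₂ (hs₃.mono i12) (hs₃.mono y2)
  have f24 : e₂.Far e₄ := far ht₂ hm₂ ha₂ (hs₄.mono (i12.trans i23)) (hs₄.mono (y2.trans i23))
  have f34 : e₃.Far e₄ := far ht₃ hm₃ ha₃ (hs₄.mono i23) (hs₄.mono y3)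
  refine Or.inr ⟨![e₁, e₂, e₃, e₄], fun k l hkl => ?_⟩
  fin_cases k <;> fin_cases l <;> first | exact absurd hkl (by decide) | assumption

end Ears

end CyclePacking

namespace CyclePacking

open SimpleGraph

/-! ### From four far ears to two far cycles described by a tuple -/

section Existence

variable {V : Type*} {G : SimpleGraph V}

/-- A closed chain of four geodesic pieces. -/
def cycleSet (D : V → V → ℕ) (p : Fin 14 → V) : Set V :=
  between D (p 0) (p 1) ∪ between D (p 1) (p 2) ∪ between D (p 2) (p 3) ∪ between D (p 3) (p 0)

/-- A closed chain of ten geodesic pieces, two of them for the second distance function. -/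
def chainSet (D D' : V → V → ℕ) (p : Fin 14 → V) : Set V :=
  between D' (p 4) (p 5) ∪ (between D (p 5) (p 8) ∪ between D (p 8) (p 9) ∪ between D (p 9) (p 10) ∪
    between D (p 10) (p 7)) ∪ between D' (p 7) (p 6) ∪ (between D (p 6) (p 11) ∪
    between D (p 11) (p 12) ∪ between D (p 12) (p 13) ∪ between D (p 13) (p 4))

/-- The graph `G` without the ball of radius `d` around `cycleSet`. -/
def awayFromCycle (G : SimpleGraph V) (M d : ℕ) (p : Fin 14 → V) : SimpleGraph V :=
  restrict G (ball G (cycleSet (cappedDist G M) p) d)ᶜ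

theorem cappedDist_comm (M : ℕ) (u v : V) : cappedDist G M u v = cappedDist G M v u := by
  classical
  unfold cappedDist
  rw [G.dist_comm (u := u) (v := v)]
  exact if_congr ⟨Reachable.symm, Reachable.symm⟩ rfl rfl

theorem between_comm (M : ℕ) (u v : V) :
    between (cappedDist G M) u v = between (cappedDist G M) v u := by
  ext w
  simp only [between, Set.mem_ofPred_eq]
  rw [cappedDist_comm M u w, cappedDist_comm M w v, cappedDist_comm M u v, add_comm]

theorem lt_cyc {g d i j : ℕ} (h1 : i + d < j) (h2 : j + d < i + g) : d < cyc g i j := by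
  unfold cyc; omega

theorem lt_cyc' {g d i j : ℕ} (h1 : j + d < i) (h2 : i + d < j + g) : d < cyc g i j := by
  unfold cyc; omega

theorem add_lt_of_lt_cyc {g d i j : ℕ} (hij : i ≤ j) (h : d < cyc g i j) :
    i + d < j ∧ j + d < i + g := by
  unfold cyc at h; omega

theorem add_lt_of_lt_cyc' {g d i j : ℕ} (hij : j ≤ i) (h : d < cyc g i j) :
    j + d < i ∧ i + d < j + g := by
  unfold cyc at h; omega

namespace Ear

variable {g d : ℕ} {γ : ℕ → V}

/-- The same ear, traversed in the other direction. -/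
def swap (e : Ear G g γ d) : Ear G g γ d where
  a := e.b
  b := e.a
  Q := e.Q.reverse
  isPath := e.isPath.reverse
  z := e.z
  z_mem := by simpa using e.z_mem
  z_high := e.z_high
  high x hx hb ha := e.high x (by simpa using hx) ha hb
  i := e.j
  j := e.i
  hi := e.hj
  hj := e.hi
  pa := e.pb
  pb := e.pa
  pa_isPath := e.pb_isPath
  pb_isPath := e.pa_isPath
  pa_length := e.pb_length
  pb_length := e.pa_length
  pa_low := e.pb_low
  pb_low := e.pa_low
  a_high := e.b_high
  b_high := e.a_high

theorem verts_swap (e : Ear G g γ d) : e.swap.verts = e.verts := by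
  ext x
  simp only [verts, swap, Walk.support_reverse, List.mem_reverse, Set.mem_ofPred_eq]
  tauto

theorem Far.swap_left {e f : Ear G g γ d} (h : e.Far f) : e.swap.Far f := by
  obtain ⟨h1, h2, h3, h4, h5⟩ := h
  exact ⟨by rwa [verts_swap], h4, h5, h2, h3⟩

theorem mem_ball_of_mem_pa (e : Ear G g γ d) {x : V} (hx : x ∈ e.pa.support) :
    x ∈ ball G (Set.range γ) (2 * d) := by
  obtain ⟨p, hp, -⟩ := (e.pa_low x hx).1
  exact mem_ball_iff.mpr ⟨_, ⟨_, rfl⟩, p, hp⟩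

theorem mem_ball_of_mem_pb (e : Ear G g γ d) {x : V} (hx : x ∈ e.pb.support) :
    x ∈ ball G (Set.range γ) (2 * d) := e.swap.mem_ball_of_mem_pa hx

end Ear

variable {g d : ℕ} {γ : ℕ → V}

/-- The union of the ears in `E` and of the vertices of the cycle at the positions in `I`. -/
def earUnion (E : Set (Ear G g γ d)) (I : Set ℕ) : Set V :=
  {x | (∃ e ∈ E, x ∈ e.verts) ∨ ∃ k ∈ I, γ k = x}

/-- A vertex of `C` within `d` of an ear is, by the girth, within `d` of a foot of that ear along
`C`. So distances that involve `C` are controlled by the index sets, and `Far` takes care of two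
ears. -/
theorem IsShortestCycle.lt_length_of_earUnion (hC : IsShortestCycle G g γ)
    (hg : 10 * d < g) {E E' : Set (Ear G g γ d)} {I I' : Set ℕ}
    (hEE : ∀ e ∈ E, ∀ f ∈ E', e.Far f) (hII : ∀ k ∈ I, ∀ l ∈ I', d < cyc g k l)
    (hI : ∀ k ∈ I, k < g) (hI' : ∀ k ∈ I', k < g)
    (hE : ∀ e ∈ E, e.i ∈ I ∧ e.j ∈ I) (hE' : ∀ e ∈ E', e.i ∈ I' ∧ e.j ∈ I')
    {u v : V} (hu : u ∈ earUnion E I) (hv : v ∈ earUnion E' I') (q : G.Walk u v) :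
    d < q.length := by
  classical
  have key : ∀ (f : Ear G g γ d) (k : ℕ), k < g → ∀ w ∈ f.verts, ∀ q : G.Walk (γ k) w,
      q.length ≤ d → cyc g k f.i ≤ d ∨ cyc g k f.j ≤ d := by
    intro f k hk w hw q hq
    rcases f.mem_verts_cases hw with ⟨-, h⟩ | ⟨l, hl, hli, ha, -⟩
    · have hwb : w ∈ ball G (Set.range γ) (2 * d) :=
        mem_ball_iff.mpr ⟨γ k, ⟨k, rfl⟩, q.reverse, by rw [Walk.length_reverse]; omega⟩
      exact absurd hwb h
    · have := (hC.cyc_le_of_anchored hk hl (Anchored.refl _ (2 * d) _) ha q hq (by omega)).1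
      rcases hli with rfl | rfl
      · exact Or.inl this
      · exact Or.inr this
  by_contra hcon
  have hq := not_lt.mp hcon
  rcases hu with ⟨e, he, hu⟩ | ⟨k, hk, rfl⟩
  · rcases hv with ⟨f, hf, hv⟩ | ⟨l, hl, rfl⟩
    · exact hcon ((hEE e he f hf).1 u hu v hv q)
    · have := key e l (hI' l hl) u hu q.reverse (by simpa using hq)
      have h1 := hII _ (hE e he).1 l hl
      have h2 := hII _ (hE e he).2 l hl
      rw [cyc_comm] at h1 h2
      omega
  · rcases hv with ⟨f, hf, hv⟩ | ⟨l, hl, rfl⟩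
    · have := key f k (hI k hk) v hv q hq
      have h1 := hII k hk _ (hE' f hf).1
      have h2 := hII k hk _ (hE' f hf).2
      omega
    · have h1 := hII k hk l hl
      have h2 := (hC.cyc_le_of_anchored (hI k hk) (hI' l hl) (Anchored.refl _ (2 * d) _)
        (Anchored.refl _ (2 * d) _) q hq (by omega)).1
      omega

theorem IsCyclicSeq.exists_arc_of_le (hC : IsCyclicSeq G g γ) {i j : ℕ} (hij : i ≤ j)
    (hj : j < i + g) : ∃ A : G.Walk (γ i) (γ j), A.IsPath ∧ A.length = j - i ∧
      ∀ x, x ∈ A.support ↔ ∃ k, i ≤ k ∧ k ≤ j ∧ γ k = x := by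
  obtain ⟨A, h1, h2, h3⟩ := hC.exists_arc i (L := j - i) (by omega)
  refine ⟨A.copy rfl (by congr 1; omega), by simpa using h1, by simpa using h2, fun x => ?_⟩
  rw [Walk.support_copy, h3]
  constructor
  · rintro ⟨k, hk, rfl⟩
    exact ⟨i + k, by omega, by omega, rfl⟩
  · rintro ⟨k, h1, h2, rfl⟩
    exact ⟨k - i, by omega, by congr 1; omega⟩

/-- An ear and an arc that joins its ends contain a cycle. -/
theorem Ear.not_isAcyclic_of_arc (e : Ear G g γ d) {S : Set V} (hS : e.verts ⊆ S)
    (A : G.Walk (γ e.i) (γ e.j)) (hA : ∀ x ∈ A.support, x ∈ Set.range γ ∧ x ∈ S) :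
    ¬ (restrict G S).IsAcyclic := by
  -- The vertex `z` is outside `B(C,2d)`, while the detour over the descents and the arc stays
  -- inside.
  refine not_isAcyclic_of_walk_avoiding (q := e.pa.append (A.append e.pb.reverse)) e.isPath e.z_mem
    (fun hz => ?_) (fun x hx => hS (Or.inl hx)) (fun x hx => ?_)
  · simp only [Walk.mem_support_append_iff, Walk.support_reverse, List.mem_reverse] at hz
    rcases hz with hz | hz | hz
    · exact e.z_high (e.mem_ball_of_mem_pa hz)
    · exact e.z_high (self_mem_ball (hA _ hz).1)
    · exact e.z_high (e.mem_ball_of_mem_pb hz)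
  · simp only [Walk.mem_support_append_iff, Walk.support_reverse, List.mem_reverse] at hx
    rcases hx with hx | hx | hx
    · exact hS (Or.inr (Or.inl hx))
    · exact (hA _ hx).2
    · exact hS (Or.inr (Or.inr hx))

/-- Two ears and two arcs that join their ends contain a cycle. -/
theorem Ear.not_isAcyclic_of_arcs (e f : Ear G g γ d) (hfar : e.Far f) {S : Set V}
    (hSe : e.verts ⊆ S) (hSf : f.verts ⊆ S) (A : G.Walk (γ e.i) (γ f.i))
    (hA : ∀ x ∈ A.support, x ∈ Set.range γ ∧ x ∈ S) (B : G.Walk (γ e.j) (γ f.j))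
    (hB : ∀ x ∈ B.support, x ∈ Set.range γ ∧ x ∈ S) : ¬ (restrict G S).IsAcyclic := by
  have hzf : e.z ∉ f.verts := fun h => by
    have := hfar.1 e.z (Or.inl e.z_mem) e.z h .nil
    simp at this
  refine not_isAcyclic_of_walk_avoiding (q := e.pa.append (A.append (f.pa.reverse.append (f.Q.append
    (f.pb.append (B.reverse.append e.pb.reverse)))))) e.isPath e.z_mem
    (fun hz => ?_) (fun x hx => hSe (Or.inl hx)) (fun x hx => ?_)
  · simp only [Walk.mem_support_append_iff, Walk.support_reverse, List.mem_reverse] at hz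
    rcases hz with hz | hz | hz | hz | hz | hz | hz
    · exact e.z_high (e.mem_ball_of_mem_pa hz)
    · exact e.z_high (self_mem_ball (hA _ hz).1)
    · exact hzf (Or.inr (Or.inl hz))
    · exact hzf (Or.inl hz)
    · exact hzf (Or.inr (Or.inr hz))
    · exact e.z_high (self_mem_ball (hB _ hz).1)
    · exact e.z_high (e.mem_ball_of_mem_pb hz)
  · simp only [Walk.mem_support_append_iff, Walk.support_reverse, List.mem_reverse] at hx
    rcases hx with hx | hx | hx | hx | hx | hx | hx
    · exact hSe (Or.inr (Or.inl hx))
    · exact (hA _ hx).2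
    · exact hSf (Or.inr (Or.inl hx))
    · exact hSf (Or.inl hx)
    · exact hSf (Or.inr (Or.inr hx))
    · exact (hB _ hx).2
    · exact hSe (Or.inr (Or.inr hx))

theorem IsCyclicSeq.not_isAcyclic_inner (hC : IsCyclicSeq G g γ) {E : Set (Ear G g γ d)} {I : Set ℕ}
    {e : Ear G g γ d} (he : e ∈ E) (hij : e.i ≤ e.j) (hI : Set.Icc e.i e.j ⊆ I) :
    ¬ (restrict G (earUnion E I)).IsAcyclic := by
  obtain ⟨A, -, -, hA⟩ := hC.exists_arc_of_le hij (by have := e.hj; omega)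
  refine e.not_isAcyclic_of_arc (fun x hx => Or.inl ⟨e, he, hx⟩) A fun x hx => ?_
  obtain ⟨k, h1, h2, rfl⟩ := (hA x).mp hx
  exact ⟨⟨k, rfl⟩, Or.inr ⟨k, hI ⟨h1, h2⟩, rfl⟩⟩

theorem IsCyclicSeq.not_isAcyclic_outer (hC : IsCyclicSeq G g γ) {E : Set (Ear G g γ d)} {I : Set ℕ}
    {e : Ear G g γ d} (he : e ∈ E) (hij : e.i < e.j) (hI : ∀ k < g, k ≤ e.i ∨ e.j ≤ k → k ∈ I) :
    ¬ (restrict G (earUnion E I)).IsAcyclic := by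
  have hi := e.hi
  have hj := e.hj
  -- The complementary arc passes position `g`, which is `γ 0`; the positions after that are reduced
  -- by `g`.
  obtain ⟨A, -, -, hA⟩ := hC.exists_arc_of_le (i := e.j) (j := e.i + g) (by omega) (by omega)
  refine e.not_isAcyclic_of_arc (fun x hx => Or.inl ⟨e, he, hx⟩)
    (A.copy rfl (hC.periodic _)).reverse fun x hx => ?_
  rw [Walk.support_reverse, Walk.support_copy, List.mem_reverse, hA] at hx
  obtain ⟨k, h1, h2, rfl⟩ := hx
  refine ⟨⟨k, rfl⟩, Or.inr ?_⟩
  rcases lt_or_ge k g with hk | hk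
  · exact ⟨k, hI k hk (Or.inr h1), rfl⟩
  · refine ⟨k - g, hI _ (by omega) (Or.inl (by omega)), ?_⟩
    rw [← hC.periodic]; congr 1; omega

theorem IsCyclicSeq.not_isAcyclic_pair (hC : IsCyclicSeq G g γ) {e f : Ear G g γ d}
    (hfar : e.Far f) (hi : e.i ≤ f.i) (hj : e.j ≤ f.j) :
    ¬ (restrict G (earUnion {e, f} (Set.Icc e.i f.i ∪ Set.Icc e.j f.j))).IsAcyclic := by
  obtain ⟨A, -, -, hA⟩ := hC.exists_arc_of_le hi (by have := f.hi; omega)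
  obtain ⟨B, -, -, hB⟩ := hC.exists_arc_of_le hj (by have := f.hj; omega)
  refine e.not_isAcyclic_of_arcs f hfar (fun x hx => Or.inl ⟨e, by simp, hx⟩)
    (fun x hx => Or.inl ⟨f, by simp, hx⟩) A (fun x hx => ?_) B (fun x hx => ?_)
  · obtain ⟨k, h1, h2, rfl⟩ := (hA x).mp hx
    exact ⟨⟨k, rfl⟩, Or.inr ⟨k, Or.inl ⟨h1, h2⟩, rfl⟩⟩
  · obtain ⟨k, h1, h2, rfl⟩ := (hB x).mp hx
    exact ⟨⟨k, rfl⟩, Or.inr ⟨k, Or.inr ⟨h1, h2⟩, rfl⟩⟩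

variable [Fintype V] {M : ℕ}

theorem IsShortestCycle.between_eq (hC : IsShortestCycle G g γ) (hM : Fintype.card V ≤ M) {u v : V}
    {A : G.Walk u v} (hA : A.IsPath) (hl : 2 * A.length < g) :
    between (cappedDist G M) u v = {x | x ∈ A.support} :=
  between_eq_support hM hA fun _ hp hpl => path_unique_of_girth hC.girth hp hA (by omega)

theorem IsShortestCycle.between_arc (hC : IsShortestCycle G g γ) (hM : Fintype.card V ≤ M)
    {i j : ℕ} (hij : i ≤ j) (hj : 2 * (j - i) < g) :
    between (cappedDist G M) (γ i) (γ j) = γ '' Set.Icc i j := by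
  obtain ⟨A, h1, h2, h3⟩ := hC.exists_arc_of_le hij (by omega)
  rw [hC.between_eq hM h1 (by omega)]
  ext x
  simp only [Set.mem_ofPred_eq, h3, Set.mem_image, Set.mem_Icc, and_assoc]

/-- An arc longer than `g / 2` is not a geodesic, but its halves are. The summand `2` leaves room
for rounding. -/
theorem IsShortestCycle.between_arc_halves (hC : IsShortestCycle G g γ) (hM : Fintype.card V ≤ M)
    {i j : ℕ} (hij : i ≤ j) (hj : j - i + 2 ≤ g) :
    between (cappedDist G M) (γ i) (γ (i + (j - i) / 2)) ∪
      between (cappedDist G M) (γ (i + (j - i) / 2)) (γ j) = γ '' Set.Icc i j := by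
  rw [hC.between_arc hM (by omega) (by omega), hC.between_arc hM (by omega) (by omega),
    ← Set.image_union, Set.Icc_union_Icc_eq_Icc (by omega) (by omega)]

/-- Each quarter of `C` is shorter than `g / 2`, hence a unique geodesic, so four vertices determine
`C` and with it the forest outside its ball. -/
theorem IsShortestCycle.cycleSet_eq (hC : IsShortestCycle G g γ) (hM : Fintype.card V ≤ M)
    {p : Fin 14 → V} (h0 : p 0 = γ 0) (h1 : p 1 = γ (g / 4)) (h2 : p 2 = γ (g / 2))
    (h3 : p 3 = γ (3 * g / 4)) : cycleSet (cappedDist G M) p = Set.range γ := by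
  have h4 : γ 0 = γ g := by rw [← hC.periodic 0, zero_add]
  have h3g := hC.three
  rw [cycleSet, h1, h2, h3]
  conv_lhs => rw [h0]
  nth_rewrite 2 [h4]
  rw [hC.between_arc hM (by omega) (by omega), hC.between_arc hM (by omega) (by omega),
    hC.between_arc hM (by omega) (by omega), hC.between_arc hM (by omega) (by omega),
    ← Set.image_union, ← Set.image_union, ← Set.image_union]
  ext x
  constructor
  · rintro ⟨k, -, rfl⟩
    exact ⟨k, rfl⟩
  · intro hx
    obtain ⟨k, hk, rfl⟩ := hC.exists_lt_of_mem_range hx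
    refine ⟨k, ?_, rfl⟩
    simp only [Set.mem_union, Set.mem_Icc]
    omega

/-- An ear may be long, so the girth does not make it a geodesic of `G`. In the forest its path is
unique, which is why a second distance function is needed. -/
theorem Ear.between_Q (e : Ear G g γ d) (hd : 1 ≤ d) (hM : Fintype.card V ≤ M)
    (hF : (restrict G (ball G (Set.range γ) d)ᶜ).IsAcyclic) :
    between (cappedDist (restrict G (ball G (Set.range γ) d)ᶜ) M) e.a e.b =
      {x | x ∈ e.Q.support} := by
  obtain ⟨q, -, hq⟩ := exists_walk_restrict (S := (ball G (Set.range γ) d)ᶜ) e.Q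
    fun x hx => e.notMem_ball_of_mem_Q hd hx
  have hqp : q.IsPath := by rw [Walk.isPath_def, hq]; exact e.isPath.support_nodup
  rw [between_eq_support hM hqp, hq]
  intro r hr _
  exact congrArg Subtype.val ((hF.subsingleton_path _ _).elim ⟨r, hr⟩ ⟨q, hqp⟩)

/-- One ear with an arc, or two ears with two arcs, form a `chainSet`. -/
theorem IsShortestCycle.exists_chain (hC : IsShortestCycle G g γ) (hd : 1 ≤ d) (hg : 10 * d < g)
    (hM : Fintype.card V ≤ M) (hF : (restrict G (ball G (Set.range γ) d)ᶜ).IsAcyclic)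
    {E : Set (Ear G g γ d)} {I : Set ℕ}
    (h : (∃ e : Ear G g γ d, E = {e} ∧ e.i ≤ e.j ∧ e.j - e.i + 2 ≤ g ∧ I = Set.Icc e.i e.j) ∨
      ∃ e f : Ear G g γ d, E = {e, f} ∧ e.i ≤ f.i ∧ f.i - e.i + 2 ≤ g ∧ e.j ≤ f.j ∧
        f.j - e.j + 2 ≤ g ∧ I = Set.Icc e.i f.i ∪ Set.Icc e.j f.j) :
    ∃ p : Fin 14 → V,
      chainSet (cappedDist G M) (cappedDist (awayFromCycle G M d p) M) p = earUnion E I := by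
  have hpa : ∀ e : Ear G g γ d,
      between (cappedDist G M) e.a (γ e.i) = {x | x ∈ e.pa.support} := fun e =>
    hC.between_eq hM e.pa_isPath (by rw [e.pa_length]; omega)
  have hpb : ∀ e : Ear G g γ d,
      between (cappedDist G M) e.b (γ e.j) = {x | x ∈ e.pb.support} := fun e =>
    hC.between_eq hM e.pb_isPath (by rw [e.pb_length]; omega)
  rcases h with ⟨e, rfl, hij, hlen, rfl⟩ | ⟨e, f, rfl, hii, hli, hjj, hlj, rfl⟩
  -- The first four entries determine `C`, the next two are the ends of the ear, and entries 8 to 10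
  -- are the two feet with the midpoint of the arc between them. The pieces for a second ear
  -- collapse to `e.a`.
  · refine ⟨![γ 0, γ (g / 4), γ (g / 2), γ (3 * g / 4), e.a, e.b, e.a, e.a, γ e.j,
      γ (e.i + (e.j - e.i) / 2), γ e.i, e.a, e.a, e.a], ?_⟩
    have hF' : awayFromCycle G M d ![γ 0, γ (g / 4), γ (g / 2), γ (3 * g / 4), e.a, e.b, e.a, e.a,
        γ e.j, γ (e.i + (e.j - e.i) / 2), γ e.i, e.a, e.a, e.a] =
        restrict G (ball G (Set.range γ) d)ᶜ := by
      rw [awayFromCycle, hC.cycleSet_eq hM rfl rfl rfl rfl]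
    rw [hF']
    show between _ e.a e.b ∪ (between _ e.b (γ e.j) ∪ between _ (γ e.j) (γ (e.i + (e.j - e.i) / 2)) ∪
      between _ (γ (e.i + (e.j - e.i) / 2)) (γ e.i) ∪ between _ (γ e.i) e.a) ∪ between _ e.a e.a ∪
      (between _ e.a e.a ∪ between _ e.a e.a ∪ between _ e.a e.a ∪ between _ e.a e.a) = _
    have harc := hC.between_arc_halves hM hij hlen
    rw [e.between_Q hd hM hF, hpb, between_comm M (γ e.j), between_comm M _ (γ e.i),
      between_comm M (γ e.i) e.a, hpa, between_self hM, between_self hM]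
    ext x
    have harc' := Set.ext_iff.mp harc x
    simp only [Set.mem_union, Set.mem_image] at harc'
    simp only [Set.mem_union, Set.mem_ofPred_eq, earUnion, Set.mem_singleton_iff, exists_eq_left,
      Ear.verts, ← harc']
    have : x = e.a → x ∈ e.Q.support := fun h => h ▸ e.Q.start_mem_support
    grind
  -- The chain follows the first ear, descends to `γ e.j`, runs along `C` to `γ f.j`, traverses the
  -- second ear backwards and returns along `C` from `γ f.i` to `γ e.i`.
  · refine ⟨![γ 0, γ (g / 4), γ (g / 2), γ (3 * g / 4), e.a, e.b, f.a, f.b, γ e.j,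
      γ (e.j + (f.j - e.j) / 2), γ f.j, γ f.i, γ (e.i + (f.i - e.i) / 2), γ e.i], ?_⟩
    have hF' : awayFromCycle G M d ![γ 0, γ (g / 4), γ (g / 2), γ (3 * g / 4), e.a, e.b, f.a, f.b,
        γ e.j, γ (e.j + (f.j - e.j) / 2), γ f.j, γ f.i, γ (e.i + (f.i - e.i) / 2), γ e.i] =
        restrict G (ball G (Set.range γ) d)ᶜ := by
      rw [awayFromCycle, hC.cycleSet_eq hM rfl rfl rfl rfl]
    rw [hF']
    show between _ e.a e.b ∪ (between _ e.b (γ e.j) ∪ between _ (γ e.j) (γ (e.j + (f.j - e.j) / 2)) ∪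
      between _ (γ (e.j + (f.j - e.j) / 2)) (γ f.j) ∪ between _ (γ f.j) f.b) ∪ between _ f.b f.a ∪
      (between _ f.a (γ f.i) ∪ between _ (γ f.i) (γ (e.i + (f.i - e.i) / 2)) ∪
        between _ (γ (e.i + (f.i - e.i) / 2)) (γ e.i) ∪ between _ (γ e.i) e.a) = _
    have harc1 := hC.between_arc_halves hM hii hli
    have harc2 := hC.between_arc_halves hM hjj hlj
    rw [e.between_Q hd hM hF, between_comm M f.b f.a, f.between_Q hd hM hF, hpb e,
      between_comm M (γ f.j) f.b, hpb f, hpa f, between_comm M (γ e.i) e.a, hpa e,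
      between_comm M (γ f.i), between_comm M _ (γ e.i)]
    ext x
    have harc1' := Set.ext_iff.mp harc1 x
    have harc2' := Set.ext_iff.mp harc2 x
    simp only [Set.mem_union, Set.mem_image] at harc1' harc2'
    simp only [Set.mem_union, Set.mem_ofPred_eq, earUnion, Set.mem_insert_iff,
      Set.mem_singleton_iff, exists_eq_left, Ear.verts, or_and_right, exists_or,
      ← harc1', ← harc2']
    grind

/-- The tuple `p` describes two cycles at distance more than `d`. -/
def IsPackingTuple (G : SimpleGraph V) (M d : ℕ) (p : Fin 14 → V) : Prop :=
  ¬ (restrict G (chainSet (cappedDist G M) (cappedDist (awayFromCycle G M d p) M) p)).IsAcyclic ∧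
    ¬ (restrict G (ball G (chainSet (cappedDist G M)
      (cappedDist (awayFromCycle G M d p) M) p) d)ᶜ).IsAcyclic

/-- Only the first cycle has to be described by the tuple; the second merely has to exist outside
the ball around the first. Hence only `E` and `I` are restricted to the two shapes of a chain. -/
theorem IsShortestCycle.exists_isPackingTuple_of_earUnion (hC : IsShortestCycle G g γ)
    (hd : 1 ≤ d) (hg : 10 * d < g) (hM : Fintype.card V ≤ M)
    (hF : (restrict G (ball G (Set.range γ) d)ᶜ).IsAcyclic) {E E' : Set (Ear G g γ d)}
    {I I' : Set ℕ}
    (h : (∃ e : Ear G g γ d, E = {e} ∧ e.i ≤ e.j ∧ e.j - e.i + 2 ≤ g ∧ I = Set.Icc e.i e.j) ∨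
      ∃ e f : Ear G g γ d, E = {e, f} ∧ e.i ≤ f.i ∧ f.i - e.i + 2 ≤ g ∧ e.j ≤ f.j ∧
        f.j - e.j + 2 ≤ g ∧ I = Set.Icc e.i f.i ∪ Set.Icc e.j f.j)
    (hEE : ∀ e ∈ E, ∀ f ∈ E', e.Far f) (hII : ∀ k ∈ I, ∀ l ∈ I', d < cyc g k l)
    (hI : ∀ k ∈ I, k < g) (hI' : ∀ k ∈ I', k < g)
    (hE : ∀ e ∈ E, e.i ∈ I ∧ e.j ∈ I) (hE' : ∀ e ∈ E', e.i ∈ I' ∧ e.j ∈ I')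
    (hac : ¬ (restrict G (earUnion E I)).IsAcyclic)
    (hac' : ¬ (restrict G (earUnion E' I')).IsAcyclic) :
    ∃ p : Fin 14 → V, IsPackingTuple G M d p := by
  obtain ⟨p, hp⟩ := hC.exists_chain hd hg hM hF h
  refine ⟨p, by rwa [hp], fun hcon => ?_⟩
  refine hac' (hcon.anti (restrict_mono ?_))
  · rw [hp]
    intro u hu hub
    obtain ⟨v, hv, q, hq⟩ := mem_ball_iff.mp hub
    have := hC.lt_length_of_earUnion hg hEE hII hI hI' hE hE' hv hu q.reverse
    rw [Walk.length_reverse] at this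
    omega

/-- Orient the ears so that `i ≤ j`, and sort them by `i`. If all pairs cross, the feet come in the
order `i₀, i₁, i₂, i₃, j₀, j₁, j₂, j₃`, and the arcs `[i₀, i₁]`, `[j₀, j₁]` that join the first two
ears are far from `[i₂, i₃]`, `[j₂, j₃]`. A pair that does not cross is nested or side by side, and
each of its ears closes up along an arc of its own. -/
theorem IsShortestCycle.exists_isPackingTuple_of_far (hC : IsShortestCycle G g γ)
    (hd : 1 ≤ d) (hg : 10 * d < g) (hM : Fintype.card V ≤ M)
    (hF : (restrict G (ball G (Set.range γ) d)ᶜ).IsAcyclic) (e : Fin 4 → Ear G g γ d)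
    (hfar : ∀ k l, k < l → (e k).Far (e l)) : ∃ p : Fin 14 → V, IsPackingTuple G M d p := by
  classical
  wlog hor : ∀ k, (e k).i ≤ (e k).j generalizing e
  · refine this (fun k => if (e k).i ≤ (e k).j then e k else (e k).swap) (fun k l hkl => ?_)
      (fun k => ?_)
    · have h := hfar k l hkl
      split_ifs
      · exact h
      · exact h.symm.swap_left.symm
      · exact h.swap_left
      · exact h.swap_left.symm.swap_left.symm
    · split_ifs with h
      · exact h
      · exact (not_le.mp h).le
  wlog hsort : Monotone fun k => (e k).i generalizing e
  · refine this (e ∘ Tuple.sort fun k => (e k).i) (fun k l hkl => ?_) (fun k => hor _)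
      (Tuple.monotone_sort fun k => (e k).i)
    have hne : Tuple.sort (fun k => (e k).i) k ≠ Tuple.sort (fun k => (e k).i) l :=
      fun h => hkl.ne (Equiv.injective _ h)
    rcases lt_or_gt_of_ne hne with h | h
    · exact hfar _ _ h
    · exact (hfar _ _ h).symm
  by_cases hcross : ∀ k l, k < l → (e l).i < (e k).j ∧ (e k).j < (e l).j
  · have e01 := hcross 0 1 (by decide)
    have e02 := hcross 0 2 (by decide)
    have e12 := hcross 1 2 (by decide)
    have e03 := hcross 0 3 (by decide)
    have e23 := hcross 2 3 (by decide)
    have s01 : (e 0).i ≤ (e 1).i := hsort (by decide)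
    have s12 : (e 1).i ≤ (e 2).i := hsort (by decide)
    have s23 : (e 2).i ≤ (e 3).i := hsort (by decide)
    have b3 := (e 3).hj
    have b3' := (e 3).hi
    obtain ⟨-, f12, f12i, f12j, f12l⟩ := hfar 1 2 (by decide)
    obtain ⟨-, f03, f03i, f03j, f03l⟩ := hfar 0 3 (by decide)
    replace f12 := add_lt_of_lt_cyc s12 f12
    replace f12i := add_lt_of_lt_cyc (by omega) f12i
    replace f12j := add_lt_of_lt_cyc' (by omega) f12j
    replace f12l := add_lt_of_lt_cyc (by omega) f12l
    replace f03 := add_lt_of_lt_cyc (by omega) f03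
    replace f03i := add_lt_of_lt_cyc (by omega) f03i
    replace f03j := add_lt_of_lt_cyc' (by omega) f03j
    replace f03l := add_lt_of_lt_cyc (by omega) f03l
    refine hC.exists_isPackingTuple_of_earUnion hd hg hM hF (E := {e 0, e 1}) (E' := {e 2, e 3})
      (I := Set.Icc (e 0).i (e 1).i ∪ Set.Icc (e 0).j (e 1).j)
      (I' := Set.Icc (e 2).i (e 3).i ∪ Set.Icc (e 2).j (e 3).j)
      (Or.inr ⟨e 0, e 1, rfl, s01, by omega, by omega, by omega, rfl⟩) ?_ ?_ ?_ ?_ ?_ ?_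
      (hC.not_isAcyclic_pair (hfar 0 1 (by decide)) (by omega) (by omega))
      (hC.not_isAcyclic_pair (hfar 2 3 (by decide)) (by omega) (by omega))
    · rintro x (rfl | rfl) y (rfl | rfl) <;> exact hfar _ _ (by decide)
    · rintro k (⟨h1, h2⟩ | ⟨h1, h2⟩) l (⟨h3, h4⟩ | ⟨h3, h4⟩)
      · exact lt_cyc (by omega) (by omega)
      · exact lt_cyc (by omega) (by omega)
      · exact lt_cyc' (by omega) (by omega)
      · exact lt_cyc (by omega) (by omega)
    · rintro k (⟨h1, h2⟩ | ⟨h1, h2⟩) <;> omega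
    · rintro k (⟨h1, h2⟩ | ⟨h1, h2⟩) <;> omega
    · rintro x (rfl | rfl) <;> simp only [Set.mem_union, Set.mem_Icc] <;> omega
    · rintro x (rfl | rfl) <;> simp only [Set.mem_union, Set.mem_Icc] <;> omega
  · push Not at hcross
    obtain ⟨k, l, hkl, hcr⟩ := hcross
    have hf := hfar k l hkl
    obtain ⟨-, f1, f2, f3, f4⟩ := hf
    have s : (e k).i ≤ (e l).i := hsort hkl.le
    have ok := hor k
    have ol := hor l
    have bk := (e k).hj
    have bl := (e l).hj
    replace f1 := add_lt_of_lt_cyc s f1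
    have common : ∀ I' : Set ℕ, (∀ m ∈ Set.Icc (e l).i (e l).j, ∀ m' ∈ I', d < cyc g m m') →
        (∀ m ∈ I', m < g) → (e k).i ∈ I' ∧ (e k).j ∈ I' →
        ¬ (restrict G (earUnion {e k} I')).IsAcyclic →
        ∃ p : Fin 14 → V, IsPackingTuple G M d p := by
      intro I' h1 h2 h3 h4
      refine hC.exists_isPackingTuple_of_earUnion hd hg hM hF (E := {e l}) (E' := {e k})
        (I := Set.Icc (e l).i (e l).j) (I' := I') (Or.inl ⟨e l, rfl, ol, by omega, rfl⟩)
        ?_ h1 ?_ h2 ?_ ?_ (hC.not_isAcyclic_inner rfl ol subset_rfl) h4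
      · rintro x rfl y rfl
        exact (hfar k l hkl).symm
      · rintro m ⟨hm1, hm2⟩; omega
      · rintro x rfl
        exact ⟨⟨le_rfl, ol⟩, ⟨ol, le_rfl⟩⟩
      · rintro x rfl
        exact h3
    rcases lt_or_ge (e l).i (e k).j with hlt | hge
    -- Ear `l` is nested in ear `k`: the inner ear takes the arc between its feet, the outer one the
    -- complementary arc through `γ 0`.
    · have hjj := hcr hlt
      replace f4 := add_lt_of_lt_cyc' hjj f4
      refine common {m | m < g ∧ (m ≤ (e k).i ∨ (e k).j ≤ m)} ?_ (fun m hm => hm.1)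
        ⟨⟨(e k).hi, Or.inl le_rfl⟩, ⟨bk, Or.inr le_rfl⟩⟩
        (hC.not_isAcyclic_outer rfl (by omega) fun m hm h => ⟨hm, h⟩)
      rintro m ⟨h1, h2⟩ m' ⟨h3, h4 | h4⟩
      · exact lt_cyc' (by omega) (by omega)
      · exact lt_cyc (by omega) (by omega)
    · replace f3 := add_lt_of_lt_cyc hge f3
      replace f2 := add_lt_of_lt_cyc (by omega) f2
      refine common (Set.Icc (e k).i (e k).j) ?_ (fun m hm => lt_of_le_of_lt hm.2 bk)
        ⟨⟨le_rfl, ok⟩, ⟨ok, le_rfl⟩⟩ (hC.not_isAcyclic_inner rfl ok subset_rfl)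
      rintro m ⟨h1, h2⟩ m' ⟨h3, h4⟩
      exact lt_cyc' (by omega) (by omega)

end Existence

end CyclePacking

namespace CyclePacking

open SimpleGraph

/-! ### Hitting sets described by tuples, and the structural dichotomy -/

section Existence

variable {V : Type*} {G : SimpleGraph V} {M g d : ℕ} {γ : ℕ → V}

/-- Unions of 12 geodesic pieces and of 12 vertices that hit all cycles. -/
def HasHittingTuples (G : SimpleGraph V) (M d : ℕ) : Prop :=
  (∃ p q : Fin 12 → V, (⋃ k, between (cappedDist G M) (p k) (q k)).ncard ≤ 12 * (d + 1) ∧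
    (restrict G (ball G (⋃ k, between (cappedDist G M) (p k) (q k)) (2 * d))ᶜ).IsAcyclic) ∧
  ∃ p : Fin 12 → V, (restrict G (ball G (Set.range p) (3 * d))ᶜ).IsAcyclic

theorem isAcyclic_of_ball_subset {W : Type*} {G : SimpleGraph W} {A B : Set W} (h : A ⊆ B)
    (hA : (restrict G Aᶜ).IsAcyclic) : (restrict G Bᶜ).IsAcyclic :=
  hA.anti (restrict_mono (Set.compl_subset_compl.mpr h))

/-- The index sets may be replaced by any set of at most 12 elements. -/
theorem hasHittingTuples_of_family {ι : Type*} [Fintype ι] [Nonempty ι] (hι : Fintype.card ι ≤ 12)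
    (P Q R : ι → V) (hcard : ∑ k, (between (cappedDist G M) (P k) (Q k)).ncard ≤ 12 * (d + 1))
    (h₁ : (restrict G (ball G (⋃ k, between (cappedDist G M) (P k) (Q k)) (2 * d))ᶜ).IsAcyclic)
    (h₂ : (restrict G (ball G (Set.range R) (3 * d))ᶜ).IsAcyclic) : HasHittingTuples G M d := by
  obtain ⟨f⟩ : Nonempty (ι ↪ Fin 12) := Function.Embedding.nonempty_of_card_le (by simpa using hι)
  have hf : Function.Surjective (Function.invFun f) := Function.invFun_surjective f.injective
  have hU : (⋃ k, between (cappedDist G M) (P (Function.invFun f k)) (Q (Function.invFun f k))) =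
      ⋃ k, between (cappedDist G M) (P k) (Q k) :=
    hf.iUnion_comp fun k => between (cappedDist G M) (P k) (Q k)
  refine ⟨⟨fun k => P (Function.invFun f k), fun k => Q (Function.invFun f k), ?_, by rwa [hU]⟩,
    fun k => R (Function.invFun f k), ?_⟩
  · rw [hU]
    exact (Set.ncard_iUnion_le_of_fintype _).trans hcard
  · rwa [show Set.range (fun k => R (Function.invFun f k)) = Set.range R from hf.range_comp R]

variable [Fintype V]

/-- Single vertices are degenerate geodesics, so the same twelve vertices serve for both hitting
sets. -/
theorem hasHittingTuples_of_points (hM : Fintype.card V ≤ M) (p : Fin 12 → V)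
    (h : (restrict G (ball G (Set.range p) (2 * d))ᶜ).IsAcyclic) : HasHittingTuples G M d := by
  have hU : (⋃ k, between (cappedDist G M) (p k) (p k)) = Set.range p := by
    simp only [between_self hM, Set.iUnion_singleton_eq_range]
  refine hasHittingTuples_of_family (by simp) p p p ?_ (by rwa [hU])
    (isAcyclic_of_ball_subset (ball_mono subset_rfl (by omega)) h)
  simp [between_self hM]

/-- The positions are shifted by `g` so that subtracting `d` is not truncated; `4 * d < g` makes the
arc of length `2 * d` a unique geodesic. -/
theorem IsShortestCycle.arcAround_subset (hC : IsShortestCycle G g γ) (hM : Fintype.card V ≤ M)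
    (hg : 4 * d < g) {i : ℕ} (hi : i < g) :
    arcAround g γ d i ⊆ between (cappedDist G M) (γ (i + g - d)) (γ (i + g + d)) := by
  rintro x ⟨k, hk, hki, rfl⟩
  rw [hC.between_arc hM (by omega) (by omega)]
  unfold cyc at hki
  by_cases h1 : i - k + (k - i) ≤ d
  · exact ⟨k + g, ⟨by omega, by omega⟩, hC.periodic k⟩
  rcases le_total i k with h | h
  · exact ⟨k, ⟨by omega, by omega⟩, rfl⟩
  · exact ⟨k + g + g, ⟨by omega, by omega⟩, by rw [hC.periodic, hC.periodic]⟩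

theorem IsShortestCycle.ncard_between_arc_le (hC : IsShortestCycle G g γ)
    (hM : Fintype.card V ≤ M) (hg : 4 * d < g) (i : ℕ) :
    (between (cappedDist G M) (γ (i + g - d)) (γ (i + g + d))).ncard ≤ 2 * d + 1 := by
  rw [hC.between_arc hM (by omega) (by omega)]
  refine (Set.ncard_image_le (Set.finite_Icc _ _)).trans ?_
  rw [Set.ncard_eq_toFinset_card', Set.toFinset_Icc, Nat.card_Icc]
  omega

/-- Four single vertices and six arcs of at most `2d + 1` vertices give at most `12d + 10`. Every
vertex of an arc is within `d` of its centre, so the four vertices and six centres suffice for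
radius `3d`. -/
theorem IsShortestCycle.hasHittingTuples_of_traces (hC : IsShortestCycle G g γ)
    (hM : Fintype.card V ≤ M) (hg : 4 * d < g) (t : Fin 3 → V) (i j : Fin 3 → ℕ)
    (hi : ∀ l, i l < g) (hj : ∀ l, j l < g)
    (h : (restrict G (ball G ({γ 0} ∪ ⋃ l, earTrace g γ d (t l) (i l) (j l)) (2 * d))ᶜ).IsAcyclic) :
    HasHittingTuples G M d := by
  let P : Option (Fin 3) ⊕ Fin 3 ⊕ Fin 3 → V := Sum.elim (fun l => l.elim (γ 0) t)
    (Sum.elim (fun l => γ (i l + g - d)) fun l => γ (j l + g - d))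
  let Q : Option (Fin 3) ⊕ Fin 3 ⊕ Fin 3 → V := Sum.elim (fun l => l.elim (γ 0) t)
    (Sum.elim (fun l => γ (i l + g + d)) fun l => γ (j l + g + d))
  let R : Option (Fin 3) ⊕ Fin 3 ⊕ Fin 3 → V := Sum.elim (fun l => l.elim (γ 0) t)
    (Sum.elim (fun l => γ (i l)) fun l => γ (j l))
  refine hasHittingTuples_of_family (by simp) P Q R ?_
    (isAcyclic_of_ball_subset (ball_mono ?_ le_rfl) h) (isAcyclic_of_ball_subset ?_ h)
  · have h1 : ∀ l, (between (cappedDist G M) (P (.inl l)) (Q (.inl l))).ncard ≤ 1 := fun l => by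
      rw [show Q (.inl l) = P (.inl l) from rfl, between_self hM, Set.ncard_singleton]
    have h2 : ∀ l, (between (cappedDist G M) (P (.inr (.inl l))) (Q (.inr (.inl l)))).ncard ≤
        2 * d + 1 := fun l => hC.ncard_between_arc_le hM hg _
    have h3 : ∀ l, (between (cappedDist G M) (P (.inr (.inr l))) (Q (.inr (.inr l)))).ncard ≤
        2 * d + 1 := fun l => hC.ncard_between_arc_le hM hg _
    rw [Fintype.sum_sum_type, Fintype.sum_sum_type]
    have s1 := Finset.sum_le_sum fun l (_ : l ∈ Finset.univ) => h1 l
    have s2 := Finset.sum_le_sum fun l (_ : l ∈ Finset.univ) => h2 l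
    have s3 := Finset.sum_le_sum fun l (_ : l ∈ Finset.univ) => h3 l
    simp only [Finset.sum_const, Finset.card_univ, Fintype.card_option, Fintype.card_fin,
      smul_eq_mul] at s1 s2 s3
    omega
  · have hmem : ∀ k, ∀ x ∈ between (cappedDist G M) (P k) (Q k),
        x ∈ ⋃ k, between (cappedDist G M) (P k) (Q k) := fun k x hx => Set.mem_iUnion.mpr ⟨k, hx⟩
    have hself : ∀ l, P (.inl l) ∈ between (cappedDist G M) (P (.inl l)) (Q (.inl l)) :=
      fun l => by rw [show Q (.inl l) = P (.inl l) from rfl, between_self hM]; rfl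
    refine Set.union_subset ?_ (Set.iUnion_subset fun l =>
      Set.union_subset (Set.union_subset ?_ ?_) ?_)
    · rintro x rfl
      exact hmem (.inl none) _ (hself none)
    · rintro x rfl
      exact hmem (.inl (some l)) _ (hself (some l))
    · exact fun x hx => hmem (.inr (.inl l)) x (hC.arcAround_subset hM hg (hi l) hx)
    · exact fun x hx => hmem (.inr (.inr l)) x (hC.arcAround_subset hM hg (hj l) hx)
  · intro x hx
    obtain ⟨v, hv, w, hw⟩ := mem_ball_iff.mp hx
    refine mem_ball_of_walk w (?_ : v ∈ ball G (Set.range R) d) (by omega)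
    have harc : ∀ k, k < g → γ k ∈ Set.range R → v ∈ arcAround g γ d k →
        v ∈ ball G (Set.range R) d := by
      rintro k hk hkp ⟨l, hl, hlk, rfl⟩
      obtain ⟨A, -, hA, -⟩ := hC.exists_cyc_path hl hk
      exact mem_ball_iff.mpr ⟨γ k, hkp, A, hA.le.trans hlk⟩
    rcases hv with rfl | hv
    · exact self_mem_ball ⟨.inl none, rfl⟩
    obtain ⟨l, (rfl | hv) | hv⟩ := Set.mem_iUnion.mp hv
    · exact self_mem_ball ⟨.inl (some l), rfl⟩
    · exact harc _ (hi l) ⟨.inr (.inl l), rfl⟩ hv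
    · exact harc _ (hj l) ⟨.inr (.inr l), rfl⟩ hv

/-- If no cycle avoids `B(C, d)`, and `C` is short, then 12 vertices of `C` are enough. -/
theorem IsShortestCycle.hasHittingTuples_of_short (hC : IsShortestCycle G g γ)
    (hM : Fintype.card V ≤ M) (hg : g ≤ 12 * (2 * d + 1))
    (hF : (restrict G (ball G (Set.range γ) d)ᶜ).IsAcyclic) : HasHittingTuples G M d := by
  -- Cut `C` into at most twelve blocks of at most `2d + 1` consecutive vertices; each vertex is
  -- within `d` of the chosen point of its block.
  refine hasHittingTuples_of_points hM (fun k : Fin 12 => γ (k * (2 * d + 1) + d))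
    (isAcyclic_of_ball_subset ?_ hF)
  intro x hx
  obtain ⟨v, hv, w, hw⟩ := mem_ball_iff.mp hx
  refine mem_ball_of_walk w (?_ : v ∈ ball G _ d) (by omega)
  obtain ⟨k, hk, rfl⟩ := hC.exists_lt_of_mem_range hv
  have hm : k / (2 * d + 1) < 12 := by
    rw [Nat.div_lt_iff_lt_mul (by omega)]
    omega
  have hdiv := Nat.div_add_mod' k (2 * d + 1)
  have hmod := Nat.mod_lt k (show 0 < 2 * d + 1 by omega)
  generalize hq : k / (2 * d + 1) = q at hm hdiv
  have hwalk : ∀ a b : ℕ, a ≤ b → ∃ p : G.Walk (γ a) (γ b), p.length = b - a := by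
    intro a b hab
    obtain ⟨p, hp, -⟩ := exists_walk_of_seq (G := G) γ (b - a) a fun k _ _ => hC.adj k
    exact ⟨p.copy rfl (by congr 1; omega), by simpa using hp⟩
  rcases le_total k (q * (2 * d + 1) + d) with h | h
  · obtain ⟨p, hp⟩ := hwalk _ _ h
    exact mem_ball_iff.mpr ⟨_, ⟨⟨q, hm⟩, rfl⟩, p, by simp only; omega⟩
  · obtain ⟨p, hp⟩ := hwalk _ _ h
    exact mem_ball_iff.mpr ⟨_, ⟨⟨q, hm⟩, rfl⟩, p.reverse, by simp only [Walk.length_reverse]; omega⟩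

/-- Either two cycles at distance more than `d`, or sets that hit all cycles, are described by
boundedly many vertices. -/
theorem hasHittingTuples_or_isPackingTuple [Nonempty V] (hd : 1 ≤ d) (hM : Fintype.card V ≤ M) :
    HasHittingTuples G M d ∨ ∃ p : Fin 14 → V, IsPackingTuple G M d p := by
  by_cases hac : G.IsAcyclic
  · exact Or.inl (hasHittingTuples_of_points hM (fun _ => Classical.arbitrary V)
      (hac.anti (restrict_le _)))
  obtain ⟨g, γ, hC⟩ := exists_isShortestCycle hac
  by_cases hF : (restrict G (ball G (Set.range γ) d)ᶜ).IsAcyclic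
  · rcases le_or_gt g (12 * (2 * d + 1)) with hg | hg
    · exact Or.inl (hC.hasHittingTuples_of_short hM hg hF)
    · rcases hC.traces_or_far_ears hd (by omega) hF with ⟨t, i, j, hi, hj, h⟩ | ⟨e, he⟩
      · exact Or.inl (hC.hasHittingTuples_of_traces hM (by omega) t i j hi hj h)
      · exact Or.inr (hC.exists_isPackingTuple_of_far hd (by omega) hM hF e he)
  · right
    -- The cycle `C` itself as a degenerate chain: the quarters occupy one group of four pieces, and
    -- all others collapse to `γ 0`.
    let p : Fin 14 → V := ![γ 0, γ (g / 4), γ (g / 2), γ (3 * g / 4), γ 0, γ 0, γ 0, γ 0,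
      γ (g / 4), γ (g / 2), γ (3 * g / 4), γ 0, γ 0, γ 0]
    have hS : chainSet (cappedDist G M) (cappedDist (awayFromCycle G M d p) M) p = Set.range γ := by
      rw [← hC.cycleSet_eq hM (p := p) rfl rfl rfl rfl]
      show between _ (γ 0) (γ 0) ∪ (between _ (γ 0) (γ (g / 4)) ∪ between _ (γ (g / 4)) (γ (g / 2)) ∪
        between _ (γ (g / 2)) (γ (3 * g / 4)) ∪ between _ (γ (3 * g / 4)) (γ 0)) ∪
        between _ (γ 0) (γ 0) ∪ (between _ (γ 0) (γ 0) ∪ between _ (γ 0) (γ 0) ∪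
        between _ (γ 0) (γ 0) ∪ between _ (γ 0) (γ 0)) = between _ (γ 0) (γ (g / 4)) ∪
        between _ (γ (g / 4)) (γ (g / 2)) ∪ between _ (γ (g / 2)) (γ (3 * g / 4)) ∪
        between _ (γ (3 * g / 4)) (γ 0)
      rw [between_self hM, between_self hM]
      have h0 : γ 0 ∈ between (cappedDist G M) (γ 0) (γ (g / 4)) := by
        rw [hC.between_arc hM (by omega) (by have := hC.three; omega)]
        exact ⟨0, ⟨le_rfl, by omega⟩, rfl⟩
      ext x
      simp only [Set.mem_union, Set.mem_singleton_iff]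
      have : x = γ 0 → x ∈ between (cappedDist G M) (γ 0) (γ (g / 4)) := fun h => h ▸ h0
      tauto
    refine ⟨p, ?_, by rwa [hS]⟩
    rw [hS]
    have hcore : IsCore G (Set.range γ) := by
      refine ⟨⟨γ 0, 0, rfl⟩, ?_⟩
      rintro v ⟨k, rfl⟩
      have h3 := hC.three
      refine ⟨γ (k + 1), ⟨_, rfl⟩, γ (k + g - 1), ⟨_, rfl⟩, ?_, hC.adj k, ?_⟩
      · exact hC.ne_of_lt (by omega) (by omega)
      · have := hC.adj (k + g - 1)
        rw [show k + g - 1 + 1 = k + g by omega, hC.periodic] at this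
        exact this.symm
    exact not_isAcyclic_of_core subset_rfl hcore

end Existence

end CyclePacking

namespace CyclePacking

/-! ### A small language over the vertices and its compilation to the machine -/

section Language

/-! ### Terms with bounded sums and commands with bounded loops -/

/-- Terms; `sum x t` adds up the values of `t` for all values of `x` less than the size of the
graph. -/
inductive Tm where
  | lit (k : ℕ)
  | size
  | dist
  | v (x : ℕ)
  | arr (a : ℕ) (t u : Tm)
  | add (t u : Tm)
  | sub (t u : Tm)
  | ite (c t u : Tm)
  | sum (x : ℕ) (t : Tm)

/-- The value of a term for the size `n`, the distance `d` and the memory `m`. -/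
def Tm.den (n d : ℕ) : Tm → Store → ℕ
  | lit k, _ => k
  | size, _ => n
  | dist, _ => d
  | v x, m => m.var x
  | arr a t u, m => m.arr a (t.den n d m) (u.den n d m)
  | add t u, m => t.den n d m + u.den n d m
  | sub t u, m => t.den n d m - u.den n d m
  | ite c t u, m => if c.den n d m ≠ 0 then t.den n d m else u.den n d m
  | sum x t, m => ∑ i ∈ Finset.range n, t.den n d (m.setVar x i)

/-- Commands; `loop x P` runs `P` for all values of `x` less than the size of the graph. -/
inductive Cmd where
  | skip
  | assign (x : ℕ) (t : Tm)
  | cell (a : ℕ) (t u w : Tm)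
  | seq (P Q : Cmd)
  | ite (c : Tm) (P Q : Cmd)
  | loop (x : ℕ) (P : Cmd)

/-- The memory after a run of a command. -/
def Cmd.run (n d : ℕ) : Cmd → Store → Store
  | skip, m => m
  | assign x t, m => m.setVar x (t.den n d m)
  | cell a t u w, m => m.setArr a (t.den n d m) (u.den n d m) (w.den n d m)
  | seq P Q, m => Q.run n d (P.run n d m)
  | ite c P Q, m => if c.den n d m ≠ 0 then P.run n d m else Q.run n d m
  | loop x P, m => Nat.rec (motive := fun _ => Store) m (fun i m' => P.run n d (m'.setVar x i)) n

/-- The registers `0` and `1` of the machine hold `n` and `d`, the register `2 * x + 2` holds the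
variable `x`, and the remaining registers are scratch space. -/
structure Sim (n d : ℕ) (m σ : Store) : Prop where
  size : σ.var 0 = n
  dist : σ.var 1 = d
  var : ∀ x, σ.var (2 * x + 2) = m.var x
  arr : σ.arr = m.arr

theorem Sim.setScratch {n d : ℕ} {m σ : Store} (h : Sim n d m σ) (s k : ℕ) :
    Sim n d m (σ.setVar (2 * s + 3) k) := by
  refine ⟨?_, ?_, fun x => ?_, h.arr⟩
  · simpa [Store.setVar] using h.size
  · simpa [Store.setVar] using h.dist
  · have : 2 * x + 2 ≠ 2 * s + 3 := by omega
    rw [Store.setVar]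
    simp only [if_neg this]
    exact h.var x

theorem Sim.setVar {n d : ℕ} {m σ : Store} (h : Sim n d m σ) (x k : ℕ) :
    Sim n d (m.setVar x k) (σ.setVar (2 * x + 2) k) := by
  refine ⟨?_, ?_, fun y => ?_, h.arr⟩
  · simpa [Store.setVar] using h.size
  · simpa [Store.setVar] using h.dist
  · by_cases hy : y = x
    · simp [Store.setVar, hy]
    · have : ¬ (2 * y + 2 = 2 * x + 2) := by omega
      simpa [Store.setVar, hy, this] using h.var y

theorem setVar_setVar_same (m : Store) (x k l : ℕ) : (m.setVar x k).setVar x l = m.setVar x l := by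
  ext y <;> simp [Store.setVar]
  split_ifs <;> rfl

theorem setVar_self (m : Store) (x : ℕ) : m.setVar x (m.var x) = m := by
  ext y <;> simp [Store.setVar]
  intro h; rw [h]

@[simp]
theorem setVar_var_self (m : Store) (x k : ℕ) : (m.setVar x k).var x = k := by simp [Store.setVar]

theorem setVar_var_of_ne (m : Store) {x y : ℕ} (k : ℕ) (h : y ≠ x) :
    (m.setVar x k).var y = m.var y := by simp [Store.setVar, h]

@[simp]
theorem setVar_arr (m : Store) (x k : ℕ) : (m.setVar x k).arr = m.arr := rfl

@[simp]
theorem setArr_var (m : Store) (a i j k : ℕ) : (m.setArr a i j k).var = m.var := rfl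

/-- A loop that counts the register `c` up to the value of the register `0`. -/
theorem runs_count_loop {B : Prog} {c n T : ℕ} (Inv : ℕ → Store → Prop)
    (hInv : ∀ i σ, Inv i σ → σ.var 0 = n ∧ σ.var c = i)
    (hB : ∀ i < n, ∀ σ, Inv i σ → ∃ τ t, Runs B σ τ t ∧ t ≤ T ∧ Inv (i + 1) τ)
    {σ : Store} (h0 : Inv 0 σ) :
    ∃ τ t, Runs (.loop (.sub (.var 0) (.var c)) B) σ τ t ∧ t ≤ n * (T + 4) + 4 ∧ Inv n τ := by
  suffices h : ∀ k i σ, i + k = n → Inv i σ →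
      ∃ τ t, Runs (.loop (.sub (.var 0) (.var c)) B) σ τ t ∧ t ≤ k * (T + 4) + 4 ∧ Inv n τ from
    h n 0 σ (by omega) h0
  intro k
  induction k with
  | zero =>
    intro i σ hi hσ
    obtain ⟨h1, h2⟩ := hInv i σ hσ
    refine ⟨σ, _, .loop_done ?_, by simp [Expr.cost], by rwa [← hi]⟩
    simp only [Expr.eval, h1, h2]; omega
  | succ k ih =>
    intro i σ hi hσ
    obtain ⟨h1, h2⟩ := hInv i σ hσ
    obtain ⟨τ, t, hr, ht, hτ⟩ := hB i (by omega) σ hσ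
    obtain ⟨τ', t', hr', ht', hτ'⟩ := ih (i + 1) τ (by omega) hτ
    refine ⟨τ', _, .loop_step ?_ hr hr', ?_, hτ'⟩
    · simp only [Expr.eval, h1, h2]; omega
    · simp only [Expr.cost]
      rw [Nat.succ_mul]; omega

/-- Every term can be evaluated into the scratch register `s` in polynomial time. -/
theorem Tm.exists_prog (t : Tm) : ∀ s, ∃ (P : Prog) (p : Polynomial ℕ),
    ∀ n d m σ, Sim n d m σ → ∃ τ c, Runs P σ τ c ∧ c ≤ p.eval n ∧ Sim n d m τ ∧
      τ.var (2 * s + 3) = t.den n d m ∧ ∀ s' < s, τ.var (2 * s' + 3) = σ.var (2 * s' + 3) := by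
  -- The number `s` acts as a stack height: scratch registers below it hold intermediate results of
  -- the enclosing terms and must be preserved.
  have simple : ∀ (e : Expr) (f : ℕ → ℕ → Store → ℕ) (s : ℕ),
      (∀ n d m σ, Sim n d m σ → e.eval σ = f n d m) → ∃ (P : Prog) (p : Polynomial ℕ),
      ∀ n d m σ, Sim n d m σ → ∃ τ c, Runs P σ τ c ∧ c ≤ p.eval n ∧ Sim n d m τ ∧
        τ.var (2 * s + 3) = f n d m ∧ ∀ s' < s, τ.var (2 * s' + 3) = σ.var (2 * s' + 3) := by
    intro e f s he
    refine ⟨.setVar (2 * s + 3) e, .C (e.cost + 1), fun n d m σ h => ⟨_, _, .setVar _ _ _, ?_,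
      h.setScratch _ _, ?_, fun s' hs' => ?_⟩⟩
    · simp
    · rw [setVar_var_self, he n d m σ h]
    · rw [setVar_var_of_ne _ _ (by omega)]
  have binary : ∀ (t u : Tm) (e : ℕ → ℕ → Expr) (f : ℕ → ℕ → Store → ℕ → ℕ → ℕ) (k s : ℕ),
      (∀ x y, (e x y).cost ≤ k) →
      (∀ n d m σ x y, Sim n d m σ → (e x y).eval σ = f n d m (σ.var x) (σ.var y)) →
      (∀ s, ∃ (P : Prog) (p : Polynomial ℕ),
        ∀ n d m σ, Sim n d m σ → ∃ τ c, Runs P σ τ c ∧ c ≤ p.eval n ∧ Sim n d m τ ∧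
        τ.var (2 * s + 3) = t.den n d m ∧ ∀ s' < s, τ.var (2 * s' + 3) = σ.var (2 * s' + 3)) →
      (∀ s, ∃ (P : Prog) (p : Polynomial ℕ),
        ∀ n d m σ, Sim n d m σ → ∃ τ c, Runs P σ τ c ∧ c ≤ p.eval n ∧ Sim n d m τ ∧
        τ.var (2 * s + 3) = u.den n d m ∧ ∀ s' < s, τ.var (2 * s' + 3) = σ.var (2 * s' + 3)) →
      ∃ (P : Prog) (p : Polynomial ℕ),
        ∀ n d m σ, Sim n d m σ → ∃ τ c, Runs P σ τ c ∧ c ≤ p.eval n ∧ Sim n d m τ ∧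
        τ.var (2 * s + 3) = f n d m (t.den n d m) (u.den n d m) ∧
        ∀ s' < s, τ.var (2 * s' + 3) = σ.var (2 * s' + 3) := by
    intro t u e f k s hk he iht ihu
    obtain ⟨P, p, hP⟩ := iht s
    obtain ⟨Q, q, hQ⟩ := ihu (s + 1)
    refine ⟨.seq P (.seq Q (.setVar (2 * s + 3) (e (2 * s + 3) (2 * (s + 1) + 3)))),
      p + (q + .C (k + 1)), fun n d m σ h => ?_⟩
    obtain ⟨τ₁, c₁, r₁, hc₁, hs₁, hv₁, hf₁⟩ := hP n d m σ h
    obtain ⟨τ₂, c₂, r₂, hc₂, hs₂, hv₂, hf₂⟩ := hQ n d m τ₁ hs₁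
    refine ⟨_, _, .seq r₁ (.seq r₂ (.setVar _ _ _)), ?_, hs₂.setScratch _ _, ?_, fun s' hs' => ?_⟩
    · have := hk (2 * s + 3) (2 * (s + 1) + 3)
      simp only [Polynomial.eval_add, Polynomial.eval_C]
      omega
    · rw [setVar_var_self, he n d m τ₂ _ _ hs₂, hv₂, hf₂ s (by omega), hv₁]
    · rw [setVar_var_of_ne _ _ (by omega), hf₂ s' (by omega), hf₁ s' hs']
  induction t with
  | lit k => exact fun s => simple (.lit k) _ s fun n d m σ h => rfl
  | size => exact fun s => simple (.var 0) (fun n _ _ => n) s fun n d m σ h => h.size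
  | dist => exact fun s => simple (.var 1) (fun _ d _ => d) s fun n d m σ h => h.dist
  | v x =>
    exact fun s => simple (.var (2 * x + 2)) (fun _ _ m => m.var x) s fun n d m σ h => h.var x
  | arr a t u iht ihu =>
    exact fun s => binary t u (fun x y => .arr a (.var x) (.var y)) (fun _ _ m i j => m.arr a i j) 3 s
      (fun x y => by simp [Expr.cost]) (fun n d m σ x y h => by simp [Expr.eval, h.arr]) iht ihu
  | add t u iht ihu =>
    exact fun s => binary t u (fun x y => .add (.var x) (.var y)) (fun _ _ _ i j => i + j) 3 s
      (fun x y => by simp [Expr.cost]) (fun n d m σ x y h => by simp [Expr.eval]) iht ihu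
  | sub t u iht ihu =>
    exact fun s => binary t u (fun x y => .sub (.var x) (.var y)) (fun _ _ _ i j => i - j) 3 s
      (fun x y => by simp [Expr.cost]) (fun n d m σ x y h => by simp [Expr.eval]) iht ihu
  | ite c t u ihc iht ihu =>
    intro s
    obtain ⟨P, p, hP⟩ := ihc s
    obtain ⟨Q, q, hQ⟩ := iht s
    obtain ⟨R, r, hR⟩ := ihu s
    refine ⟨.seq P (.cond (.var (2 * s + 3)) Q R), p + (.C 2 + q + r), fun n d m σ h => ?_⟩
    obtain ⟨τ₁, c₁, r₁, hc₁, hs₁, hv₁, hf₁⟩ := hP n d m σ h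
    obtain ⟨τ₂, c₂, r₂, hc₂, hs₂, hv₂, hf₂⟩ := hQ n d m τ₁ hs₁
    obtain ⟨τ₃, c₃, r₃, hc₃, hs₃, hv₃, hf₃⟩ := hR n d m τ₁ hs₁
    simp only [Tm.den]
    by_cases hc : c.den n d m = 0
    · refine ⟨τ₃, _, .seq r₁ (.cond_false (by simpa [Expr.eval, hv₁] using hc) r₃), ?_, hs₃, ?_,
        fun s' hs' => by rw [hf₃ s' hs', hf₁ s' hs']⟩
      · simp only [Polynomial.eval_add, Polynomial.eval_C, Expr.cost]
        omega
      · simp [hc, hv₃]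
    · refine ⟨τ₂, _, .seq r₁ (.cond_true (by simpa [Expr.eval, hv₁] using hc) r₂), ?_, hs₂, ?_,
        fun s' hs' => by rw [hf₂ s' hs', hf₁ s' hs']⟩
      · simp only [Polynomial.eval_add, Polynomial.eval_C, Expr.cost]
        omega
      · simp [hc, hv₂]
  | sum x t ih =>
    intro s
    obtain ⟨P, p, hP⟩ := ih (s + 3)
    -- Three registers hold the partial sum, the counter and the old value of `x`, and the body is
    -- evaluated above them. The old value is restored at the end, because evaluating a term must
    -- not change the memory.
    let acc := 2 * s + 3
    let cnt := 2 * (s + 1) + 3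
    let sav := 2 * (s + 2) + 3
    let res := 2 * (s + 3) + 3
    let B : Prog := .seq (.setVar (2 * x + 2) (.var cnt)) (.seq P (.seq
      (.setVar acc (.add (.var acc) (.var res))) (.setVar cnt (.add (.var cnt) (.lit 1)))))
    refine ⟨.seq (.setVar acc (.lit 0)) (.seq (.setVar cnt (.lit 0)) (.seq
      (.setVar sav (.var (2 * x + 2))) (.seq (.loop (.sub (.var 0) (.var cnt)) B)
      (.setVar (2 * x + 2) (.var sav))))), .X * (p + .C 14) + .C 12, fun n d m σ h => ?_⟩
    let Inv : ℕ → Store → Prop := fun i τ => (∃ y, Sim n d (m.setVar x y) τ) ∧ τ.var cnt = i ∧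
      τ.var acc = ∑ j ∈ Finset.range i, t.den n d (m.setVar x j) ∧ τ.var sav = m.var x ∧
      ∀ s' < s, τ.var (2 * s' + 3) = σ.var (2 * s' + 3)
    obtain ⟨τ, c, hr, hc, ⟨y, hy⟩, h1, h2, h3, h4⟩ := runs_count_loop (B := B) (c := cnt) (n := n)
      (T := p.eval n + 10) Inv (fun i τ hτ => ⟨hτ.1.choose_spec.size, hτ.2.1⟩) (by
        rintro i - τ ⟨⟨y, hy⟩, h1, h2, h3, h4⟩
        have hy' := hy.setVar x (τ.var cnt)
        rw [setVar_setVar_same, h1] at hy'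
        obtain ⟨τ', c, hr, hc, hs, hv, hf⟩ := hP n d _ _ hy'
        have hfr : ∀ s' < s + 3, τ'.var (2 * s' + 3) = τ.var (2 * s' + 3) := fun s' hs' => by
          rw [hf s' hs', setVar_var_of_ne _ _ (by omega)]
        have hr' : Runs P (τ.setVar (2 * x + 2) ((Expr.var cnt).eval τ)) τ' c := by
          simpa only [Expr.eval, h1] using hr
        refine ⟨_, _, .seq (.setVar _ _ _) (.seq hr' (.seq (.setVar _ _ _) (.setVar _ _ _))), ?_, ?_⟩
        · simp only [Expr.cost]; omega
        · have e1 := hfr s (by omega)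
          have e2 := hfr (s + 1) (by omega)
          have e3 := hfr (s + 2) (by omega)
          refine ⟨⟨i, (hs.setScratch _ _).setScratch _ _⟩, ?_, ?_, ?_, fun s' hs' => ?_⟩
          · rw [setVar_var_self]
            simp only [Expr.eval]
            rw [setVar_var_of_ne _ _ (by simp only [acc, cnt]; omega), e2, h1]
          · rw [setVar_var_of_ne _ _ (by simp only [acc, cnt]; omega), setVar_var_self]
            simp only [Expr.eval]
            rw [e1, hv, Finset.sum_range_succ, ← h2]
          · rw [setVar_var_of_ne _ _ (by simp only [sav, cnt]; omega),
              setVar_var_of_ne _ _ (by simp only [sav, acc]; omega), e3, ← h3]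
          · rw [setVar_var_of_ne _ _ (by simp only [cnt]; omega),
              setVar_var_of_ne _ _ (by simp only [acc]; omega), hfr s' (by omega), h4 s' hs'])
      (σ := ((σ.setVar acc 0).setVar cnt 0).setVar sav (σ.var (2 * x + 2))) (by
        refine ⟨⟨m.var x, ?_⟩, ?_, ?_, ?_, fun s' hs' => ?_⟩
        · rw [setVar_self]
          exact ((h.setScratch _ _).setScratch _ _).setScratch _ _
        · rw [setVar_var_of_ne _ _ (by simp only [sav, cnt]; omega), setVar_var_self]
        · rw [setVar_var_of_ne _ _ (by simp only [sav, acc]; omega),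
            setVar_var_of_ne _ _ (by simp only [cnt, acc]; omega), setVar_var_self]
          simp
        · rw [setVar_var_self, h.var]
        · rw [setVar_var_of_ne _ _ (by simp only [sav]; omega),
            setVar_var_of_ne _ _ (by simp only [cnt]; omega),
            setVar_var_of_ne _ _ (by simp only [acc]; omega)])
    have hx : ((σ.setVar acc 0).setVar cnt 0).var (2 * x + 2) = σ.var (2 * x + 2) := by
      rw [setVar_var_of_ne _ _ (by simp only [cnt]; omega),
        setVar_var_of_ne _ _ (by simp only [acc]; omega)]
    rw [← hx] at hr
    refine ⟨_, _, .seq (.setVar _ _ _) (.seq (.setVar _ _ _) (.seq (.setVar _ _ _)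
      (.seq hr (.setVar _ _ _)))), ?_, ?_, ?_, fun s' hs' => ?_⟩
    · simp only [Expr.cost, Polynomial.eval_add, Polynomial.eval_mul, Polynomial.eval_X,
        Polynomial.eval_C]
      have : n * (p.eval n + 10 + 4) = n * (p.eval n + 14) := by ring
      omega
    · have := hy.setVar x (τ.var sav)
      rw [setVar_setVar_same, h3, setVar_self] at this
      simpa only [Expr.eval, h3] using this
    · rw [setVar_var_of_ne _ _ (by omega)]
      exact h2
    · rw [setVar_var_of_ne _ _ (by omega), h4 s' hs']

/-- Every command can be executed in polynomial time. -/
theorem Cmd.exists_prog (C : Cmd) : ∀ s, ∃ (P : Prog) (p : Polynomial ℕ),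
    ∀ n d m σ, Sim n d m σ → ∃ τ c, Runs P σ τ c ∧ c ≤ p.eval n ∧ Sim n d (C.run n d m) τ ∧
      ∀ s' < s, τ.var (2 * s' + 3) = σ.var (2 * s' + 3) := by
  induction C with
  | skip =>
    exact fun s => ⟨.skip, .C 1, fun n d m σ h => ⟨σ, 1, .skip _, by simp, h, fun _ _ => rfl⟩⟩
  | assign x t =>
    intro s
    obtain ⟨P, p, hP⟩ := t.exists_prog s
    refine ⟨.seq P (.setVar (2 * x + 2) (.var (2 * s + 3))), p + .C 2, fun n d m σ h => ?_⟩
    obtain ⟨τ, c, hr, hc, hs, hv, hf⟩ := hP n d m σ h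
    refine ⟨_, _, .seq hr (.setVar _ _ _), ?_, ?_, fun s' hs' => ?_⟩
    · simp only [Expr.cost, Polynomial.eval_add, Polynomial.eval_C]; omega
    · simp only [Expr.eval, hv, Cmd.run]
      exact hs.setVar _ _
    · rw [setVar_var_of_ne _ _ (by omega), hf s' hs']
  | cell a t u w =>
    intro s
    obtain ⟨P, p, hP⟩ := t.exists_prog s
    obtain ⟨Q, q, hQ⟩ := u.exists_prog (s + 1)
    obtain ⟨R, r, hR⟩ := w.exists_prog (s + 2)
    refine ⟨.seq P (.seq Q (.seq R (.setArr a (.var (2 * s + 3)) (.var (2 * (s + 1) + 3))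
      (.var (2 * (s + 2) + 3))))), p + (q + (r + .C 4)), fun n d m σ h => ?_⟩
    obtain ⟨τ₁, c₁, r₁, hc₁, hs₁, hv₁, hf₁⟩ := hP n d m σ h
    obtain ⟨τ₂, c₂, r₂, hc₂, hs₂, hv₂, hf₂⟩ := hQ n d m τ₁ hs₁
    obtain ⟨τ₃, c₃, r₃, hc₃, hs₃, hv₃, hf₃⟩ := hR n d m τ₂ hs₂
    refine ⟨_, _, .seq r₁ (.seq r₂ (.seq r₃ (.setArr _ _ _ _ _))), ?_, ?_, fun s' hs' => ?_⟩
    · simp only [Expr.cost, Polynomial.eval_add, Polynomial.eval_C]; omega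
    · simp only [Expr.eval, Cmd.run]
      rw [hv₃, hf₃ (s + 1) (by omega), hv₂, hf₃ s (by omega), hf₂ s (by omega), hv₁]
      refine ⟨hs₃.size, hs₃.dist, hs₃.var, ?_⟩
      simp only [Store.setArr, hs₃.arr]
    · rw [setArr_var, hf₃ s' (by omega), hf₂ s' (by omega), hf₁ s' hs']
  | seq P Q ihP ihQ =>
    intro s
    obtain ⟨P', p, hP⟩ := ihP s
    obtain ⟨Q', q, hQ⟩ := ihQ s
    refine ⟨.seq P' Q', p + q, fun n d m σ h => ?_⟩
    obtain ⟨τ₁, c₁, r₁, hc₁, hs₁, hf₁⟩ := hP n d m σ h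
    obtain ⟨τ₂, c₂, r₂, hc₂, hs₂, hf₂⟩ := hQ n d _ τ₁ hs₁
    exact ⟨τ₂, _, .seq r₁ r₂, by rw [Polynomial.eval_add]; omega, hs₂,
      fun s' hs' => by rw [hf₂ s' hs', hf₁ s' hs']⟩
  | ite c P Q ihP ihQ =>
    intro s
    obtain ⟨R, r, hR⟩ := c.exists_prog s
    obtain ⟨P', p, hP⟩ := ihP s
    obtain ⟨Q', q, hQ⟩ := ihQ s
    refine ⟨.seq R (.cond (.var (2 * s + 3)) P' Q'), r + (.C 2 + p + q), fun n d m σ h => ?_⟩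
    obtain ⟨τ₁, c₁, r₁, hc₁, hs₁, hv₁, hf₁⟩ := hR n d m σ h
    obtain ⟨τ₂, c₂, r₂, hc₂, hs₂, hf₂⟩ := hP n d m τ₁ hs₁
    obtain ⟨τ₃, c₃, r₃, hc₃, hs₃, hf₃⟩ := hQ n d m τ₁ hs₁
    simp only [Cmd.run]
    by_cases hc : c.den n d m = 0
    · refine ⟨τ₃, _, .seq r₁ (.cond_false (by simpa [Expr.eval, hv₁] using hc) r₃), ?_, ?_,
        fun s' hs' => by rw [hf₃ s' hs', hf₁ s' hs']⟩
      · simp only [Polynomial.eval_add, Polynomial.eval_C, Expr.cost]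
        omega
      · simpa [hc] using hs₃
    · refine ⟨τ₂, _, .seq r₁ (.cond_true (by simpa [Expr.eval, hv₁] using hc) r₂), ?_, ?_,
        fun s' hs' => by rw [hf₂ s' hs', hf₁ s' hs']⟩
      · simp only [Polynomial.eval_add, Polynomial.eval_C, Expr.cost]
        omega
      · simpa [hc] using hs₂
  | loop x P ih =>
    intro s
    obtain ⟨P', p, hP⟩ := ih (s + 1)
    let cnt := 2 * s + 3
    let B : Prog := .seq (.setVar (2 * x + 2) (.var cnt)) (.seq P'
      (.setVar cnt (.add (.var cnt) (.lit 1))))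
    refine ⟨.seq (.setVar cnt (.lit 0)) (.loop (.sub (.var 0) (.var cnt)) B),
      .X * (p + .C 10) + .C 6, fun n d m σ h => ?_⟩
    let Inv : ℕ → Store → Prop := fun i τ => Sim n d
      (Nat.rec (motive := fun _ => Store) m (fun i m' => P.run n d (m'.setVar x i)) i) τ ∧
      τ.var cnt = i ∧ ∀ s' < s, τ.var (2 * s' + 3) = σ.var (2 * s' + 3)
    obtain ⟨τ, c, hr, hc, h1, h2, h3⟩ := runs_count_loop (B := B) (c := cnt) (n := n)
      (T := p.eval n + 6) Inv (fun i τ hτ => ⟨hτ.1.size, hτ.2.1⟩) (by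
        rintro i - τ ⟨h1, h2, h3⟩
        obtain ⟨τ', c, hr, hc, hs, hf⟩ := hP n d _ _ (h1.setVar x (τ.var cnt))
        have hfr : ∀ s' < s + 1, τ'.var (2 * s' + 3) = τ.var (2 * s' + 3) := fun s' hs' => by
          rw [hf s' hs', setVar_var_of_ne _ _ (by omega)]
        refine ⟨_, _, .seq (.setVar _ _ _) (.seq hr (.setVar _ _ _)), ?_, ?_, ?_, fun s' hs' => ?_⟩
        · simp only [Expr.cost]; omega
        · rw [h2] at hs
          exact hs.setScratch _ _
        · rw [setVar_var_self]
          simp only [Expr.eval]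
          rw [hfr s (by omega), ← h2]
        · rw [setVar_var_of_ne _ _ (by simp only [cnt]; omega), hfr s' (by omega), h3 s' hs'])
      (σ := σ.setVar cnt 0) ⟨h.setScratch _ _, setVar_var_self _ _ _, fun s' hs' => by
        rw [setVar_var_of_ne _ _ (by simp only [cnt]; omega)]⟩
    refine ⟨τ, _, .seq (.setVar _ _ _) hr, ?_, h1, h3⟩
    simp only [Expr.cost, Polynomial.eval_add, Polynomial.eval_mul, Polynomial.eval_X,
      Polynomial.eval_C]
    have : n * (p.eval n + 6 + 4) = n * (p.eval n + 10) := by ring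
    omega

end Language

end CyclePacking

namespace CyclePacking

open SimpleGraph

/-! ### Frame conditions, derived terms and tables -/

section Programs

variable {n d : ℕ}

/-! ### What terms read and commands write -/

def Tm.vars : Tm → List ℕ
  | lit _ => []
  | size => []
  | dist => []
  | v x => [x]
  | arr _ t u => t.vars ++ u.vars
  | add t u => t.vars ++ u.vars
  | sub t u => t.vars ++ u.vars
  | ite c t u => c.vars ++ t.vars ++ u.vars
  | sum _ t => t.vars

def Tm.arrs : Tm → List ℕ
  | lit _ => []
  | size => []
  | dist => []
  | v _ => []
  | arr a t u => a :: (t.arrs ++ u.arrs)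
  | add t u => t.arrs ++ u.arrs
  | sub t u => t.arrs ++ u.arrs
  | ite c t u => c.arrs ++ t.arrs ++ u.arrs
  | sum _ t => t.arrs

theorem Tm.den_congr (t : Tm) : ∀ {m m' : Store}, (∀ x ∈ t.vars, m.var x = m'.var x) →
    (∀ a ∈ t.arrs, m.arr a = m'.arr a) → t.den n d m = t.den n d m' := by
  induction t with
  | lit k => intros; rfl
  | size => intros; rfl
  | dist => intros; rfl
  | v x => exact fun hv _ => hv x (by simp [vars])
  | arr a t u iht ihu =>
    intro m m' hv ha
    simp only [vars, arrs, List.mem_append, List.mem_cons] at hv ha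
    simp only [den]
    rw [iht (fun x h => hv x (.inl h)) (fun x h => ha x (.inr (.inl h))),
      ihu (fun x h => hv x (.inr h)) (fun x h => ha x (.inr (.inr h))), ha a (.inl rfl)]
  | add t u iht ihu =>
    intro m m' hv ha
    simp only [vars, arrs, List.mem_append] at hv ha
    simp only [den]
    rw [iht (fun x h => hv x (.inl h)) (fun x h => ha x (.inl h)),
      ihu (fun x h => hv x (.inr h)) (fun x h => ha x (.inr h))]
  | sub t u iht ihu =>
    intro m m' hv ha
    simp only [vars, arrs, List.mem_append] at hv ha
    simp only [den]
    rw [iht (fun x h => hv x (.inl h)) (fun x h => ha x (.inl h)),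
      ihu (fun x h => hv x (.inr h)) (fun x h => ha x (.inr h))]
  | ite c t u ihc iht ihu =>
    intro m m' hv ha
    simp only [vars, arrs, List.mem_append] at hv ha
    simp only [den]
    rw [ihc (fun x h => hv x (.inl (.inl h))) (fun x h => ha x (.inl (.inl h))),
      iht (fun x h => hv x (.inl (.inr h))) (fun x h => ha x (.inl (.inr h))),
      ihu (fun x h => hv x (.inr h)) (fun x h => ha x (.inr h))]
  | sum x t ih =>
    intro m m' hv ha
    refine Finset.sum_congr rfl fun i _ => ih (fun y hy => ?_) ha
    have := hv y hy
    simp only [Store.setVar]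
    rw [this]

def Cmd.vars : Cmd → List ℕ
  | skip => []
  | assign x _ => [x]
  | cell _ _ _ _ => []
  | seq P Q => P.vars ++ Q.vars
  | ite _ P Q => P.vars ++ Q.vars
  | loop x P => x :: P.vars

def Cmd.arrs : Cmd → List ℕ
  | skip => []
  | assign _ _ => []
  | cell a _ _ _ => [a]
  | seq P Q => P.arrs ++ Q.arrs
  | ite _ P Q => P.arrs ++ Q.arrs
  | loop _ P => P.arrs

theorem Cmd.run_loop_inv {x : ℕ} {P : Cmd} {m : Store} (Inv : ℕ → Store → Prop) (h0 : Inv 0 m)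
    (hs : ∀ i < n, ∀ m', Inv i m' → Inv (i + 1) (P.run n d (m'.setVar x i))) :
    Inv n ((Cmd.loop x P).run n d m) := by
  suffices h : ∀ k ≤ n, Inv k
      (Nat.rec (motive := fun _ => Store) m (fun i m' => P.run n d (m'.setVar x i)) k) from h n le_rfl
  intro k
  induction k with
  | zero => exact fun _ => h0
  | succ k ih => exact fun hk => hs k hk _ (ih (by omega))

/-- As the condition is membership in a computable list, frame conditions for concrete programs are
settled by `decide`. -/
theorem Cmd.run_var (C : Cmd) : ∀ (m : Store) {x : ℕ}, x ∉ C.vars → (C.run n d m).var x = m.var x := by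
  induction C with
  | skip => intros; rfl
  | assign y t =>
    intro m x hx
    exact setVar_var_of_ne _ _ (by simpa [vars] using hx)
  | cell a t u w => intros; rfl
  | seq P Q ihP ihQ =>
    intro m x hx
    simp only [vars, List.mem_append, not_or] at hx
    rw [run, ihQ _ hx.2, ihP _ hx.1]
  | ite c P Q ihP ihQ =>
    intro m x hx
    simp only [vars, List.mem_append, not_or] at hx
    rw [run]
    split_ifs
    exacts [ihP _ hx.1, ihQ _ hx.2]
  | loop y P ih =>
    intro m x hx
    simp only [vars, List.mem_cons, not_or] at hx
    refine run_loop_inv (fun _ m' => m'.var x = m.var x) rfl fun i _ m' h => ?_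
    rw [ih _ hx.2, setVar_var_of_ne _ _ hx.1, h]

theorem Cmd.run_arr (C : Cmd) : ∀ (m : Store) {a : ℕ}, a ∉ C.arrs → (C.run n d m).arr a = m.arr a := by
  induction C with
  | skip => intros; rfl
  | assign y t => intros; rfl
  | cell b t u w =>
    intro m a ha
    have : a ≠ b := by simpa [arrs] using ha
    funext i j
    simp [run, Store.setArr, this]
  | seq P Q ihP ihQ =>
    intro m a ha
    simp only [arrs, List.mem_append, not_or] at ha
    rw [run, ihQ _ ha.2, ihP _ ha.1]
  | ite c P Q ihP ihQ =>
    intro m a ha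
    simp only [arrs, List.mem_append, not_or] at ha
    rw [run]
    split_ifs
    exacts [ihP _ ha.1, ihQ _ ha.2]
  | loop y P ih =>
    intro m a ha
    refine run_loop_inv (fun _ m' => m'.arr a = m.arr a) rfl fun i _ m' h => ?_
    rw [ih _ ha, setVar_arr, h]

/-! ### Conditions -/

/-- A term is regarded as a condition that holds when its value is not zero. -/
def Tm.Holds (n d : ℕ) (t : Tm) (m : Store) : Prop := t.den n d m ≠ 0

namespace Tm

def and (t u : Tm) : Tm := ite t u (lit 0)

def not (t : Tm) : Tm := ite t (lit 0) (lit 1)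

def le (t u : Tm) : Tm := not (sub t u)

def eq (t u : Tm) : Tm := and (le t u) (le u t)

/-- One of the terms `t 0, …, t (k - 1)` holds. -/
def any (t : ℕ → Tm) : ℕ → Tm
  | 0 => lit 0
  | k + 1 => add (any t k) (t k)

/-- The term `t` added to itself `k` times. -/
def mul (t : Tm) : ℕ → Tm
  | 0 => lit 0
  | k + 1 => add (mul t k) t

/-- The least value of `x` for which `c` holds; the variable `y` is auxiliary. -/
def least (x y : ℕ) (c : Tm) : Tm := sum y (not (sum x (and (le (v x) (v y)) c)))

@[simp]
theorem holds_and {t u : Tm} {m : Store} :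
    (and t u).Holds n d m ↔ t.Holds n d m ∧ u.Holds n d m := by
  simp only [Holds, and, den]
  split_ifs with h <;> simp [h]

@[simp]
theorem holds_add {t u : Tm} {m : Store} :
    (add t u).Holds n d m ↔ t.Holds n d m ∨ u.Holds n d m := by
  simp only [Holds, den]
  omega

@[simp]
theorem holds_not {t : Tm} {m : Store} : (not t).Holds n d m ↔ ¬ t.Holds n d m := by
  simp only [Holds, not, den]
  split_ifs with h <;> simp [h]

@[simp]
theorem holds_le {t u : Tm} {m : Store} :
    (le t u).Holds n d m ↔ t.den n d m ≤ u.den n d m := by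
  rw [le, holds_not]
  simp only [Holds, den]
  omega

@[simp]
theorem holds_eq {t u : Tm} {m : Store} :
    (eq t u).Holds n d m ↔ t.den n d m = u.den n d m := by
  rw [eq, holds_and, holds_le, holds_le]
  omega

@[simp]
theorem holds_sum {x : ℕ} {t : Tm} {m : Store} :
    (sum x t).Holds n d m ↔ ∃ i : Fin n, t.Holds n d (m.setVar x i) := by
  simp only [Holds, den, ne_eq, Finset.sum_eq_zero_iff, Finset.mem_range, not_forall]
  exact ⟨fun ⟨i, hi, h⟩ => ⟨⟨i, hi⟩, h⟩, fun ⟨i, h⟩ => ⟨i, i.2, h⟩⟩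

@[simp]
theorem holds_any {t : ℕ → Tm} {k : ℕ} {m : Store} :
    (any t k).Holds n d m ↔ ∃ i : Fin k, (t i).Holds n d m := by
  induction k with
  | zero => simp [any, Holds, den]
  | succ k ih => rw [any, holds_add, ih, Fin.exists_fin_succ', Fin.val_last]; rfl

theorem holds_arr {a : ℕ} {t u : Tm} {m : Store} :
    (arr a t u).Holds n d m ↔ m.arr a (t.den n d m) (u.den n d m) ≠ 0 := Iff.rfl

@[simp]
theorem den_mul {t : Tm} {k : ℕ} {m : Store} : (mul t k).den n d m = k * t.den n d m := by
  induction k with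
  | zero => simp [mul, den]
  | succ k ih => rw [mul, den, ih, Nat.succ_mul]

theorem den_sum_ite {x : ℕ} {c : Tm} {m : Store} {S : Set (Fin n)}
    (h : ∀ i : Fin n, c.Holds n d (m.setVar x i) ↔ i ∈ S) :
    (sum x (ite c (lit 1) (lit 0))).den n d m = S.ncard := by
  classical
  simp only [den]
  rw [← Fin.sum_univ_eq_sum_range (fun i => if c.den n d (m.setVar x i) ≠ 0 then 1 else 0) n,
    Finset.sum_boole, ← Set.ncard_coe_finset]
  simp only [Nat.cast_id]
  congr 1
  ext i
  simpa [Holds] using h i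

/-- The sum counts the values of `y` such that no `x ≤ y` satisfies `c`. These are exactly the
numbers below the least solution, or all `n` numbers if there is none; so the value `n` signals
failure. -/
theorem least_spec {x y : ℕ} (hxy : x ≠ y) {c : Tm} (hy : y ∉ c.vars) (m : Store) :
    (least x y c).den n d m ≤ n ∧
      ((least x y c).den n d m < n → c.Holds n d (m.setVar x ((least x y c).den n d m))) ∧
      ∀ i < (least x y c).den n d m, ¬ c.Holds n d (m.setVar x i) := by
  classical
  have key : ∀ i j, (and (le (v x) (v y)) c).Holds n d ((m.setVar y j).setVar x i) ↔
      i ≤ j ∧ c.Holds n d (m.setVar x i) := by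
    intro i j
    rw [holds_and, holds_le]
    refine and_congr ?_ ?_
    · simp only [den, setVar_var_self, setVar_var_of_ne _ _ hxy.symm]
    · unfold Holds
      rw [den_congr c (m := (m.setVar y j).setVar x i) (m' := m.setVar x i)]
      · intro z hz
        have : z ≠ y := fun h => hy (h ▸ hz)
        simp [Store.setVar, this]
      · intro a _; rfl
  have hden : (least x y c).den n d m =
      ((Finset.range n).filter fun j => ∀ i < n, i ≤ j → ¬ c.Holds n d (m.setVar x i)).card := by
    rw [Finset.card_filter, least, den]
    refine Finset.sum_congr rfl fun j _ => ?_
    rw [not, den, den, den]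
    have : (sum x (and (le (v x) (v y)) c)).den n d (m.setVar y j) ≠ 0 ↔
        ∃ i : Fin n, (i : ℕ) ≤ j ∧ c.Holds n d (m.setVar x i) :=
      holds_sum.trans (exists_congr fun i => key i j)
    by_cases h : ∃ i : Fin n, (i : ℕ) ≤ j ∧ c.Holds n d (m.setVar x i)
    · rw [if_pos (this.mpr h), if_neg]
      obtain ⟨i, h1, h2⟩ := h
      exact fun h' => h' i i.2 h1 h2
    · rw [if_neg (fun h' => h (this.mp h')), if_pos]
      exact fun i hi hij hc => h ⟨⟨i, hi⟩, hij, hc⟩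
  by_cases hex : ∃ i < n, c.Holds n d (m.setVar x i)
  · have hN := Nat.find_spec hex
    have hmin := fun i => Nat.find_min hex (m := i)
    generalize Nat.find hex = N at hN hmin
    have : (least x y c).den n d m = N := by
      rw [hden]
      have : (Finset.range n).filter (fun j => ∀ i < n, i ≤ j → ¬ c.Holds n d (m.setVar x i)) =
          Finset.range N := by
        ext j
        simp only [Finset.mem_filter, Finset.mem_range]
        constructor
        · rintro ⟨_, h⟩
          by_contra hj
          exact h N hN.1 (by omega) hN.2
        · intro hj
          exact ⟨by omega, fun i hi hij hc => hmin i (by omega) ⟨hi, hc⟩⟩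
      rw [this, Finset.card_range]
    rw [this]
    exact ⟨hN.1.le, fun _ => hN.2, fun i hi hc => hmin i hi ⟨by omega, hc⟩⟩
  · push Not at hex
    have : (least x y c).den n d m = n := by
      rw [hden, Finset.filter_true_of_mem fun j _ i hi _ => hex i hi, Finset.card_range]
    rw [this]
    exact ⟨le_rfl, fun h => absurd h (lt_irrefl _), fun i hi => hex i hi⟩

end Tm

/-! ### Tables -/

/-- Fill the array `a` with the values of `t`, which depends on the position `(v 0, v 1)`. -/
def fill (a : ℕ) (t : Tm) : Cmd := .loop 0 (.loop 1 (.cell a (.v 0) (.v 1) t))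

theorem fill_spec {a : ℕ} {t : Tm} (ha : a ∉ t.arrs) (m : Store) {i j : ℕ} (hi : i < n) (hj : j < n) :
    ((fill a t).run n d m).arr a i j = t.den n d ((m.setVar 0 i).setVar 1 j) := by
  -- Only the array `a` and the two loop variables change; since `t` does not read `a`, its values
  -- stay what they were at the beginning.
  let OK : Store → Prop := fun m' =>
    (∀ x, x ≠ 0 → x ≠ 1 → m'.var x = m.var x) ∧ ∀ b, b ≠ a → m'.arr b = m.arr b
  refine (Cmd.run_loop_inv (n := n) (d := d) (x := 0) (P := .loop 1 (.cell a (.v 0) (.v 1) t))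
    (m := m) (fun k m' => OK m' ∧ ∀ i < k, ∀ j < n,
      m'.arr a i j = t.den n d ((m.setVar 0 i).setVar 1 j)) ⟨⟨fun _ _ _ => rfl, fun _ _ => rfl⟩,
      fun i hi => absurd hi (Nat.not_lt_zero i)⟩ ?_).2 i hi j hj
  clear hi hj i j
  intro i hi m₁ ⟨⟨h1, h2⟩, h3⟩
  have := Cmd.run_loop_inv (n := n) (d := d) (x := 1) (P := .cell a (.v 0) (.v 1) t)
    (m := m₁.setVar 0 i) (fun l m' => OK m' ∧ m'.var 0 = i ∧ (∀ i' < i, ∀ j < n,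
      m'.arr a i' j = t.den n d ((m.setVar 0 i').setVar 1 j)) ∧
      ∀ j < l, m'.arr a i j = t.den n d ((m.setVar 0 i).setVar 1 j))
    ⟨⟨fun x hx _ => by rw [setVar_var_of_ne _ _ hx, h1 x hx ‹_›], h2⟩, setVar_var_self _ _ _, h3,
      fun j hj => absurd hj (Nat.not_lt_zero j)⟩ ?_
  · refine ⟨this.1, fun i' hi' j hj => ?_⟩
    rcases Nat.lt_succ_iff_lt_or_eq.mp hi' with h | rfl
    · exact this.2.2.1 i' h j hj
    · exact this.2.2.2 j hj
  intro l hl m₂ ⟨⟨g1, g2⟩, g3, g4, g5⟩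
  have e0 : (m₂.setVar 1 l).var 0 = i := by rw [setVar_var_of_ne _ _ (by decide), g3]
  have hval : t.den n d (m₂.setVar 1 l) = t.den n d ((m.setVar 0 i).setVar 1 l) := by
    refine t.den_congr (fun x _ => ?_) fun b hb => g2 b fun h => ha (h ▸ hb)
    by_cases hx1 : x = 1
    · subst hx1; simp
    by_cases hx0 : x = 0
    · subst hx0
      rw [e0, setVar_var_of_ne _ _ hx1, setVar_var_self]
    · rw [setVar_var_of_ne _ _ hx1, setVar_var_of_ne _ _ hx1, setVar_var_of_ne _ _ hx0, g1 x hx0 hx1]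
  have hrun : (Cmd.cell a (.v 0) (.v 1) t).run n d (m₂.setVar 1 l) =
      (m₂.setVar 1 l).setArr a i l (t.den n d ((m.setVar 0 i).setVar 1 l)) := by
    simp only [Cmd.run, Tm.den, e0, setVar_var_self, hval]
  rw [hrun]
  refine ⟨⟨fun x hx0 hx1 => ?_, fun b hb => ?_⟩, e0, fun i' hi' j hj => ?_, fun j hj => ?_⟩
  · rw [setArr_var, setVar_var_of_ne _ _ hx1, g1 x hx0 hx1]
  · rw [← g2 b hb]
    funext i' j'
    simp [Store.setArr, hb]
  · rw [← g4 i' hi' j hj]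
    have : i' ≠ i := by omega
    simp [Store.setArr, this]
  · by_cases hjl : j = l
    · subst hjl; simp [Store.setArr]
    · rw [← g5 j (by omega)]
      simp [Store.setArr, hjl]

/-- Compute the array `a`; the old contents of `a` may be used. -/
def table (a : ℕ) (t : Tm) : Cmd := .seq (fill 9 t) (fill a (.arr 9 (.v 0) (.v 1)))

/-- The array `9` is a buffer: all values are computed before any entry of `a` is overwritten. -/
theorem table_spec {a : ℕ} {t : Tm} (ha : a ≠ 9) (ht : 9 ∉ t.arrs) (m : Store) (i j : Fin n) :
    ((table a t).run n d m).arr a i j = t.den n d ((m.setVar 0 i).setVar 1 j) := by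
  rw [table, Cmd.run, fill_spec (by simpa [Tm.arrs] using ha) _ i.2 j.2]
  exact fill_spec ht m i.2 j.2

end Programs

end CyclePacking

namespace CyclePacking

open SimpleGraph

/-! ### Distances, cores and balls -/

section Subroutines

variable {n d : ℕ}

/-- Column `0` of the array `a` is an indicator of `S`. -/
def IsSet (m : Store) (a : ℕ) (S : Set (Fin n)) : Prop := ∀ i : Fin n, m.arr a i 0 ≠ 0 ↔ i ∈ S

/-- The array `a` is an adjacency matrix of `H`. -/
def IsAdj (m : Store) (a : ℕ) (H : SimpleGraph (Fin n)) : Prop :=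
  ∀ i j : Fin n, m.arr a i j ≠ 0 ↔ H.Adj i j

/-- The array `a` is the matrix `D`. -/
def IsMatrix (m : Store) (a : ℕ) (D : Fin n → Fin n → ℕ) : Prop := ∀ i j : Fin n, m.arr a i j = D i j

theorem IsSet.congr {m m' : Store} {a : ℕ} {S : Set (Fin n)} (h : IsSet m a S)
    (he : m'.arr a = m.arr a) : IsSet m' a S := by
  unfold IsSet; rw [he]; exact h

theorem IsAdj.congr {m m' : Store} {a : ℕ} {H : SimpleGraph (Fin n)} (h : IsAdj m a H)
    (he : m'.arr a = m.arr a) : IsAdj m' a H := by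
  unfold IsAdj; rw [he]; exact h

theorem IsMatrix.congr {m m' : Store} {a : ℕ} {D : Fin n → Fin n → ℕ} (h : IsMatrix m a D)
    (he : m'.arr a = m.arr a) : IsMatrix m' a D := by
  unfold IsMatrix; rw [he]; exact h

theorem setVar_var (m : Store) (x y k : ℕ) :
    (m.setVar x k).var y = if y = x then k else m.var y := rfl

theorem table_isSet {a : ℕ} {t : Tm} (ha : a ≠ 9) (ht : 9 ∉ t.arrs) {m : Store} {S : Set (Fin n)}
    (h : ∀ i : Fin n, t.Holds n d ((m.setVar 0 i).setVar 1 0) ↔ i ∈ S) :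
    IsSet ((table a t).run n d m) a S := by
  intro i
  rw [← h i]
  have := table_spec (n := n) (d := d) ha ht m i ⟨0, i.pos⟩
  simp only at this
  rw [this]
  rfl

theorem table_isAdj {a : ℕ} {t : Tm} (ha : a ≠ 9) (ht : 9 ∉ t.arrs) {m : Store}
    {H : SimpleGraph (Fin n)}
    (h : ∀ i j : Fin n, t.Holds n d ((m.setVar 0 i).setVar 1 j) ↔ H.Adj i j) :
    IsAdj ((table a t).run n d m) a H := by
  intro i j
  rw [← h i j, table_spec ha ht]
  rfl

instance (t : Tm) (m : Store) : Decidable (t.Holds n d m) := inferInstanceAs (Decidable (_ ≠ 0))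

theorem Tm.den_ite {c t u : Tm} {m : Store} : (ite c t u).den n d m =
    if c.Holds n d m then t.den n d m else u.den n d m := rfl

/-! ### Distances -/

/-- A number larger than all distances and radii that occur. -/
def infty : Tm := .add .size (.mul .dist 3)

/-- Compute the distances in the graph with adjacency matrix `a` into the array `b`. -/
def distances (a b : ℕ) : Cmd :=
  .seq (table b (.ite (.eq (.v 0) (.v 1)) (.lit 0) infty))
    (.loop 4 (table b (.ite (.le (.arr b (.v 0) (.v 1)) (.v 4)) (.arr b (.v 0) (.v 1))
      (.ite (.sum 2 (.and (.arr a (.v 2) (.v 1)) (.le (.arr b (.v 0) (.v 2)) (.v 4))))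
        (.add (.v 4) (.lit 1)) infty))))

open Classical in
/-- The distances up to `k`. -/
noncomputable def distUpTo (H : SimpleGraph (Fin n)) (M k : ℕ) (i j : Fin n) : ℕ :=
  if ∃ p : H.Walk i j, p.length ≤ k then H.dist i j else M

theorem distUpTo_le_iff {H : SimpleGraph (Fin n)} {M k : ℕ} (hk : k < M) {i j : Fin n} :
    distUpTo H M k i j ≤ k ↔ ∃ p : H.Walk i j, p.length ≤ k := by
  unfold distUpTo
  split_ifs with h
  · obtain ⟨p, hp⟩ := h
    exact iff_of_true ((H.dist_le p).trans hp) ⟨p, hp⟩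
  · exact iff_of_false (by omega) h

/-- One round of breadth-first search from all vertices at once: entries at most `k` are final, and
a new vertex is reached through a neighbour that has been reached. `k < M` keeps the default value
from counting as reached. -/
theorem distUpTo_succ {H : SimpleGraph (Fin n)} {M k : ℕ} (hk : k < M) (i j : Fin n)
    [Decidable (∃ z : Fin n, H.Adj z j ∧ distUpTo H M k i z ≤ k)] :
    distUpTo H M (k + 1) i j = if distUpTo H M k i j ≤ k then distUpTo H M k i j else
      if ∃ z : Fin n, H.Adj z j ∧ distUpTo H M k i z ≤ k then k + 1 else M := by
  classical
  simp only [distUpTo_le_iff hk]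
  by_cases h : ∃ p : H.Walk i j, p.length ≤ k
  · obtain ⟨p, hp⟩ := h
    have h1 : ∃ p : H.Walk i j, p.length ≤ k := ⟨p, hp⟩
    have h2 : ∃ p : H.Walk i j, p.length ≤ k + 1 := ⟨p, by omega⟩
    simp only [distUpTo, if_pos h1, if_pos h2]
  · rw [if_neg h]
    by_cases hz : ∃ z : Fin n, H.Adj z j ∧ ∃ p : H.Walk i z, p.length ≤ k
    · rw [if_pos hz]
      obtain ⟨z, hzj, p, hp⟩ := hz
      have h2 : ∃ p : H.Walk i j, p.length ≤ k + 1 := ⟨p.concat hzj, by simpa using hp⟩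
      rw [distUpTo, if_pos h2]
      obtain ⟨q, hq⟩ := h2
      have hle := (H.dist_le q).trans hq
      obtain ⟨r, hr⟩ := q.reachable.exists_walk_length_eq_dist
      have : ¬ r.length ≤ k := fun h' => h ⟨r, h'⟩
      omega
    · rw [if_neg hz, distUpTo, if_neg]
      rintro ⟨p, hp⟩
      have hq : p.reverse.length ≤ k + 1 := by simpa using hp
      generalize p.reverse = q at hq
      cases q with
      | nil => exact h ⟨.nil, by simp⟩
      | cons hadj q => exact hz ⟨_, hadj.symm, q.reverse, by simpa using hq⟩

/-- After `n` rounds the search is complete, as finite distances are less than `n`. -/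
theorem distances_spec {a b : ℕ} (hab : a ≠ b) (ha : a ≠ 9) (hb : b ≠ 9) {m : Store}
    {H : SimpleGraph (Fin n)} (h : IsAdj m a H) :
    IsMatrix ((distances a b).run n d m) b (cappedDist H (n + 3 * d)) := by
  classical
  have hinf : ∀ m : Store, infty.den n d m = n + 3 * d := fun m => by simp [infty, Tm.den]
  have hT : ∀ m', IsAdj m' a H → ∀ (P : Cmd), a ∉ P.arrs → IsAdj (P.run n d m') a H :=
    fun m' h' P hP => h'.congr (P.run_arr m' hP)
  have harr : ∀ t, a ∉ (table b t).arrs := fun t => by simp [table, fill, Cmd.arrs, hab, ha]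
  have := Cmd.run_loop_inv (n := n) (d := d) (x := 4) (P := table b (.ite
    (.le (.arr b (.v 0) (.v 1)) (.v 4)) (.arr b (.v 0) (.v 1))
      (.ite (.sum 2 (.and (.arr a (.v 2) (.v 1)) (.le (.arr b (.v 0) (.v 2)) (.v 4))))
        (.add (.v 4) (.lit 1)) infty)))
    (m := (table b (.ite (.eq (.v 0) (.v 1)) (.lit 0) infty)).run n d m)
    (fun k m' => IsAdj m' a H ∧ IsMatrix m' b (distUpTo H (n + 3 * d) k)) ⟨hT _ h _ (harr _), ?_⟩ ?_
  · refine (fun i j => (this.2 i j).trans ?_)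
    unfold distUpTo cappedDist
    congr 1
    rw [eq_iff_iff]
    refine ⟨fun ⟨p, _⟩ => p.reachable, fun hr => ?_⟩
    obtain ⟨p, hp⟩ := hr.exists_walk_length_eq_dist
    refine ⟨p, ?_⟩
    have := dist_lt_card hr
    rw [Fintype.card_fin] at this
    omega
  · intro i j
    rw [table_spec hb (by simp [Tm.arrs, infty, Tm.mul, Tm.eq, Tm.and, Tm.le, Tm.not]), Tm.den_ite,
      hinf]
    simp only [Tm.holds_eq, Tm.den, setVar_var]
    simp only [distUpTo]
    by_cases hij : i = j
    · subst hij
      simp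
    · have h1 : (i : ℕ) ≠ j := fun h => hij (Fin.ext h)
      have h2 : ¬ ∃ p : H.Walk i j, p.length ≤ 0 := by
        rintro ⟨p, hp⟩
        exact hij (p.eq_of_length_eq_zero (by omega))
      rw [if_neg h2]
      simp [h1]
  · rintro k hk m' ⟨h1, h2⟩
    refine ⟨hT (m'.setVar 4 k) (h1.congr rfl) _ (harr _), fun i j => ?_⟩
    rw [table_spec hb (by
      simp [Tm.arrs, infty, Tm.mul, Tm.and, Tm.le, Tm.not, ha.symm, hb.symm]), Tm.den_ite,
      Tm.den_ite, hinf, distUpTo_succ (by omega)]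
    simp only [Tm.holds_le, Tm.holds_sum, Tm.holds_and, Tm.holds_arr, Tm.den, setVar_var, setVar_arr]
    simp [h2 _ _, h1 _ _]

/-! ### Cores -/

/-- The vertices of `K` with two neighbours in `K`. -/
def prune {V : Type*} (G : SimpleGraph V) (K : Set V) : Set V :=
  {v | v ∈ K ∧ ∃ a ∈ K, ∃ b ∈ K, a ≠ b ∧ G.Adj v a ∧ G.Adj v b}

theorem prune_iterate_subset {V : Type*} (G : SimpleGraph V) (S : Set V) (k : ℕ) :
    (prune G)^[k] S ⊆ S := by
  induction k with
  | zero => exact subset_rfl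
  | succ k ih =>
    rw [Function.iterate_succ_apply']
    exact fun v hv => ih hv.1

theorem IsCore.subset_prune_iterate {V : Type*} {G : SimpleGraph V} {S K : Set V} (hK : IsCore G K)
    (h : K ⊆ S) (k : ℕ) : K ⊆ (prune G)^[k] S := by
  induction k with
  | zero => exact h
  | succ k ih =>
    rw [Function.iterate_succ_apply']
    intro v hv
    obtain ⟨a, ha, b, hb, hab⟩ := hK.2 v hv
    exact ⟨ih hv, a, ih ha, b, ih hb, hab⟩

/-- A round that changes the set loses a vertex, so after as many rounds as there are vertices the
set is stable or empty, and the empty set is stable. -/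
theorem prune_iterate_card {V : Type*} [Fintype V] (G : SimpleGraph V) (S : Set V) :
    prune G ((prune G)^[Fintype.card V] S) = (prune G)^[Fintype.card V] S := by
  classical
  have key : ∀ k, ((prune G)^[k] S).ncard + k ≤ Fintype.card V ∨
      prune G ((prune G)^[k] S) = (prune G)^[k] S := by
    intro k
    induction k with
    | zero =>
      left
      have := Set.ncard_le_card ((prune G)^[0] S)
      rw [Nat.card_eq_fintype_card] at this
      simpa using this
    | succ k ih =>
      rw [Function.iterate_succ_apply']
      by_cases h : prune G ((prune G)^[k] S) = (prune G)^[k] S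
      · right; rw [h, h]
      · left
        have hlt : (prune G ((prune G)^[k] S)).ncard < ((prune G)^[k] S).ncard :=
          Set.ncard_lt_ncard (lt_of_le_of_ne (fun v hv => hv.1) h) (Set.toFinite _)
        have := ih.resolve_right h
        omega
  rcases key (Fintype.card V) with h | h
  · have h0 : (prune G)^[Fintype.card V] S = ∅ :=
      (Set.ncard_eq_zero (Set.toFinite _)).mp (by omega)
    rw [h0]
    exact Set.eq_empty_of_forall_notMem fun v hv => hv.1
  · exact h

theorem isCore_prune_iterate {V : Type*} [Fintype V] {G : SimpleGraph V} {S : Set V}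
    (h : ((prune G)^[Fintype.card V] S).Nonempty) : IsCore G ((prune G)^[Fintype.card V] S) := by
  refine ⟨h, fun v hv => ?_⟩
  rw [← prune_iterate_card] at hv
  exact hv.2

/-- The acyclicity test of the program: every core inside `S` survives pruning, and what is left, if
not empty, is itself a core. -/
theorem not_isAcyclic_iff_prune {V : Type*} [Fintype V] {G : SimpleGraph V} {S : Set V} :
    ¬ (restrict G S).IsAcyclic ↔ ((prune G)^[Fintype.card V] S).Nonempty := by
  constructor
  · intro h
    obtain ⟨K, hKS, hK⟩ := exists_core_of_not_isAcyclic h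
    exact hK.1.mono (hK.subset_prune_iterate hKS _)
  · exact fun h => not_isAcyclic_of_core (prune_iterate_subset G S _) (isCore_prune_iterate h)

/-- Compute the largest core of the set `a` into the array `b`. -/
def core (a b : ℕ) : Cmd :=
  .seq (table b (.arr a (.v 0) (.lit 0)))
    (.loop 4 (table b (.and (.arr b (.v 0) (.lit 0)) (.sum 2 (.and (.arr b (.v 2) (.lit 0))
      (.sum 3 (.and (.arr b (.v 3) (.lit 0)) (.and (.not (.eq (.v 2) (.v 3)))
        (.and (.arr 0 (.v 0) (.v 2)) (.arr 0 (.v 0) (.v 3)))))))))))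

theorem core_spec {a b : ℕ} (ha : a ≠ 9) (hb : b ≠ 9) (hb0 : b ≠ 0) {m : Store}
    {G : SimpleGraph (Fin n)} {S : Set (Fin n)} (hG : IsAdj m 0 G) (hS : IsSet m a S) :
    IsSet ((core a b).run n d m) b ((prune G)^[n] S) := by
  have harr : ∀ t, 0 ∉ (table b t).arrs := fun t => by simp [table, fill, Cmd.arrs, hb0.symm]
  refine (Cmd.run_loop_inv (n := n) (d := d) (fun k m' => IsAdj m' 0 G ∧
    IsSet m' b ((prune G)^[k] S)) ⟨hG.congr (Cmd.run_arr _ _ (harr _)), ?_⟩ ?_).2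
  · refine table_isSet hb (by simpa [Tm.arrs] using ha.symm) fun i => ?_
    simp [Tm.holds_arr, Tm.den, setVar_var, hS i]
  · rintro k hk m' ⟨h1, h2⟩
    refine ⟨(h1.congr rfl).congr (Cmd.run_arr _ _ (harr _)), ?_⟩
    refine table_isSet hb (by simp [Tm.arrs, Tm.and, Tm.eq, Tm.le, Tm.not, hb.symm]) fun i => ?_
    rw [Function.iterate_succ_apply']
    simp [Tm.holds_arr, Tm.den, setVar_var, h2 _, h1 _ _, prune, ← Fin.ext_iff]

/-- Some entry of the set `a` is not zero. -/
def nonempty (a : ℕ) : Tm := .sum 2 (.arr a (.v 2) (.lit 0))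

theorem holds_nonempty {a : ℕ} {m : Store} {S : Set (Fin n)} (hS : IsSet m a S) :
    (nonempty a).Holds n d m ↔ S.Nonempty := by
  simp [nonempty, Tm.holds_arr, Tm.den, hS _, Set.Nonempty]

/-! ### Balls -/

/-- Compute the complement of the ball of radius `r` around the set `a` into the array `b`. -/
def outside (a b : ℕ) (r : Tm) : Cmd :=
  table b (.not (.sum 2 (.and (.arr a (.v 2) (.lit 0)) (.le (.arr 3 (.v 0) (.v 2)) r))))

theorem outside_spec {a b : ℕ} (ha : a ≠ 9) (hb : b ≠ 9) {k : ℕ} (hk : k ≤ 3) {m : Store}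
    {G : SimpleGraph (Fin n)} {S : Set (Fin n)} (hD : IsMatrix m 3 (cappedDist G (n + 3 * d)))
    (hS : IsSet m a S) :
    IsSet ((outside a b (.mul .dist k)).run n d m) b (ball G S (k * d))ᶜ := by
  have hmul : ∀ k, (Tm.mul .dist k).arrs = [] := fun k => by
    induction k with
    | zero => rfl
    | succ k ih => simp [Tm.mul, Tm.arrs, ih]
  refine table_isSet hb (by simp [Tm.arrs, Tm.and, Tm.le, Tm.not, hmul, ha.symm]) fun i => ?_
  simp only [Tm.holds_not, Tm.holds_sum, Tm.holds_and, Tm.holds_le, Tm.holds_arr, Tm.den, Tm.den_mul,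
    setVar_var, setVar_arr]
  simp only [Set.mem_compl_iff, mem_ball_iff]
  refine not_congr (exists_congr fun j => ?_)
  simp only [if_true, hS j]
  refine and_congr Iff.rfl ?_
  have h3 : k * d ≤ 3 * d := Nat.mul_le_mul_right d hk
  have hn := i.pos
  have : (if 0 = 2 then (j : ℕ) else if 0 = 1 then 0 else (i : ℕ)) = i := by simp
  rw [this, hD i j]
  unfold cappedDist
  split_ifs with hr
  · constructor
    · intro h
      obtain ⟨p, hp⟩ := hr.exists_walk_length_eq_dist
      exact ⟨p, hp.trans_le h⟩
    · rintro ⟨p, hp⟩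
      exact (G.dist_le p).trans hp
  -- Vertices in different components carry the entry `n + 3 * d`, which exceeds the radius because
  -- `k ≤ 3` and `0 < n`.
  · exact iff_of_false (by omega) fun ⟨p, _⟩ => hr p.reachable

end Subroutines

end CyclePacking

namespace CyclePacking

open SimpleGraph

/-! ### Reading a cycle off a core, and exhaustive search over tuples -/

section Extraction

variable {n d : ℕ}

/-- Trace a walk in the set `a` that never turns back into the array `8`. -/
def traceWalk (a : ℕ) : Cmd :=
  .seq (.cell 8 (.lit 0) (.lit 0) (.least 2 3 (.arr a (.v 2) (.lit 0))))
    (.loop 4 (.cell 8 (.add (.v 4) (.lit 1)) (.lit 0) (.least 2 3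
      (.and (.arr 0 (.arr 8 (.v 4) (.lit 0)) (.v 2)) (.and (.arr a (.v 2) (.lit 0))
        (.not (.eq (.v 2) (.arr 8 (.sub (.v 4) (.lit 1)) (.lit 0)))))))))

theorem Tm.exists_den_least_eq {x y : ℕ} (hxy : x ≠ y) {c : Tm} (hy : y ∉ c.vars) {m : Store}
    (h : ∃ i : Fin n, c.Holds n d (m.setVar x i)) :
    ∃ z : Fin n, (least x y c).den n d m = z ∧ c.Holds n d (m.setVar x z) := by
  obtain ⟨-, h2, h3⟩ := least_spec (n := n) (d := d) hxy hy m
  obtain ⟨i, hi⟩ := h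
  have hlt : (least x y c).den n d m < n := by
    by_contra hlt
    exact h3 i (by omega) hi
  exact ⟨⟨_, hlt⟩, rfl, h2 hlt⟩

theorem setArr_arr_of_ne (m : Store) {a b : ℕ} (i j k : ℕ) (h : b ≠ a) :
    (m.setArr a i j k).arr b = m.arr b := by
  funext i' j'
  simp [Store.setArr, h]

/-- In a core there is always a neighbour other than the previous vertex, and the program takes the
least one. For `k = 0` the truncated `k - 1` is `0`, and the condition is harmless. -/
theorem traceWalk_spec {a : ℕ} (ha : a ≠ 8) {m : Store} {G : SimpleGraph (Fin n)} {K : Set (Fin n)}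
    (hG : IsAdj m 0 G) (ha' : IsSet m a K) (hK : IsCore G K) :
    ∃ w : ℕ → Fin n, (∀ k ≤ n, ((traceWalk a).run n d m).arr 8 k 0 = w k ∧ w k ∈ K) ∧
      ∀ k < n, G.Adj (w k) (w (k + 1)) ∧ w (k + 1) ≠ w (k - 1) := by
  refine (Cmd.run_loop_inv (n := n) (d := d) (fun k m' => IsAdj m' 0 G ∧ IsSet m' a K ∧
    ∃ w : ℕ → Fin n, (∀ l ≤ k, m'.arr 8 l 0 = w l ∧ w l ∈ K) ∧
      ∀ l < k, G.Adj (w l) (w (l + 1)) ∧ w (l + 1) ≠ w (l - 1)) ⟨?_, ?_, ?_⟩ ?_).2.2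
  · exact hG.congr (setArr_arr_of_ne _ _ _ _ (by decide))
  · exact ha'.congr (setArr_arr_of_ne _ _ _ _ ha)
  · obtain ⟨x, hx⟩ := hK.1
    obtain ⟨z, hz, hzc⟩ := Tm.exists_den_least_eq (n := n) (d := d) (x := 2) (y := 3) (by decide)
      (c := .arr a (.v 2) (.lit 0)) (by simp [Tm.vars]) (m := m)
      ⟨x, by simp [Tm.holds_arr, Tm.den, ha' x, hx]⟩
    have hzK := (ha' z).mp (by simpa [Tm.holds_arr, Tm.den] using hzc)
    refine ⟨fun _ => z, fun l hl => ⟨?_, hzK⟩, fun l hl => absurd hl (Nat.not_lt_zero l)⟩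
    obtain rfl : l = 0 := by omega
    simp [Cmd.run, Store.setArr, Tm.den, hz]
  · rintro k hk m' ⟨h0, h1, w, hw, hadj⟩
    refine ⟨(h0.congr rfl).congr (setArr_arr_of_ne _ _ _ _ (by decide)),
      (h1.congr rfl).congr (setArr_arr_of_ne _ _ _ _ ha), ?_⟩
    have hc : ∀ z : Fin n, (Tm.and (.arr 0 (.arr 8 (.v 4) (.lit 0)) (.v 2)) (.and
        (.arr a (.v 2) (.lit 0)) (.not (.eq (.v 2) (.arr 8 (.sub (.v 4) (.lit 1)) (.lit 0)))))).Holds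
        n d ((m'.setVar 4 k).setVar 2 z) ↔ G.Adj (w k) z ∧ z ∈ K ∧ z ≠ w (k - 1) := by
      intro z
      simp only [Tm.holds_and, Tm.holds_arr, Tm.holds_not, Tm.holds_eq, Tm.den, setVar_var, setVar_arr]
      simp [(hw k le_rfl).1, (hw (k - 1) (by omega)).1, h0 _ _, h1 _, ← Fin.ext_iff]
    obtain ⟨y, hy⟩ : ∃ y, G.Adj (w k) y ∧ y ∈ K ∧ y ≠ w (k - 1) := by
      obtain ⟨y, hy, z, hz, hyz, hay, haz⟩ := hK.2 _ (hw k le_rfl).2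
      by_cases h : y = w (k - 1)
      · exact ⟨z, haz, hz, fun h' => hyz (h.trans h'.symm)⟩
      · exact ⟨y, hay, hy, h⟩
    obtain ⟨z, hz, hzc⟩ := Tm.exists_den_least_eq (n := n) (d := d) (x := 2) (y := 3) (by decide)
      (by simp [Tm.vars, Tm.and, Tm.not, Tm.eq, Tm.le]) ⟨y, (hc y).mpr hy⟩
    rw [hc] at hzc
    have hrun : ∀ l, l ≤ k → Function.update w (k + 1) z l = w l := fun l hl =>
      Function.update_of_ne (by omega) _ _
    refine ⟨Function.update w (k + 1) z, fun l hl => ?_, fun l hl => ?_⟩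
    · simp only [Cmd.run, Store.setArr, Tm.den, hz, setVar_var_self, setVar_arr]
      by_cases h : l = k + 1
      · subst h
        simpa using hzc.2.1
      · rw [hrun l (by omega)]
        simpa [h] using hw l (by omega)
    · rw [hrun l (by omega), hrun (l - 1) (by omega)]
      by_cases h : l = k
      · subst h
        simpa using ⟨hzc.1, hzc.2.2⟩
      · rw [hrun (l + 1) (by omega)]
        exact hadj l (by omega)

theorem holdsList_iff {τ : Store} {a ℓ : ℕ} {l : List (Fin n)} :
    τ.HoldsList a ℓ l ↔ l.map Fin.val = (List.range ℓ).map fun i => τ.arr a i 0 := by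
  have : l.map Fin.val = l.flatMap fun v : Fin n => [v.val] := List.map_eq_flatMap
  rw [this]
  simp only [Store.HoldsList, List.map_id', List.bind_eq_flatMap, List.pure_def]

/-- Find a cycle in the core `a`, and write it into the array `b` and its length into the
variable `x`. -/
def extract (a b x : ℕ) : Cmd :=
  .seq (traceWalk a) <|
  .seq (.assign 5 (.least 2 3 (.sum 6 (.and (.not (.le (.v 2) (.v 6)))
    (.eq (.arr 8 (.v 6) (.lit 0)) (.arr 8 (.v 2) (.lit 0))))))) <|
  .seq (.assign 6 (.least 2 3 (.and (.not (.le (.v 5) (.v 2)))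
    (.eq (.arr 8 (.v 2) (.lit 0)) (.arr 8 (.v 5) (.lit 0)))))) <|
  .seq (.loop 4 (.cell b (.v 4) (.lit 0) (.arr 8 (.add (.v 6) (.v 4)) (.lit 0)))) <|
  .seq (.cell b (.sub (.v 5) (.v 6)) (.lit 0) (.arr 8 (.v 5) (.lit 0)))
    (.assign x (.add (.sub (.v 5) (.v 6)) (.lit 1)))

theorem extract_spec {a b x : ℕ} (ha : a ≠ 8) (hb : b ≠ 8) {m : Store} {G : SimpleGraph (Fin n)}
    {K : Set (Fin n)} (hG : IsAdj m 0 G) (ha' : IsSet m a K) (hK : IsCore G K) :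
    ∃ (u : Fin n) (c : G.Walk u u), c.IsCycle ∧ (∀ y ∈ c.support, y ∈ K) ∧
      ((extract a b x).run n d m).HoldsList b (((extract a b x).run n d m).var x) c.support := by
  obtain ⟨w, hw, hadj⟩ := traceWalk_spec (d := d) ha hG ha' hK
  unfold extract
  rw [Cmd.run]
  generalize (traceWalk a).run n d m = m₁ at hw ⊢
  obtain ⟨i₀, j₀, hij₀, hj₀, hw₀, hinj₀⟩ := exists_first_repeat (n := n) w (by simp)
  have hrep : ∀ k l, k ≤ n → l ≤ n → (m₁.arr 8 k 0 = m₁.arr 8 l 0 ↔ w k = w l) := fun k l hk hl => by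
    rw [(hw k hk).1, (hw l hl).1, Fin.ext_iff]
  obtain ⟨hJ1, hJ2, hJ3⟩ := Tm.least_spec (n := n) (d := d) (x := 2) (y := 3) (by decide)
    (c := .sum 6 (.and (.not (.le (.v 2) (.v 6)))
      (.eq (.arr 8 (.v 6) (.lit 0)) (.arr 8 (.v 2) (.lit 0)))))
    (by simp [Tm.vars, Tm.and, Tm.not, Tm.eq, Tm.le]) m₁
  rw [Cmd.run, Cmd.run]
  generalize Tm.den n d _ m₁ = J at hJ1 hJ2 hJ3 ⊢
  have hcond : ∀ l ≤ n, (Tm.sum 6 (.and (.not (.le (.v 2) (.v 6)))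
      (.eq (.arr 8 (.v 6) (.lit 0)) (.arr 8 (.v 2) (.lit 0))))).Holds n d (m₁.setVar 2 l) ↔
      ∃ k < l, w k = w l := by
    intro l hl
    rw [Tm.holds_sum]
    simp only [Tm.holds_and, Tm.holds_not, Tm.holds_le, Tm.holds_eq, Tm.den, setVar_var, setVar_arr]
    constructor
    · rintro ⟨k, h1, h2⟩
      exact ⟨k, by simpa using h1, (hrep k l k.2.le hl).mp (by simpa using h2)⟩
    · rintro ⟨k, h1, h2⟩
      exact ⟨⟨k, by omega⟩, by simpa using h1, by simpa using (hrep k l (by omega) hl).mpr h2⟩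
  -- `least` searches below `n` only and returns `n` if it finds nothing; by the pigeonhole
  -- principle the first repetition is then at `n`, so this default is the right answer.
  have hJ : ∃ k < J, w k = w J := by
    by_cases h : J < n
    · exact (hcond J hJ1).mp (hJ2 h)
    · by_cases h' : j₀ < J
      · exact absurd ((hcond j₀ hj₀).mpr ⟨i₀, hij₀, hw₀.symm⟩) (hJ3 j₀ h')
      · obtain rfl : j₀ = J := by omega
        exact ⟨i₀, hij₀, hw₀.symm⟩
  have hinj : ∀ k l, k < l → l < J → w k ≠ w l := fun k l hkl hl h =>
    hJ3 l hl ((hcond l (by omega)).mpr ⟨k, hkl, h⟩)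
  have hcondI : ∀ k : Fin n, (Tm.and (.not (.le (.v 5) (.v 2)))
      (.eq (.arr 8 (.v 2) (.lit 0)) (.arr 8 (.v 5) (.lit 0)))).Holds n d
      ((m₁.setVar 5 J).setVar 2 k) ↔ (k : ℕ) < J ∧ w k = w J := by
    intro k
    simp only [Tm.holds_and, Tm.holds_not, Tm.holds_le, Tm.holds_eq, Tm.den, setVar_var, setVar_arr]
    simp [hrep k J k.2.le hJ1]
  obtain ⟨k₀, hk₀⟩ : ∃ k : Fin n, (k : ℕ) < J ∧ w k = w J := by
    obtain ⟨k, hk⟩ := hJ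
    exact ⟨⟨k, by omega⟩, hk⟩
  obtain ⟨I, hI, hIc⟩ := Tm.exists_den_least_eq (n := n) (d := d) (x := 2) (y := 3) (by decide)
    (by simp [Tm.vars, Tm.and, Tm.not, Tm.eq, Tm.le]) ⟨k₀, (hcondI k₀).mpr hk₀⟩
  obtain ⟨hIJ, hIw⟩ := (hcondI I).mp hIc
  rw [Cmd.run, Cmd.run, hI, Cmd.run]
  obtain ⟨g1, g2, g3, g4⟩ := Cmd.run_loop_inv (n := n) (d := d) (x := 4)
    (P := .cell b (.v 4) (.lit 0) (.arr 8 (.add (.v 6) (.v 4)) (.lit 0)))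
    (m := (m₁.setVar 5 J).setVar 6 I)
    (fun k m' => m'.arr 8 = m₁.arr 8 ∧ m'.var 5 = J ∧ m'.var 6 = I ∧
      ∀ l < k, m'.arr b l 0 = m₁.arr 8 (I + l) 0)
    ⟨rfl, by simp [setVar_var], by simp, fun l hl => absurd hl (Nat.not_lt_zero l)⟩ (by
      rintro k hk m' ⟨h1, h2, h3, h4⟩
      refine ⟨?_, ?_, ?_, fun l hl => ?_⟩
      · rw [Cmd.run, setArr_arr_of_ne _ _ _ _ hb.symm, setVar_arr, h1]
      · simpa [Cmd.run, setVar_var] using h2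
      · simpa [Cmd.run, setVar_var] using h3
      · simp only [Cmd.run, Tm.den, Store.setArr, setVar_var, setVar_arr, h1]
        by_cases h : l = k
        · simp [h, h3]
        · simpa [h] using h4 l (by omega))
  generalize Cmd.run n d (.loop 4 _) _ = m₂ at g1 g2 g3 g4
  obtain ⟨c, hc, hs⟩ := exists_cycle_of_seq (G := G) w (i := I) (j := J) hIJ hIw.symm
    (fun k l _ => hinj k l) (fun k _ hk => (hadj k (by omega)).1)
    (fun k _ hk => (hadj (k + 1) (by omega)).2)
  refine ⟨w I, c, hc, fun y hy => ?_, ?_⟩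
  · rw [hs, List.mem_map] at hy
    obtain ⟨k, hk, rfl⟩ := hy
    rw [List.mem_range] at hk
    exact (hw (I + k) (by omega)).2
  · rw [holdsList_iff]
    simp only [Cmd.run, Tm.den, setVar_var_self, setArr_var, setVar_arr, g1, g2, g3]
    rw [hs, List.map_map]
    refine List.map_congr_left fun k hk => ?_
    rw [List.mem_range] at hk
    simp only [Function.comp, Store.setArr]
    -- The last entry is written separately, since the cycle may have `n` vertices, and the copying
    -- loop does not reach position `n`.
    by_cases h : k = J - I
    · subst h
      simp [Nat.add_sub_cancel' hIJ.le, (hw J hJ1).1]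
    · simp only [h, and_false, false_and, if_false]
      rw [g4 k (by omega), (hw _ (by omega)).1]

/-! ### Search through all tuples -/

/-- Run `P` for all values of the variables `x, …, x + k - 1`. -/
def nest (P : Cmd) : ℕ → ℕ → Cmd
  | _, 0 => P
  | x, k + 1 => .loop x (nest P (x + 1) k)

theorem nest_inv {P : Cmd} (I : Store → Prop) (hP : ∀ m, I m → I (P.run n d m)) (k : ℕ) :
    ∀ x, (∀ m, ∀ y ≥ x, ∀ i, I m → I (m.setVar y i)) → ∀ m, I m → I ((nest P x k).run n d m) := by
  induction k with
  | zero => exact fun x _ => hP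
  | succ k ih =>
    intro x hx m hm
    exact Cmd.run_loop_inv (fun _ => I) hm fun i _ m' hm' =>
      ih (x + 1) (fun m y hy => hx m y (by omega)) _ (hx m' x le_rfl i hm')

/-- Each loop passes the value prescribed by `f`; from there on the invariant `I` is strengthened by
this value, so that the innermost run sees the whole tuple. Once established, `R` persists. -/
theorem nest_found {P : Cmd} (R : Store → Prop) (hR : ∀ m, R m → R (P.run n d m)) (k : ℕ) :
    ∀ (x : ℕ) (I : Store → Prop), (∀ y ≥ x, y ∉ P.vars) → (∀ m, I m → I (P.run n d m)) →
      (∀ m, ∀ y ≥ x, ∀ i, I m → I (m.setVar y i)) → (∀ m, ∀ y ≥ x, ∀ i, R m → R (m.setVar y i)) →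
      ∀ f : ℕ → ℕ, (∀ i < k, f i < n) →
      (∀ m, I m → (∀ i < k, m.var (x + i) = f i) → R (P.run n d m)) →
      ∀ m, I m → R ((nest P x k).run n d m) := by
  induction k with
  | zero => exact fun x I _ _ _ _ f _ h m hm => h m hm fun i hi => absurd hi (Nat.not_lt_zero i)
  | succ k ih =>
    intro x I hv hP hI hRx f hf h m hm
    refine (Cmd.run_loop_inv (fun j m' => I m' ∧ (f 0 < j → R m')) ⟨hm, fun h =>
      absurd h (Nat.not_lt_zero _)⟩ fun j hj m' hm' => ⟨?_, fun hlt => ?_⟩).2 (hf 0 (by omega))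
    · exact nest_inv I hP k _ (fun m y hy => hI m y (by omega)) _ (hI m' x le_rfl j hm'.1)
    · by_cases hj0 : f 0 = j
      · refine ih (x + 1) (fun m => I m ∧ m.var x = f 0) (fun y hy => hv y (by omega))
          (fun m hm => ⟨hP m hm.1, by rw [P.run_var m (hv x le_rfl), hm.2]⟩)
          (fun m y hy i hm => ⟨hI m y (by omega) i hm.1, ?_⟩)
          (fun m y hy => hRx m y (by omega)) (fun i => f (i + 1)) (fun i hi => hf _ (by omega))
          (fun m hm hi => h m hm.1 fun i hi' => ?_) _ ⟨hI m' x le_rfl j hm'.1, ?_⟩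
        · rw [setVar_var_of_ne _ _ (by omega), hm.2]
        · cases i with
          | zero => exact hm.2
          | succ i =>
            rw [← hi i (by omega)]
            congr 1
            omega
        · rw [setVar_var_self, hj0]
      · exact nest_inv R hR k _ (fun m y hy => hRx m y (by omega)) _
          (hRx m' x le_rfl j (hm'.2 (by omega)))

/-- Unless the variable `x` is set, run `P` and set `x` if `c` holds. -/
def attempt (x : ℕ) (P : Cmd) (c : Tm) : Cmd :=
  .ite (.v x) .skip (.seq P (.ite c (.assign x (.lit 1)) .skip))

/-- After a success nothing is recomputed, so the arrays of the first successful tuple survive the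
remaining iterations. -/
theorem run_attempt_of_ne {x : ℕ} {P : Cmd} {c : Tm} {m : Store} (h : m.var x ≠ 0) :
    (attempt x P c).run n d m = m := by
  rw [attempt, Cmd.run, Tm.den, if_pos h, Cmd.run]

theorem run_attempt_of_eq {x : ℕ} {P : Cmd} {c : Tm} {m : Store} (h : m.var x = 0) :
    (attempt x P c).run n d m = if c.Holds n d (P.run n d m) then (P.run n d m).setVar x 1
      else P.run n d m := by
  rw [attempt, Cmd.run, Tm.den, if_neg (by simp [h])]
  rfl

/-- A search finds a memory with the property `Q` if it sets the variable `x`, and it does so if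
one of the tuples passes the test. -/
theorem search_spec {x k : ℕ} {P : Cmd} {c : Tm} (hx : x < 20) (hPx : x ∉ P.vars)
    (hP : ∀ z ∈ P.vars, z < 20) (B Q : Store → Prop) (hBv : ∀ m y i, B m → B (m.setVar y i))
    (hQv : ∀ m y i, Q m → Q (m.setVar y i)) (hB : ∀ m, B m → B (P.run n d m))
    (hQ : ∀ m, B m → c.Holds n d (P.run n d m) → Q (P.run n d m)) {m : Store} (hm : B m)
    (hm0 : m.var x = 0) :
    B ((nest (attempt x P c) 20 k).run n d m) ∧
      (((nest (attempt x P c) 20 k).run n d m).var x ≠ 0 →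
        Q ((nest (attempt x P c) 20 k).run n d m)) ∧
      ∀ f : Fin k → Fin n, (∀ m, B m → (∀ i : Fin k, m.var (20 + i) = f i) →
        c.Holds n d (P.run n d m)) → ((nest (attempt x P c) 20 k).run n d m).var x ≠ 0 := by
  have hR : ∀ m : Store, ∀ y ≥ 20, ∀ i, m.var x ≠ 0 → (m.setVar y i).var x ≠ 0 :=
    fun m y hy i h => by rwa [setVar_var_of_ne _ _ (by omega)]
  have hIv : ∀ m : Store, ∀ y ≥ 20, ∀ i, (B m ∧ (m.var x ≠ 0 → Q m)) →
      B (m.setVar y i) ∧ ((m.setVar y i).var x ≠ 0 → Q (m.setVar y i)) := by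
    intro m y hy i ⟨h1, h2⟩
    refine ⟨hBv m y i h1, fun h => hQv m y i (h2 ?_)⟩
    rwa [setVar_var_of_ne _ _ (by omega)] at h
  have hI : ∀ m : Store, (B m ∧ (m.var x ≠ 0 → Q m)) → B ((attempt x P c).run n d m) ∧
      (((attempt x P c).run n d m).var x ≠ 0 → Q ((attempt x P c).run n d m)) := by
    intro m hm
    by_cases h : m.var x = 0
    · rw [run_attempt_of_eq h]
      by_cases hc : c.Holds n d (P.run n d m)
      · rw [if_pos hc]
        exact ⟨hBv _ _ _ (hB m hm.1), fun _ => hQv _ _ _ (hQ m hm.1 hc)⟩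
      · rw [if_neg hc, P.run_var m hPx]
        exact ⟨hB m hm.1, fun h' => absurd h h'⟩
    · rwa [run_attempt_of_ne h]
  obtain ⟨h1, h2⟩ := nest_inv _ hI k 20 hIv m ⟨hm, fun h => absurd hm0 h⟩
  refine ⟨h1, h2, fun f hf => ?_⟩
  refine nest_found (fun m => m.var x ≠ 0) (fun m hm => by rwa [run_attempt_of_ne hm]) k 20
    (fun m => B m ∧ (m.var x ≠ 0 → Q m)) ?_ hI hIv hR (fun i => if hi : i < k then f ⟨i, hi⟩ else 0)
    (fun i hi => by simp [hi]) (fun m hm hv => ?_) m ⟨hm, fun h => absurd hm0 h⟩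
  · intro y hy hmem
    simp only [attempt, Cmd.vars, List.nil_append, List.append_nil, List.mem_append,
      List.mem_singleton] at hmem
    rcases hmem with h | h
    · exact absurd (hP y h) (by omega)
    · omega
  · by_cases h : m.var x = 0
    · rw [run_attempt_of_eq h, if_pos (hf m hm.1 fun i => by simpa using hv i i.2), setVar_var_self]
      exact one_ne_zero
    · rwa [run_attempt_of_ne h]

end Extraction

end CyclePacking

namespace CyclePacking

open SimpleGraph

/-! ### The searches and the correctness of the algorithm -/

section Algorithm

variable {n d : ℕ} {G : SimpleGraph (Fin n)}

/-- The array `0` is the adjacency matrix, and the array `3` is the distance matrix. -/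
def HasDistances (G : SimpleGraph (Fin n)) (d : ℕ) (m : Store) : Prop :=
  IsAdj m 0 G ∧ IsMatrix m 3 (cappedDist G (n + 3 * d))

theorem HasDistances.run {m : Store} (h : HasDistances G d m) {P : Cmd} (h0 : 0 ∉ P.arrs)
    (h3 : 3 ∉ P.arrs) : HasDistances G d (P.run n d m) :=
  ⟨h.1.congr (P.run_arr m h0), h.2.congr (P.run_arr m h3)⟩

theorem IsSet.run {m : Store} {a : ℕ} {S : Set (Fin n)} (h : IsSet m a S) {P : Cmd}
    (ha : a ∉ P.arrs) : IsSet (P.run n d m) a S :=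
  h.congr (P.run_arr m ha)

/-- The vertex `v 0` is between the vertices `v x` and `v y` with respect to the distances `a`. -/
def betweenTm (a x y : ℕ) : Tm :=
  .le (.add (.arr a (.v x) (.v 0)) (.arr a (.v 0) (.v y))) (.arr a (.v x) (.v y))

theorem holds_betweenTm {m : Store} {a x y : ℕ} {D : Fin n → Fin n → ℕ} (hD : IsMatrix m a D)
    {i u w : Fin n} (hi : m.var 0 = i) (hu : m.var x = u) (hw : m.var y = w) :
    (betweenTm a x y).Holds n d m ↔ i ∈ between D u w := by
  rw [betweenTm, Tm.holds_le]
  simp only [Tm.den, hi, hu, hw, hD _ _]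
  rfl

/-! ### Packings -/

/-- The vertex `v 0` is in `cycleSet` for the tuple of the variables `20, …, 33`. -/
def cycleTm : Tm :=
  .add (.add (.add (betweenTm 3 20 21) (betweenTm 3 21 22)) (betweenTm 3 22 23)) (betweenTm 3 23 20)

/-- The vertices `v 0` and `v 1` of the set `10` are adjacent. -/
def restrictTm : Tm :=
  .and (.arr 0 (.v 0) (.v 1)) (.and (.arr 10 (.v 0) (.lit 0)) (.arr 10 (.v 1) (.lit 0)))

/-- The vertex `v 0` is in `chainSet` for the tuple of the variables `20, …, 33`. -/
def chainTm : Tm :=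
  .add (.add (.add (betweenTm 4 24 25) (.add (.add (.add (betweenTm 3 25 28)
    (betweenTm 3 28 29)) (betweenTm 3 29 30)) (betweenTm 3 30 27))) (betweenTm 4 27 26))
    (.add (.add (.add (betweenTm 3 26 31) (betweenTm 3 31 32)) (betweenTm 3 32 33))
      (betweenTm 3 33 24))

/-- Compute the set `chainSet` for the tuple of the variables `20, …, 33` into the array `5`. -/
def chain : Cmd :=
  .seq (table 5 cycleTm) <|
  .seq (outside 5 10 (.mul .dist 1)) <|
  .seq (table 11 restrictTm) <|
  .seq (distances 11 4) (table 5 chainTm)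

/-- The second distance function depends on the tuple: the ball around the set given by its first
four entries is removed before distances are computed again. -/
theorem chain_spec {m : Store} (h : HasDistances G d m) {p : Fin 14 → Fin n}
    (hp : ∀ i : Fin 14, m.var (20 + i) = p i) :
    IsSet (chain.run n d m) 5 (chainSet (cappedDist G (n + 3 * d))
      (cappedDist (awayFromCycle G (n + 3 * d) d p) (n + 3 * d)) p) := by
  unfold chain
  rw [Cmd.run]
  have hp' : ∀ (P : Cmd) (m : Store), (∀ z ∈ P.vars, z < 20) →
      (∀ i : Fin 14, m.var (20 + i) = p i) → ∀ i : Fin 14, (P.run n d m).var (20 + i) = p i :=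
    fun P m hz hp i => by rw [P.run_var m fun hi => absurd (hz _ hi) (by omega), hp]
  have hat : ∀ {m : Store}, (∀ i : Fin 14, m.var (20 + i) = p i) → ∀ i j : ℕ, ∀ k : Fin 14,
      ((m.setVar 0 i).setVar 1 j).var (20 + k) = p k := fun hp i j k => by
    rw [setVar_var_of_ne _ _ (by omega), setVar_var_of_ne _ _ (by omega), hp]
  have key : ∀ {m : Store} {a : ℕ} {D : Fin n → Fin n → ℕ}, IsMatrix m a D →
      (∀ i : Fin 14, m.var (20 + i) = p i) → ∀ (i : Fin n) (k l : Fin 14),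
      (betweenTm a (20 + k) (20 + l)).Holds n d ((m.setVar 0 i).setVar 1 0) ↔
        i ∈ between D (p k) (p l) := fun {m} _ _ hD hp i k l =>
    holds_betweenTm (m := (m.setVar 0 i).setVar 1 0) (hD.congr rfl) rfl (hat hp i 0 k) (hat hp i 0 l)
  have h1 : IsSet ((table 5 cycleTm).run n d m) 5 (cycleSet (cappedDist G (n + 3 * d)) p) := by
    refine table_isSet (by decide) (by decide) fun i => ?_
    have B := key h.2 hp i
    simp only [cycleTm, Tm.holds_add, cycleSet, Set.mem_union]
    exact or_congr (or_congr (or_congr (B 0 1) (B 1 2)) (B 2 3)) (B 3 0)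
  replace h := h.run (P := table 5 cycleTm) (by decide) (by decide)
  replace hp := hp' (table 5 cycleTm) m (by decide) hp
  generalize Cmd.run n d (table 5 _) m = m₁ at h hp h1 ⊢
  rw [Cmd.run]
  have h2 := outside_spec (a := 5) (b := 10) (by decide) (by decide) (k := 1) (by decide) h.2 h1
  replace h := h.run (P := outside 5 10 (.mul .dist 1)) (by decide) (by decide)
  replace hp := hp' (outside 5 10 (.mul .dist 1)) m₁ (by decide) hp
  generalize Cmd.run n d (outside _ _ _) m₁ = m₂ at h hp h2 ⊢
  rw [Cmd.run]
  have h3 : IsAdj ((table 11 restrictTm).run n d m₂) 11 (awayFromCycle G (n + 3 * d) d p) := by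
    refine table_isAdj (by decide) (by decide) fun i j => ?_
    rw [one_mul] at h2
    simp [restrictTm, Tm.holds_arr, Tm.den, setVar_var, h.1 _ _, h2 _, awayFromCycle, restrict]
  replace h := h.run (P := table 11 restrictTm) (by decide) (by decide)
  replace hp := hp' (table 11 restrictTm) m₂ (by decide) hp
  generalize Cmd.run n d (table 11 _) m₂ = m₃ at h hp h3 ⊢
  rw [Cmd.run]
  have h4 := distances_spec (d := d) (a := 11) (b := 4) (by decide) (by decide) (by decide) h3
  replace h := h.run (P := distances 11 4) (by decide) (by decide)
  replace hp := hp' (distances 11 4) m₃ (by decide) hp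
  generalize Cmd.run n d (distances _ _) m₃ = m₄ at h hp h4 ⊢
  refine table_isSet (by decide) (by decide) fun i => ?_
  have B := key h.2 hp i
  have B' := key h4 hp i
  simp only [chainTm, Tm.holds_add, chainSet, Set.mem_union]
  exact or_congr (or_congr (or_congr (B' 4 5) (or_congr (or_congr (or_congr (B 5 8) (B 8 9))
    (B 9 10)) (B 10 7))) (B' 7 6)) (or_congr (or_congr (or_congr (B 6 11) (B 11 12)) (B 12 13))
    (B 13 4))

/-- Compute cores of the set `chainSet` and of the complement of the ball of radius `d` around it
into the arrays `6` and `7`. -/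
def packing : Cmd :=
  .seq chain (.seq (core 5 6) (.seq (outside 5 10 (.mul .dist 1)) (core 10 7)))

/-- The set `S` is whatever the array `5` contains. A successful test is sound for any such set;
only completeness needs to know that it is the chain of the tuple. -/
theorem packing_spec {m : Store} (h : HasDistances G d m) :
    ∃ S : Set (Fin n), IsSet (packing.run n d m) 6 ((prune G)^[n] S) ∧
      IsSet (packing.run n d m) 7 ((prune G)^[n] (ball G S d)ᶜ) ∧
      ∀ p : Fin 14 → Fin n, (∀ i : Fin 14, m.var (20 + i) = p i) →
        S = chainSet (cappedDist G (n + 3 * d))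
          (cappedDist (awayFromCycle G (n + 3 * d) d p) (n + 3 * d)) p := by
  simp only [packing, Cmd.run]
  have hc := fun p => chain_spec (p := p) h
  have h1 := h.run (P := chain) (by decide) (by decide)
  generalize chain.run n d m = m₁ at hc h1 ⊢
  let S : Set (Fin n) := {i | m₁.arr 5 i 0 ≠ 0}
  have hS : IsSet m₁ 5 S := fun i => Iff.rfl
  have h2 := core_spec (d := d) (a := 5) (b := 6) (by decide) (by decide) (by decide) h1.1 hS
  have hS2 := hS.run (d := d) (P := core 5 6) (by decide)
  replace h1 := h1.run (P := core 5 6) (by decide) (by decide)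
  have h3 := outside_spec (a := 5) (b := 10) (by decide) (by decide) (k := 1) (by decide) h1.2 hS2
  rw [one_mul] at h3
  replace h2 := h2.run (d := d) (P := outside 5 10 (.mul .dist 1)) (by decide)
  replace h1 := h1.run (P := outside 5 10 (.mul .dist 1)) (by decide) (by decide)
  have h4 := core_spec (d := d) (a := 10) (b := 7) (by decide) (by decide) (by decide) h1.1 h3
  refine ⟨S, h2.run (d := d) (P := core 10 7) (by decide), h4, fun p hp => ?_⟩
  ext i
  exact hc p hp i

/-- Search for a packing; the variable `10` tells whether it is found. -/
def searchPacking : Cmd := nest (attempt 10 packing (.and (nonempty 6) (nonempty 7))) 20 14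

/-- The arrays `6` and `7` hold cores that are far from each other. -/
def HoldsPacking (G : SimpleGraph (Fin n)) (d : ℕ) (m : Store) : Prop :=
  ∃ S K L : Set (Fin n), IsSet m 6 K ∧ IsSet m 7 L ∧ IsCore G K ∧ IsCore G L ∧ K ⊆ S ∧
    L ⊆ (ball G S d)ᶜ

theorem searchPacking_spec {m : Store} (h : HasDistances G d m) (h0 : m.var 10 = 0) :
    HasDistances G d (searchPacking.run n d m) ∧
      ((searchPacking.run n d m).var 10 ≠ 0 → HoldsPacking G d (searchPacking.run n d m)) ∧
      ∀ p, IsPackingTuple G (n + 3 * d) d p → (searchPacking.run n d m).var 10 ≠ 0 := by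
  have hcard : Fintype.card (Fin n) = n := Fintype.card_fin n
  have hsearch := search_spec (k := 14) (P := packing) (x := 10)
    (c := .and (nonempty 6) (nonempty 7)) (by decide) (by decide) (by decide) (HasDistances G d)
    (HoldsPacking G d) (fun m y i hm => hm) (fun m y i hm => hm)
    (fun m hm => hm.run (by decide) (by decide)) (fun m hm hc => ?_) h h0
  · obtain ⟨h1, h2, h3⟩ := hsearch
    refine ⟨h1, h2, fun p hp => h3 p fun m hm hv => ?_⟩
    obtain ⟨S, h6, h7, hS⟩ := packing_spec hm
    obtain rfl := hS p hv
    rw [Tm.holds_and, holds_nonempty h6, holds_nonempty h7]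
    exact ⟨by simpa only [hcard] using not_isAcyclic_iff_prune.mp hp.1,
      by simpa only [hcard] using not_isAcyclic_iff_prune.mp hp.2⟩
  · obtain ⟨S, h6, h7, -⟩ := packing_spec hm
    rw [Tm.holds_and, holds_nonempty h6, holds_nonempty h7] at hc
    have hK := isCore_prune_iterate (G := G) (S := S) (by rw [hcard]; exact hc.1)
    have hL := isCore_prune_iterate (G := G) (S := (ball G S d)ᶜ) (by rw [hcard]; exact hc.2)
    rw [hcard] at hK hL
    exact ⟨S, _, _, h6, h7, hK, hL, prune_iterate_subset _ _ _, prune_iterate_subset _ _ _⟩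

/-! ### Hitting sets -/

/-- Compute a set into the array `a`, and a core of the complement of the ball of radius `k * d`
around it into the array `7`. -/
def hitting (a k : ℕ) (t : Tm) : Cmd :=
  .seq (table a t) (.seq (outside a 10 (.mul .dist k)) (core 10 7))

theorem hitting_spec {a k : ℕ} (ha : a ∉ [0, 3, 4, 5, 6, 7, 8, 9, 10]) (hk : k ≤ 3) {t : Tm}
    (ht : 9 ∉ t.arrs) {m : Store} (h : HasDistances G d m) {X : Set (Fin n)}
    (hX : ∀ i : Fin n, t.Holds n d ((m.setVar 0 i).setVar 1 0) ↔ i ∈ X) :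
    IsSet ((hitting a k t).run n d m) a X ∧
      (¬ (nonempty 7).Holds n d ((hitting a k t).run n d m) ↔
        (restrict G (ball G X (k * d))ᶜ).IsAcyclic) := by
  simp only [List.mem_cons, List.not_mem_nil, or_false, not_or] at ha
  have h1 := table_isSet (d := d) (a := a) (by tauto) ht hX
  have h2 : HasDistances G d ((table a t).run n d m) :=
    h.run (by simp [table, fill, Cmd.arrs]; tauto) (by simp [table, fill, Cmd.arrs]; tauto)
  have h3 := outside_spec (a := a) (b := 10) (by tauto) (by decide) hk h2.2 h1
  replace h1 := h1.run (d := d) (P := outside a 10 (.mul .dist k))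
    (by simp [outside, table, fill, Cmd.arrs]; tauto)
  replace h2 : HasDistances G d ((outside a 10 (.mul .dist k)).run n d ((table a t).run n d m)) :=
    h2.run (by simp [outside, table, fill, Cmd.arrs]) (by simp [outside, table, fill, Cmd.arrs])
  have h4 := core_spec (d := d) (a := 10) (b := 7) (by decide) (by decide) (by decide) h2.1 h3
  simp only [hitting, Cmd.run]
  refine ⟨h1.run (by simp [core, table, fill, Cmd.arrs]; tauto), ?_⟩
  rw [holds_nonempty h4]
  have := not_isAcyclic_iff_prune (G := G) (S := (ball G X (k * d))ᶜ)
  rw [Fintype.card_fin] at this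
  rw [← this, not_not]

/-- The vertex `v 0` is on one of the geodesics between the vertices of the variables
`20, …, 31` and `32, …, 43`. -/
def geodesicsTm : Tm := .any (fun k => betweenTm 3 (20 + k) (32 + k)) 12

/-- Search for a union of 12 geodesics; the variable `11` tells whether it is found. -/
def searchGeodesics : Cmd :=
  nest (attempt 11 (hitting 1 2 geodesicsTm) (.and (.not (nonempty 7))
    (.le (.sum 2 (.ite (.arr 1 (.v 2) (.lit 0)) (.lit 1) (.lit 0)))
      (.mul (.add .dist (.lit 1)) 12)))) 20 24

/-- The array `a` holds a set of at most `s` vertices that hits all cycles. -/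
def HoldsHitting (G : SimpleGraph (Fin n)) (d a k s : ℕ) (m : Store) : Prop :=
  ∃ X : Set (Fin n), IsSet m a X ∧ X.ncard ≤ s ∧ (restrict G (ball G X (k * d))ᶜ).IsAcyclic

theorem searchGeodesics_spec {m : Store} (h : HasDistances G d m) (h0 : m.var 11 = 0) :
    HasDistances G d (searchGeodesics.run n d m) ∧
      ((searchGeodesics.run n d m).var 11 ≠ 0 →
        HoldsHitting G d 1 2 (12 * (d + 1)) (searchGeodesics.run n d m)) ∧
      ∀ p q : Fin 12 → Fin n,
        (⋃ k, between (cappedDist G (n + 3 * d)) (p k) (q k)).ncard ≤ 12 * (d + 1) →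
        (restrict G (ball G (⋃ k, between (cappedDist G (n + 3 * d)) (p k) (q k)) (2 * d))ᶜ).IsAcyclic →
        (searchGeodesics.run n d m).var 11 ≠ 0 := by
  have key : ∀ m, HasDistances G d m → ∀ X : Set (Fin n),
      (∀ i : Fin n, geodesicsTm.Holds n d ((m.setVar 0 i).setVar 1 0) ↔ i ∈ X) →
      IsSet ((hitting 1 2 geodesicsTm).run n d m) 1 X ∧
      ((Tm.and (.not (nonempty 7)) (.le (.sum 2 (.ite (.arr 1 (.v 2) (.lit 0)) (.lit 1) (.lit 0)))
      (.mul (.add .dist (.lit 1)) 12))).Holds n d ((hitting 1 2 geodesicsTm).run n d m) ↔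
      (restrict G (ball G X (2 * d))ᶜ).IsAcyclic ∧ X.ncard ≤ 12 * (d + 1)) := by
    intro m hm X hX
    obtain ⟨h1, h2⟩ := hitting_spec (a := 1) (k := 2) (by decide) (by decide) (by decide) hm hX
    refine ⟨h1, ?_⟩
    rw [Tm.holds_and, Tm.holds_not, h2, Tm.holds_le, Tm.den_sum_ite (S := X), Tm.den_mul]
    · rfl
    · intro i
      simpa [Tm.holds_arr, Tm.den] using h1 i
  have hsearch := search_spec (n := n) (d := d) (k := 24) (P := hitting 1 2 geodesicsTm)
    (x := 11) (c := .and (.not (nonempty 7))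
      (.le (.sum 2 (.ite (.arr 1 (.v 2) (.lit 0)) (.lit 1) (.lit 0)))
      (.mul (.add .dist (.lit 1)) 12))) (by decide) (by decide) (by decide) (HasDistances G d)
    (HoldsHitting G d 1 2 (12 * (d + 1))) (fun m y i hm => hm) (fun m y i hm => hm)
    (fun m hm => hm.run (by decide) (by decide)) (fun m hm hc => ?_) h h0
  · obtain ⟨h1, h2, h3⟩ := hsearch
    refine ⟨h1, h2, fun p q hcard hac => h3 (Fin.append p q) fun m hm hv => ?_⟩
    refine ((key m hm _ fun i => ?_).2).mpr ⟨hac, hcard⟩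
    rw [geodesicsTm, Tm.holds_any, Set.mem_iUnion]
    refine exists_congr fun k => holds_betweenTm (m := (m.setVar 0 i).setVar 1 0) (hm.2.congr rfl)
      rfl ?_ ?_
    · rw [setVar_var_of_ne _ _ (by omega), setVar_var_of_ne _ _ (by omega)]
      simpa using hv (Fin.castAdd 12 k)
    · rw [setVar_var_of_ne _ _ (by omega), setVar_var_of_ne _ _ (by omega)]
      have := hv (Fin.natAdd 12 k)
      rw [Fin.append_right, Fin.val_natAdd, ← add_assoc] at this
      exact this
  · obtain ⟨h1, h2⟩ := key m hm _ fun i => Iff.rfl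
    exact ⟨_, h1, (h2.mp hc).2, (h2.mp hc).1⟩

/-- The vertex `v 0` is one of the vertices of the variables `20, …, 31`. -/
def pointsTm : Tm := .any (fun k => .eq (.v 0) (.v (20 + k))) 12

/-- Search for 12 vertices; the variable `12` tells whether they are found. -/
def searchPoints : Cmd := nest (attempt 12 (hitting 2 3 pointsTm) (.not (nonempty 7))) 20 12

theorem searchPoints_spec {m : Store} (h : HasDistances G d m) (h0 : m.var 12 = 0) :
    ((searchPoints.run n d m).var 12 ≠ 0 → HoldsHitting G d 2 3 12 (searchPoints.run n d m)) ∧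
      ∀ p : Fin 12 → Fin n, (restrict G (ball G (Set.range p) (3 * d))ᶜ).IsAcyclic →
        (searchPoints.run n d m).var 12 ≠ 0 := by
  have hpt : ∀ (m : Store) (i : Fin n), pointsTm.Holds n d ((m.setVar 0 i).setVar 1 0) ↔
      ∃ k : Fin 12, (i : ℕ) = m.var (20 + k) := by
    intro m i
    rw [pointsTm, Tm.holds_any]
    refine exists_congr fun k => ?_
    rw [Tm.holds_eq, Tm.den, Tm.den, setVar_var_of_ne _ _ (by omega : 20 + (k : ℕ) ≠ 1),
      setVar_var_of_ne _ _ (by omega : 20 + (k : ℕ) ≠ 0)]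
    rfl
  have hsearch := search_spec (n := n) (d := d) (k := 12) (P := hitting 2 3 pointsTm)
    (x := 12) (c := .not (nonempty 7)) (by decide) (by decide) (by decide) (HasDistances G d)
    (HoldsHitting G d 2 3 12) (fun m y i hm => hm) (fun m y i hm => hm)
    (fun m hm => hm.run (by decide) (by decide)) (fun m hm hc => ?_) h h0
  · obtain ⟨-, h2, h3⟩ := hsearch
    refine ⟨h2, fun p hac => h3 p fun m hm hv => ?_⟩
    rw [Tm.holds_not]
    refine ((hitting_spec (a := 2) (k := 3) (by decide) (by decide) (by decide) hm
      fun i => ?_).2).mpr hac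
    rw [hpt]
    exact exists_congr fun k => by rw [hv k, Fin.ext_iff, eq_comm]
  · obtain ⟨h1, h2⟩ := hitting_spec (a := 2) (k := 3) (by decide) (by decide) (by decide) hm
      (X := {i : Fin n | ∃ k : Fin 12, (i : ℕ) = m.var (20 + k)}) (hpt m)
    rw [Tm.holds_not, h2] at hc
    refine ⟨_, h1, ?_, hc⟩
    have hsub : Fin.val '' {i : Fin n | ∃ k : Fin 12, (i : ℕ) = m.var (20 + k)} ⊆
        Set.range fun k : Fin 12 => m.var (20 + k) := by
      rintro _ ⟨i, ⟨k, hk⟩, rfl⟩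
      exact ⟨k, hk.symm⟩
    rw [← Set.ncard_image_of_injective _ Fin.val_injective]
    refine (Set.ncard_le_ncard hsub (Set.finite_range _)).trans ?_
    rw [← Set.image_univ]
    exact (Set.ncard_image_le (Set.toFinite _)).trans (by simp [Set.ncard_univ])

/-! ### The algorithm -/

def algorithm : Cmd :=
  .seq (distances 0 3) <| .seq searchPacking <|
    .ite (.v 10) (.seq (extract 6 1 13) (extract 7 2 14)) (.seq searchGeodesics searchPoints)

/-- Vertices outside `B(S,d)` are more than `d` away from `S`, so any cycle inside `S` and any cycle
outside the ball are distinct and far apart. -/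
theorem isCorrect_cycles {S : Set (Fin n)} {u v : Fin n} {c₁ : G.Walk u u} {c₂ : G.Walk v v}
    (h₁ : c₁.IsCycle) (h₂ : c₂.IsCycle) (hS : ∀ y ∈ c₁.support, y ∈ S)
    (hS' : ∀ y ∈ c₂.support, y ∈ (ball G S d)ᶜ) :
    IsCorrect G d (.cycles c₁.support c₂.support) := by
  have hne : c₁.toSubgraph ≠ c₂.toSubgraph := by
    intro h
    have hu : u ∈ c₂.toSubgraph.verts := by rw [← h]; exact c₁.start_mem_verts_toSubgraph
    exact hS' u ((c₂.mem_verts_toSubgraph).mp hu) (self_mem_ball (hS u c₁.start_mem_support))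
  refine ⟨u, v, c₁, c₂, h₁, h₂, rfl, rfl, hne, ?_, ?_⟩
  · rintro C (rfl | rfl)
    exacts [⟨_, _, h₁, rfl⟩, ⟨_, _, h₂, rfl⟩]
  · rintro C (rfl | rfl) D (rfl | rfl) hCD ⟨x, hx, y, hy, q, -, hq⟩
    · exact hCD rfl
    · rw [Walk.mem_verts_toSubgraph] at hx hy
      exact hS' y hy (mem_ball_iff.mpr ⟨x, hS x hx, q.reverse, by simpa using hq⟩)
    · rw [Walk.mem_verts_toSubgraph] at hx hy
      exact hS' x hx (mem_ball_iff.mpr ⟨y, hS y hy, q, hq⟩)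
    · exact hCD rfl

theorem algorithm_spec (hd : 1 ≤ d) {m : Store} (hG : IsAdj m 0 G) (hv : ∀ x, m.var x = 0) :
    ∃ A : Answer n, IsCorrect G d A ∧ match A with
      | .cycles l₁ l₂ => (algorithm.run n d m).var 10 ≠ 0 ∧
          (algorithm.run n d m).HoldsList 1 ((algorithm.run n d m).var 13) l₁ ∧
          (algorithm.run n d m).HoldsList 2 ((algorithm.run n d m).var 14) l₂
      | .sets X₁ X₂ => (algorithm.run n d m).var 10 = 0 ∧ (algorithm.run n d m).HoldsSet 1 X₁ ∧
          (algorithm.run n d m).HoldsSet 2 X₂ := by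
  classical
  have h1 : HasDistances G d ((distances 0 3).run n d m) :=
    ⟨hG.congr (Cmd.run_arr _ _ (by decide)), distances_spec (by decide) (by decide) (by decide) hG⟩
  have hv1 : ∀ x ∈ [10, 11, 12], ((distances 0 3).run n d m).var x = 0 := fun x hx => by
    rw [Cmd.run_var _ _ (by revert x; decide), hv]
  obtain ⟨h2, hpack, hfound⟩ := searchPacking_spec h1 (hv1 10 (by decide))
  have hv2 : ∀ x ∈ [11, 12], (searchPacking.run n d ((distances 0 3).run n d m)).var x = 0 :=
    fun x hx => by rw [Cmd.run_var _ _ (by revert x; decide), hv1 x (by revert x; decide)]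
  have hrun : algorithm.run n d m = if
      (searchPacking.run n d ((distances 0 3).run n d m)).var 10 ≠ 0 then
      (extract 7 2 14).run n d ((extract 6 1 13).run n d
        (searchPacking.run n d ((distances 0 3).run n d m)))
      else searchPoints.run n d (searchGeodesics.run n d
        (searchPacking.run n d ((distances 0 3).run n d m))) := rfl
  rw [hrun]
  generalize searchPacking.run n d ((distances 0 3).run n d m) = m₂ at h2 hpack hfound hv2 ⊢
  by_cases h10 : m₂.var 10 = 0
  · rw [if_neg (not_not.mpr h10)]
    obtain ⟨h3, hX₁, hfound₁⟩ := searchGeodesics_spec h2 (hv2 11 (by decide))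
    obtain ⟨hX₂, hfound₂⟩ := searchPoints_spec h3
      (by rw [Cmd.run_var _ _ (by decide), hv2 12 (by decide)])
    have hv10 : (searchPoints.run n d (searchGeodesics.run n d m₂)).var 10 = 0 := by
      rw [Cmd.run_var _ _ (by decide), Cmd.run_var _ _ (by decide), h10]
    -- The graph without vertices admits no tuples of vertices, so it is treated apart.
    rcases Nat.eq_zero_or_pos n with rfl | hn
    · refine ⟨.sets ∅ ∅, ⟨by simp, by simp, ?_, ?_⟩, hv10, fun v => v.elim0, fun v => v.elim0⟩
      · exact fun v => v.1.elim0
      · exact fun v => v.1.elim0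
    have : Nonempty (Fin n) := ⟨⟨0, hn⟩⟩
    -- The first search failed, so there is no packing tuple, and the dichotomy provides tuples on
    -- which the other two searches succeed.
    obtain ⟨⟨p, q, hcard, hac⟩, r, hr⟩ : HasHittingTuples G (n + 3 * d) d := by
      rcases hasHittingTuples_or_isPackingTuple (G := G) (M := n + 3 * d) hd (by simp) with h | ⟨p, hp⟩
      · exact h
      · exact absurd h10 (hfound p hp)
    obtain ⟨X₁, hs₁, hc₁, ha₁⟩ := hX₁ (hfound₁ p q hcard hac)
    obtain ⟨X₂, hs₂, hc₂, ha₂⟩ := hX₂ (hfound₂ r hr)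
    replace hs₁ := hs₁.run (d := d) (P := searchPoints) (by decide)
    refine ⟨.sets X₁.toFinset X₂.toFinset, ⟨?_, ?_, ?_, ?_⟩, hv10, fun v => ?_, fun v => ?_⟩
    · rwa [← Set.ncard_eq_toFinset_card']
    · rwa [← Set.ncard_eq_toFinset_card']
    · rw [Set.coe_toFinset]
      exact isAcyclic_induce_iff.mpr ha₁
    · rw [Set.coe_toFinset]
      exact isAcyclic_induce_iff.mpr ha₂
    · rw [Set.mem_toFinset, hs₁ v]
    · rw [Set.mem_toFinset, hs₂ v]
  · rw [if_pos h10]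
    obtain ⟨S, K, L, hK, hL, hKc, hLc, hKS, hLS⟩ := hpack h10
    obtain ⟨u, c₁, hc₁, hs₁, hl₁⟩ := extract_spec (d := d) (a := 6) (b := 1) (x := 13) (by decide)
      (by decide) h2.1 hK hKc
    replace h2 := h2.run (P := extract 6 1 13) (by decide) (by decide)
    replace hL := hL.run (d := d) (P := extract 6 1 13) (by decide)
    obtain ⟨v, c₂, hc₂, hs₂, hl₂⟩ := extract_spec (d := d) (a := 7) (b := 2) (x := 14) (by decide)
      (by decide) h2.1 hL hLc
    refine ⟨.cycles c₁.support c₂.support, isCorrect_cycles hc₁ hc₂ (fun y hy => hKS (hs₁ y hy))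
      (fun y hy => hLS (hs₂ y hy)), ?_, ?_, hl₂⟩
    · rwa [Cmd.run_var _ _ (by decide), Cmd.run_var _ _ (by decide)]
    · unfold Store.HoldsList at hl₁ ⊢
      rwa [Cmd.run_var _ _ (by decide : 13 ∉ (extract 7 2 14).vars),
        Cmd.run_arr _ _ (by decide : 1 ∉ (extract 7 2 14).arrs)]

end Algorithm

end CyclePacking

/-- One program and one polynomial work for all `d` and all finite graphs; the number of steps is
bounded by a polynomial in the number of vertices alone. -/
theorem theorem1p6 :
    ∃ (P : CyclePacking.Prog) (p : Polynomial ℕ),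
      ∀ (d : ℕ), 1 ≤ d → ∀ (n : ℕ) (G : SimpleGraph (Fin n)),
        ∃ (τ : CyclePacking.Store) (t : ℕ) (A : CyclePacking.Answer n),
          CyclePacking.Runs P (CyclePacking.inputStore G d) τ t ∧
          t ≤ p.eval n ∧
          τ.Outputs A ∧
          CyclePacking.IsCorrect G d A := by
  obtain ⟨P, p, hP⟩ := CyclePacking.algorithm.exists_prog 0
  -- The registers 22, 28 and 30 hold the variables 10, 13 and 14, namely the success flag and the
  -- two lengths. Truncated subtraction from `1` turns the flag into the output convention, where
  -- `0` announces cycles.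
  refine ⟨.seq P (.seq (.setVar 1 (.var 28)) (.seq (.setVar 2 (.var 30))
    (.setVar 0 (.sub (.lit 1) (.var 22))))), p + .C 8, fun d hd n G => ?_⟩
  obtain ⟨τ, c, hr, hc, hs, -⟩ := hP n d ⟨fun _ => 0, (CyclePacking.inputStore G d).arr⟩
    (CyclePacking.inputStore G d) ⟨by simp [CyclePacking.inputStore],
      by simp [CyclePacking.inputStore], fun x => by simp [CyclePacking.inputStore], rfl⟩
  obtain ⟨A, hA, hout⟩ := CyclePacking.algorithm_spec (G := G) hd
    (m := ⟨fun _ => 0, (CyclePacking.inputStore G d).arr⟩)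
    (fun i j => by simp [CyclePacking.inputStore]) (fun _ => rfl)
  generalize CyclePacking.Cmd.run n d CyclePacking.algorithm _ = m at hs hout
  have h10 : τ.var 22 = m.var 10 := hs.var 10
  have h13 : τ.var 28 = m.var 13 := hs.var 13
  have h14 : τ.var 30 = m.var 14 := hs.var 14
  refine ⟨_, _, A, .seq hr (.seq (.setVar _ _ _) (.seq (.setVar _ _ _) (.setVar _ _ _))), ?_, ?_, hA⟩
  · simp only [CyclePacking.Expr.cost, Polynomial.eval_add, Polynomial.eval_C]
    omega
  · cases A with
    | cycles l₁ l₂ =>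
      obtain ⟨h0, h1, h2⟩ := hout
      refine ⟨?_, ?_, ?_⟩
      · simp only [CyclePacking.Expr.eval, CyclePacking.Store.setVar]
        simp only [if_true]
        norm_num
        omega
      · simpa [CyclePacking.Store.HoldsList, CyclePacking.Expr.eval, CyclePacking.Store.setVar,
          hs.arr, h13] using h1
      · simpa [CyclePacking.Store.HoldsList, CyclePacking.Expr.eval, CyclePacking.Store.setVar,
          hs.arr, h14] using h2
    | sets X₁ X₂ =>
      obtain ⟨h0, h1, h2⟩ := hout
      refine ⟨?_, ?_, ?_⟩
      · simp [CyclePacking.Expr.eval, CyclePacking.Store.setVar, h10, h0]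
      · simpa [CyclePacking.Store.HoldsSet, CyclePacking.Store.setVar, hs.arr] using h1
      · simpa [CyclePacking.Store.HoldsSet, CyclePacking.Store.setVar, hs.arr] using h2
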